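/- Let $\Sigma$ be an algebra of events on a set $\Omega$, $Z$ a set of outcomes, $L$ the set of finitely supported lotteries on $Z$, and $F$ the set of $\Sigma$-measurable acts $f:\Omega\to L$ with finitely many values; lotteries are identified with constant acts. Acts are mixed statewise, and $f_Eg$ is the act equal to $f$ on $E\in\Sigma$ and to $g$ off $E$. Let $\succsim$ be a binary relation on $F$, with $\succ$, $\sim$ its strict part and indifference. Notions. $f$ is *well-understood* if $f\sim c$ for some constant act $c$. $E\in\Sigma$ is *null* if there are no constant acts $c_1,c_2,c_3$ with $(c_2)_Ec_1\succ (c_3)_Ec_1$. $f\ge g$ means $f(\omega)\succsim g(\omega)$ for all $\omega$; $f\ge^0 g$ means that this holds for all $\omega$ outside some null event. *$f$'s partition* consists of the classes of states on which $f$ gives indifferent lotteries. For $N\in\mathbb N\cup\{\infty\}$, $f$ is *$N$-simple* if its partition has at most $N$ cells; $F_N$ is the set of $N$-simple acts. $\mathrm{simsup}_{N,f}$ is the set of $h\in F_N$ with $h\ge^0 f$ such that no $k\in F_N$ with $k\ge^0 f$ satisfies $h\succ k$; $\mathrm{siminf}_{N,f}$ is the set of $h\in F_N$ with $f\ge^0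 h$ such that no $k\in F_N$ with $f\ge^0 k$ satisfies $k\succ h$. For a finitely additive probability $P$ on $\Sigma$ and $u:Z\to\mathbb R$, write $V_{P,u}(f)=\int_\Omega E_{f(\omega)}[u]\,dP(\omega)$. Axioms. *Basic Conditions*: $\succsim$ is reflexive and transitive; $f\ge g$ implies $f\succsim g$; for all $f,g,h$ the sets $\{\lambda\in[0,1]:\lambda f+(1-\lambda)g\succsim h\}$ and $\{\lambda\in[0,1]:h\succsim\lambda f+(1-\lambda)g\}$ are closed; $f\succ g$ for some $f,g$; $\succsim$ is complete on constant acts; for constant $c_1,c_2$, any $f$ and $\alpha\in(0,1)$, $f\succsim c_1$ (resp. $c_1\succsim f$) iff $\alpha f+(1-\alpha)c_2\succsim\alpha c_1+(1-\alpha)c_2$ (resp. $\alpha c_1+(1-\alpha)c_2\succsim \alpha f+(1-\alpha)c_2$). *Simplicity Conditions*: (A0) for every $E\in\Sigma$ there are constant acts $c\succ d$ with $c_Ed$ well-understood. For every well-understood $f$, with partition $\tau$: (A1) every partition of $\Omega$ into events that is coarser than $\tau$ is the partition of some well-understood act; (A2) if $g$ is well-understood, gives indifferent lotteries on each cell of $\tau$,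 and for some $a\in f(\Omega)$ satisfies $g(\omega)\in\{f(\omega),a\}$ for all $\omega$, then $\alpha f+(1-\alpha)g$ is well-understood for all $\alpha\in(0,1)$; (A3) if $T\ne T'$ in $\tau$ are non-null and $\tau'$ is a partition of $T\cup T'$ into two non-empty events, then $\tau'\cup(\tau\setminus\{T,T'\})$ is the partition of some well-understood act; (A4) if $E$ is null then $g_Ef\sim f$ for all $g\in F$. *S-Independence*: if $f,g,h$, $\alpha f+(1-\alpha)h$, $\alpha g+(1-\alpha)h$ are well-understood, $\alpha\in(0,1)$, then $f\succsim g$ iff $\alpha f+(1-\alpha)h\succsim\alpha g+(1-\alpha)h$. *Uniform Comparability*: if not $f\ge g$, then $f\succsim g$ iff there are well-understood $h,k$ with $f\ge h\succsim k\ge g$. Representation. $(N,P,u)$, with $N\in\{2,3,\dots\}\cup\{\infty\}$, $P$ a finitely additive probability on $\Sigma$ and $u:Z\to\mathbb R$ non-constant, is a *Simple Bounds representation* of $\succsim$ if $\succsim$ is reflexive and transitive, its restriction to lotteries is represented by $l\mapsto E_l[u]$, for every $f$ the sets $\mathrm{siminf}_{N,f}$ and $\mathrm{simsup}_{N,f}$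 are non-empty and $V_{P,u}$ is constant on each of them, and for all $f,g\in F$, $$f\succsim g\iff f\ge g\ \text{ or }\ V_{P,u}(\mathrm{siminf}_{N,f})\ge V_{P,u}(\mathrm{simsup}_{N,g}).$$ **Theorem.** (1) $\succsim$ satisfies the Basic Conditions, the Simplicity Conditions, S-Independence and Uniform Comparability if and only if it has a Simple Bounds representation. (2) $(N,P,u)$ is a Simple Bounds representation of $\succsim$ if and only if $N\ge2$, $u$ is non-constant and, for all $f,g\in F$, $f\succsim g$ iff either $E_{f(\omega)}[u]\ge E_{g(\omega)}[u]$ for all $\omega$, or $V_{P,u}(h)\ge V_{P,u}(k)$ for some $N$-simple lower bound $h$ of $f$ and some $N$-simple upper bound $k$ of $g$, where these bounds ($\mathrm{siminf}_{N,f}$, $\mathrm{simsup}_{N,g}$) are formed for the ranking of acts by $V_{P,u}$ in place of $\succsim$. (3) If $(N,P,u)$ is a Simple Bounds representation of $\succsim$, then every Simple Bounds representation $(N',P',u')$ of $\succsim$ has $P'=P$ and $u'=au+b$ with $a>0$; conversely $(N,P,au+b)$ is one for all $a>0$ and $b$; and $\mathrm{siminf}_{N,f}$ and $\mathrm{simsup}_{N,f}$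 are non-empty for every $f\in F$. -/

import Mathlib

noncomputable section

namespace SimpleBounds

/-- Lotteries: finitely supported probability distributions over the outcomes `Z`. -/
abbrev Lottery (Z : Type*) := Convexity.StdSimplex ℝ Z

/-- Expected utility `E_l u` of a lottery. -/
def Lottery.eu {Z : Type*} (u : Z → ℝ) (l : Lottery Z) : ℝ :=
  l.weights.sum fun z p => p * u z

/-- The mixture `t l + (1 - t) m` of two lotteries. -/
def Lottery.mix {Z : Type*} (t : unitInterval) (l m : Lottery Z) : Lottery Z :=
  Convexity.convexCombPair (t : ℝ) (1 - (t : ℝ)) t.2.1 (sub_nonneg.2 t.2.2)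
    (add_sub_cancel _ _) l m

/-- Finite-valued acts, measurable with respect to the algebra of events `𝓔`. -/
@[ext]
structure Act {Ω : Type*} (𝓔 : BooleanSubalgebra (Set Ω)) (Z : Type*) where
  /-- the lottery obtained in each state -/
  toFun : Ω → Lottery Z
  finite_range : (Set.range toFun).Finite
  measurable : ∀ s : Set (Lottery Z), toFun ⁻¹' s ∈ 𝓔

namespace Act

variable {Ω Z : Type*} {𝓔 : BooleanSubalgebra (Set Ω)}

instance : CoeFun (Act 𝓔 Z) fun _ => Ω → Lottery Z := ⟨Act.toFun⟩

/-- The constant act with value `l`. -/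
def const (𝓔 : BooleanSubalgebra (Set Ω)) (l : Lottery Z) : Act 𝓔 Z where
  toFun _ := l
  finite_range := (Set.finite_singleton l).subset (by rintro _ ⟨ω, rfl⟩; rfl)
  measurable s := by
    by_cases h : l ∈ s
    · rw [Set.preimage_const_of_mem h]; exact 𝓔.top_mem
    · rw [Set.preimage_const_of_notMem h]; exact 𝓔.bot_mem

open Classical in
/-- The act `f_E g`, equal to `f` on the event `E` and to `g` elsewhere. -/
def splice (E : 𝓔) (f g : Act 𝓔 Z) : Act 𝓔 Z where
  toFun ω := if ω ∈ (E : Set Ω) then f ω else g ω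
  finite_range := (f.finite_range.union g.finite_range).subset (by
    rintro _ ⟨ω, rfl⟩
    by_cases h : ω ∈ (E : Set Ω)
    · left; exact ⟨ω, by simp [h]⟩
    · right; exact ⟨ω, by simp [h]⟩)
  measurable s := by
    have h : (fun ω => if ω ∈ (E : Set Ω) then f ω else g ω) ⁻¹' s
        = ((E : Set Ω) ⊓ f.toFun ⁻¹' s) ⊔ ((E : Set Ω)ᶜ ⊓ g.toFun ⁻¹' s) := by
      ext ω
      by_cases h : ω ∈ (E : Set Ω)
      · simp only [Set.mem_preimage, if_pos h]
        exact ⟨fun hs => Or.inl ⟨h, hs⟩, fun hs => hs.elim (·.2) fun h' => absurd h h'.1⟩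
      · simp only [Set.mem_preimage, if_neg h]
        exact ⟨fun hs => Or.inr ⟨h, hs⟩, fun hs => hs.elim (fun h' => absurd h'.1 h) (·.2)⟩
    rw [h]
    exact 𝓔.sup_mem (𝓔.inf_mem E.2 (f.measurable s))
      (𝓔.inf_mem (𝓔.compl_mem E.2) (g.measurable s))

/-- The statewise mixture `t f + (1 - t) g`. -/
def mix (t : unitInterval) (f g : Act 𝓔 Z) : Act 𝓔 Z where
  toFun ω := Lottery.mix t (f ω) (g ω)
  finite_range := (f.finite_range.image2 (Lottery.mix t) g.finite_range).subset (by
    rintro _ ⟨ω, rfl⟩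
    exact ⟨f ω, ⟨ω, rfl⟩, g ω, ⟨ω, rfl⟩, rfl⟩)
  measurable s := by
    have h : (fun ω => Lottery.mix t (f ω) (g ω)) ⁻¹' s
        = f.finite_range.toFinset.sup fun l =>
            f.toFun ⁻¹' {l} ⊓ g.toFun ⁻¹' (Lottery.mix t l ⁻¹' s) := by
      ext ω
      simp only [Finset.sup_eq_iSup, Set.mem_preimage, Set.iSup_eq_iUnion, Set.mem_iUnion]
      constructor
      · intro hs
        exact ⟨f ω, by simp, rfl, hs⟩
      · rintro ⟨l, _, hl, hs⟩
        have hl' : f ω = l := hl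
        rw [hl']
        exact hs
    rw [h]
    exact Finset.sup_induction 𝓔.bot_mem (fun _ ha _ hb => 𝓔.sup_mem ha hb)
      fun l _ => 𝓔.inf_mem (f.measurable _) (g.measurable _)

end Act

section Preference

variable {Ω Z : Type*} {𝓔 : BooleanSubalgebra (Set Ω)} (R : Act 𝓔 Z → Act 𝓔 Z → Prop)

/-- Strict preference. -/
def Strict (f g : Act 𝓔 Z) : Prop := R f g ∧ ¬ R g f

/-- Indifference. -/
def Indiff (f g : Act 𝓔 Z) : Prop := R f g ∧ R g f

/-- `f` is well-understood: it has a certain equivalent. -/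
def WellUnderstood (f : Act 𝓔 Z) : Prop := ∃ c : Lottery Z, Indiff R f (.const 𝓔 c)

/-- The event `E` is null: no preference between bets can be traced back to `E`. -/
def Null (E : 𝓔) : Prop :=
  ¬ ∃ c₁ c₂ c₃ : Lottery Z, Strict R (Act.splice E (.const 𝓔 c₂) (.const 𝓔 c₁))
    (Act.splice E (.const 𝓔 c₃) (.const 𝓔 c₁))

/-- Statewise dominance `f ≥ g`. -/
def Dominates (f g : Act 𝓔 Z) : Prop := ∀ ω, R (.const 𝓔 (f ω)) (.const 𝓔 (g ω))

/-- Statewise dominance outside a null event, `f ≥⁰ g`. -/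
def EssDominates (f g : Act 𝓔 Z) : Prop :=
  ∃ E : 𝓔, Null R E ∧ ∀ ω ∉ (E : Set Ω), R (.const 𝓔 (f ω)) (.const 𝓔 (g ω))

/-- The partition of the act `f`: its cells are the classes of states in which `f` yields
indifferent lotteries (that is, lotteries of the same utility). -/
def partition (f : Act 𝓔 Z) : Set (Set Ω) :=
  Set.range fun ω => {ω' | Indiff R (.const 𝓔 (f ω')) (.const 𝓔 (f ω))}

/-- `f` is `N`-simple: its partition has at most `N` cells (no restriction if `N = ∞`). -/
def NSimple (N : ℕ∞) (f : Act 𝓔 Z) : Prop := (partition R f).encard ≤ N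

/-- The `N`-simple upper bounds of `f`: the `≿`-minimal ones among the `N`-simple acts that
dominate `f` outside a null event. -/
def simSup (N : ℕ∞) (f : Act 𝓔 Z) : Set (Act 𝓔 Z) :=
  {h | NSimple R N h ∧ EssDominates R h f ∧
    ¬ ∃ k, NSimple R N k ∧ EssDominates R k f ∧ Strict R h k}

/-- The `N`-simple lower bounds of `f`: the `≿`-maximal ones among the `N`-simple acts that
are dominated by `f` outside a null event. -/
def simInf (N : ℕ∞) (f : Act 𝓔 Z) : Set (Act 𝓔 Z) :=
  {h | NSimple R N h ∧ EssDominates R f h ∧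
    ¬ ∃ k, NSimple R N k ∧ EssDominates R f k ∧ Strict R k h}

/-- The Basic Conditions. -/
structure BasicConditions : Prop where
  preorder : (∀ f, R f f) ∧ ∀ f g h, R f g → R g h → R f h
  monotonicity : ∀ f g, Dominates R f g → R f g
  archimedean : ∀ f g h, IsClosed {t : unitInterval | R (Act.mix t f g) h} ∧
    IsClosed {t : unitInterval | R h (Act.mix t f g)}
  nontriviality : ∃ f g, Strict R f g
  cCompleteness : ∀ c d : Lottery Z,
    R (.const 𝓔 c) (.const 𝓔 d) ∨ R (.const 𝓔 d) (.const 𝓔 c)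
  weakCIndependence : ∀ (f : Act 𝓔 Z) (c₁ c₂ : Lottery Z) (t : unitInterval), 0 < t → t < 1 →
    (R f (.const 𝓔 c₁) ↔
      R (Act.mix t f (.const 𝓔 c₂)) (Act.mix t (.const 𝓔 c₁) (.const 𝓔 c₂))) ∧
    (R (.const 𝓔 c₁) f ↔
      R (Act.mix t (.const 𝓔 c₁) (.const 𝓔 c₂)) (Act.mix t f (.const 𝓔 c₂)))

/-- The Simplicity Conditions A0-A4. -/
structure SimplicityConditions : Prop where
  a0 : ∀ E : 𝓔, ∃ c d : Lottery Z, Strict R (.const 𝓔 c) (.const 𝓔 d) ∧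
    WellUnderstood R (Act.splice E (.const 𝓔 c) (.const 𝓔 d))
  a1 : ∀ f, WellUnderstood R f → ∀ τ : Set (Set Ω), Setoid.IsPartition τ → (∀ T ∈ τ, T ∈ 𝓔) →
    (∀ T ∈ partition R f, ∃ T' ∈ τ, T ⊆ T') → ∃ g, WellUnderstood R g ∧ partition R g = τ
  a2 : ∀ f g, WellUnderstood R f →
    (∀ T ∈ partition R f, ∀ ω ∈ T, ∀ ω' ∈ T, Indiff R (.const 𝓔 (g ω)) (.const 𝓔 (g ω'))) →
    (∃ a ∈ Set.range f, ∀ ω, g ω = f ω ∨ g ω = a) → WellUnderstood R g →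
    ∀ t : unitInterval, 0 < t → t < 1 → WellUnderstood R (Act.mix t f g)
  a3 : ∀ f, WellUnderstood R f → ∀ T T' : 𝓔, (T : Set Ω) ∈ partition R f →
    (T' : Set Ω) ∈ partition R f → T ≠ T' → ¬ Null R T → ¬ Null R T' →
    ∀ S S' : 𝓔, (S : Set Ω).Nonempty → (S' : Set Ω).Nonempty →
    Disjoint (S : Set Ω) (S' : Set Ω) → (S : Set Ω) ∪ (S' : Set Ω) = (T : Set Ω) ∪ (T' : Set Ω) →
    ∃ g, WellUnderstood R g ∧
      partition R g = {(S : Set Ω), (S' : Set Ω)} ∪ (partition R f \ {(T : Set Ω), (T' : Set Ω)})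
  a4 : ∀ f, WellUnderstood R f → ∀ E : 𝓔, Null R E → ∀ g, Indiff R (Act.splice E g f) f

/-- S-Independence. -/
def SIndependence : Prop :=
  ∀ f g h, WellUnderstood R f → WellUnderstood R g → WellUnderstood R h →
    ∀ t : unitInterval, 0 < t → t < 1 →
    WellUnderstood R (Act.mix t f h) → WellUnderstood R (Act.mix t g h) →
    (R f g ↔ R (Act.mix t f h) (Act.mix t g h))

/-- Uniform Comparability. -/
def UniformComparability : Prop :=
  ∀ f g, ¬ Dominates R f g → (R f g ↔ ∃ h k, WellUnderstood R h ∧ WellUnderstood R k ∧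
    Dominates R f h ∧ R h k ∧ Dominates R k g)

end Preference

/-- Finitely additive probabilities on the algebra of events `𝓔`. -/
@[ext]
structure Prob {Ω : Type*} (𝓔 : BooleanSubalgebra (Set Ω)) where
  /-- the probability of each event -/
  toFun : 𝓔 → ℝ
  nonneg : ∀ E, 0 ≤ toFun E
  univ : toFun ⊤ = 1
  additive : ∀ A B : 𝓔, Disjoint (A : Set Ω) (B : Set Ω) → toFun (A ⊔ B) = toFun A + toFun B

section Representation

variable {Ω Z : Type*} {𝓔 : BooleanSubalgebra (Set Ω)}

/-- `∫ E_{f(ω)} u dP(ω)`, a finite sum because `f` takes finitely many values. -/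
def expectedUtility (P : Prob 𝓔) (u : Z → ℝ) (f : Act 𝓔 Z) : ℝ :=
  ∑ l ∈ f.finite_range.toFinset, P.toFun ⟨f.toFun ⁻¹' {l}, f.measurable {l}⟩ * Lottery.eu u l

/-- The relation that ranks acts by their `P`-expected utility. -/
def euPref (P : Prob 𝓔) (u : Z → ℝ) (f g : Act 𝓔 Z) : Prop :=
  expectedUtility P u g ≤ expectedUtility P u f

/-- `(N, P, u)` is a Simple Bounds representation of the preference (reflexive and transitive
relation) `R`. All simple bounds are those of `R`, in terms of the null events of `R` and the
utility on lotteries. The fields `lower` and `upper` say that the integral over "the" lower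
(upper) simple bound makes sense. -/
structure IsSimpleBoundsRep (R : Act 𝓔 Z → Act 𝓔 Z → Prop) (N : ℕ∞) (P : Prob 𝓔) (u : Z → ℝ) :
    Prop where
  refl : ∀ f, R f f
  trans : ∀ f g h, R f g → R g h → R f h
  two_le : 2 ≤ N
  nonconstant : ∃ z z', u z ≠ u z'
  utility : ∀ l m : Lottery Z, R (.const 𝓔 l) (.const 𝓔 m) ↔ Lottery.eu u m ≤ Lottery.eu u l
  lower : ∀ f, (simInf R N f).Nonempty ∧
    ∀ h ∈ simInf R N f, ∀ h' ∈ simInf R N f, expectedUtility P u h = expectedUtility P u h'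
  upper : ∀ f, (simSup R N f).Nonempty ∧
    ∀ h ∈ simSup R N f, ∀ h' ∈ simSup R N f, expectedUtility P u h = expectedUtility P u h'
  represents : ∀ f g, R f g ↔ Dominates R f g ∨
    ∃ h ∈ simInf R N f, ∃ k ∈ simSup R N g, expectedUtility P u k ≤ expectedUtility P u h

/-- `R` is the relation given explicitly by `(N, P, u)`: simple bounds, null events and dominance
are those of the `P`-expected utility ranking. Nothing else is required of `R`. -/
structure IsExplicitRep (R : Act 𝓔 Z → Act 𝓔 Z → Prop) (N : ℕ∞) (P : Prob 𝓔) (u : Z → ℝ) :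
    Prop where
  two_le : 2 ≤ N
  nonconstant : ∃ z z', u z ≠ u z'
  represents : ∀ f g, R f g ↔ (∀ ω, Lottery.eu u (g ω) ≤ Lottery.eu u (f ω)) ∨
    ∃ h ∈ simInf (euPref P u) N f, ∃ k ∈ simSup (euPref P u) N g,
      expectedUtility P u k ≤ expectedUtility P u h

end Representation

end SimpleBounds

end

/-! ### Expected utility on lotteries: the von Neumann-Morgenstern theorem -/

noncomputable section

namespace SimpleBounds

namespace Lottery

open Convexity

variable {Z : Type*}

/-! Everything passes through utility profiles ω ↦ E_{f(ω)}[u]. For a profile, `Prob.lower` is the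
largest integral of a function with at most N values lying below it outside a null set, and
`Prob.upper` is its dual. The pivot is `IsBoundRep`: f ≿ g iff the profile of f dominates that of g
or the upper value of g is at most the lower value of f. Optima exist because any N-valued lower
function can be rounded, without loss, to a function of the profile with values among those of the
profile (`Prob.IsLower.exists_comp`). Finitely many candidates remain, and each is the profile of an
act. Hence the explicit representation is the same as `IsBoundRep`.

For (2), the difficulty is that a Simple Bounds representation forms its bounds with the null events
and strict preference of R itself. Constancy of expected utility on the lower bounds of a constant
act forces null events to have probability zero, and a study of bets gives the converse. Then R is
shown to rank N-simple acts by expected utility (`IsSimpleBoundsRep.rel_iff_of_nsimple`), so both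
kinds of bounds agree. Uniqueness in (3) is calibration, by lotteries for u and by bets for P.

Necessity in (1): under `IsBoundRep` an act is well-understood iff its profile takes at most N
values with positive probability (`IsBoundRep.wellUnderstood_iff`). The axioms are then checked one
by one.

Sufficiency in (1): von Neumann-Morgenstern on constant acts gives u. Weak C-Independence carries
certainty equivalents along positive affine maps of profiles, so that one may speak of feasible real
functions (those of well-understood acts) and of their values. S-Independence makes values additive,
and A0 then yields P from bets. By A1, A2 and a lemma on vectors
(`ContractionStable.mem_of_injective_mem`), feasibility depends only on the partition and passes to
coarser ones, so feasible functions are valued by their integral. By A4 null cells do not matter. By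
A3 and a lemma on surjections (`surjective_mem_of_update_mem`), only the number of essential cells
matters. So feasible means having at most N essential values, N being the supremum that occurs, and
Uniform Comparability turns this into `IsBoundRep`. -/

lemma weights_mix (t : unitInterval) (l m : Lottery Z) :
    (mix t l m).weights = (t : ℝ) • l.weights + (1 - (t : ℝ)) • m.weights := by
  simp [mix]

lemma eu_mix (u : Z → ℝ) (t : unitInterval) (l m : Lottery Z) :
    eu u (mix t l m) = t * eu u l + (1 - t) * eu u m := by
  classical
  unfold eu
  rw [weights_mix, Finsupp.sum_add_index' (by simp) (by intros; ring),
    Finsupp.sum_smul_index (by simp), Finsupp.sum_smul_index (by simp), Finsupp.mul_sum,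
    Finsupp.mul_sum]
  simp only [mul_assoc]

lemma eu_single (u : Z → ℝ) (z : Z) : eu u (StdSimplex.single z) = u z := by
  simp [eu]

lemma eu_affine (u : Z → ℝ) (a b : ℝ) (l : Lottery Z) :
    eu (fun z => a * u z + b) l = a * eu u l + b := by
  have h : b = b * l.weights.sum fun _ p => p := by rw [l.total, mul_one]
  conv_rhs => rw [h]
  unfold eu
  rw [Finsupp.mul_sum, Finsupp.mul_sum, ← Finsupp.sum_add]
  exact Finsupp.sum_congr fun z _ => by ring

lemma eu_neg (u : Z → ℝ) (l : Lottery Z) : eu (fun z => - u z) l = - eu u l := by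
  simpa using eu_affine u (-1) 0 l

lemma exists_eu_eq (u : Z → ℝ) {l m : Lottery Z} {y : ℝ} (hl : eu u l ≤ y) (hm : y ≤ eu u m) :
    ∃ n, eu u n = y := by
  rcases eq_or_lt_of_le (hl.trans hm) with h | h
  · exact ⟨l, le_antisymm hl (h ▸ hm)⟩
  · have h0 : 0 < eu u m - eu u l := sub_pos.2 h
    refine ⟨mix ⟨(y - eu u l) / (eu u m - eu u l), div_nonneg (by linarith) h0.le,
      (div_le_one h0).2 (by linarith)⟩ m l, ?_⟩
    rw [eu_mix]
    field_simp
    ring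

lemma mix_self (t : unitInterval) (l : Lottery Z) : mix t l l = l := by
  ext1; rw [weights_mix]; module

lemma mix_one (l m : Lottery Z) : mix 1 l m = l := by
  ext1; rw [weights_mix]; simp

lemma mix_zero (l m : Lottery Z) : mix 0 l m = m := by
  ext1; rw [weights_mix]; simp

lemma mix_symm (t : unitInterval) (l m : Lottery Z) :
    mix (unitInterval.symm t) l m = mix t m l := by
  ext1; simp only [weights_mix, unitInterval.coe_symm_eq]; module

/-- A functional on lotteries that respects mixtures is an expected utility. -/
lemma eq_eu_of_mix {U : Lottery Z → ℝ}
    (hU : ∀ (t : unitInterval) l m, U (mix t l m) = t * U l + (1 - t) * U m) (l : Lottery Z) :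
    U l = eu (fun z => U (StdSimplex.single z)) l := by
  classical
  induction hn : l.weights.support.card using Nat.strong_induction_on generalizing l with
  | _ n ih =>
  obtain ⟨z, hz⟩ := l.support_weights_nonempty
  by_cases hs : l.weights.support = {z}
  · rw [StdSimplex.support_weights_eq_singleton.1 hs, eu_single]
  · have h1 : ∃ x ∈ ({z} : Set Z), l.weights x ≠ 0 := ⟨z, rfl, by simpa using hz⟩
    have h2 : ∃ x ∈ ({z} : Set Z)ᶜ, l.weights x ≠ 0 := by
      by_contra! h
      refine hs (Finset.eq_singleton_iff_unique_mem.2 ⟨hz, fun x hx => ?_⟩)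
      by_contra hne
      exact (Finsupp.mem_support_iff.1 hx) (h x hne)
    -- Split off the atom z: l is a mixture of the point mass at z and of its conditional on the
    -- complement, whose support is smaller.
    have key := StdSimplex.convexCombPair_restrict_restrict_compl l {z} h1 h2
    set s : ℝ := (l.weights.filter (· ∈ ({z} : Set Z))).sum fun _ k => k with hs'
    set s' : ℝ := (l.weights.filter (· ∉ ({z} : Set Z))).sum fun _ k => k with hs''
    have hs0 : 0 ≤ s := Finsupp.sum_nonneg fun i _ => by
      rw [Finsupp.filter_apply]; split_ifs <;> simp
    have hs0' : 0 ≤ s' := Finsupp.sum_nonneg fun i _ => by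
      rw [Finsupp.filter_apply]; split_ifs <;> simp
    have hss : s + s' = 1 := by
      have : l.weights.filter (· ∈ ({z} : Set Z)) + l.weights.filter (· ∉ ({z} : Set Z))
          = l.weights := Finsupp.filter_add_filter_not _ _
      rw [← l.total]
      conv_rhs => rw [← this]
      rw [Finsupp.sum_add_index' (by simp) (by simp)]
    have hmix : mix ⟨s, hs0, by linarith⟩ (l.restrict {z} h1) (l.restrict {z}ᶜ h2) = l := by
      conv_rhs => rw [← key]
      ext1
      rw [weights_mix, StdSimplex.weights_convexCombPair, ← hs', ← hs'']
      exact congrArg (fun x => s • (l.restrict {z} h1).weights + x • (l.restrict {z}ᶜ h2).weights)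
        (sub_eq_of_eq_add' hss.symm)
    rw [← hmix, hU, eu_mix, StdSimplex.restrict_singleton, eu_single]
    congr 2
    refine ih _ ?_ _ rfl
    rw [← hn, StdSimplex.support_weights_restrict]
    exact Finset.card_lt_card (Finset.filter_ssubset.2 ⟨z, hz, by simp⟩)

section VonNeumannMorgenstern

variable {r : Lottery Z → Lottery Z → Prop}

/-- The von Neumann-Morgenstern conditions on a relation between lotteries. -/
structure IsVNM (r : Lottery Z → Lottery Z → Prop) : Prop where
  refl : ∀ l, r l l
  trans : ∀ {l m n}, r l m → r m n → r l n
  total : ∀ l m, r l m ∨ r m l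
  closed : ∀ l m n, IsClosed {t : unitInterval | r (mix t l m) n} ∧
    IsClosed {t : unitInterval | r n (mix t l m)}
  indep : ∀ (l m n) (t : unitInterval), 0 < t → t < 1 → (r l m ↔ r (mix t l n) (mix t m n))

namespace IsVNM

lemma indep' (h : IsVNM r) (l m n : Lottery Z) {t : unitInterval} (ht : 0 < t) :
    r l m ↔ r (mix t l n) (mix t m n) := by
  rcases eq_or_lt_of_le (unitInterval.le_one' (t := t)) with h1 | h1
  · subst h1; rw [mix_one, mix_one]
  · exact h.indep l m n t ht h1

/-- Independence, mixing with d, puts the point t strictly above d. The point s is a mixture of the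
point t with d, so a second use, mixing with the point t, puts it strictly below. -/
lemma segment_strict (h : IsVNM r) {c d : Lottery Z} (hcd : ¬ r d c) {s t : unitInterval}
    (hst : s < t) : ¬ r (mix s c d) (mix t c d) := by
  have ht : 0 < t := lt_of_le_of_lt unitInterval.nonneg' hst
  have ht' : (0 : ℝ) < t := ht
  have hst' : (s : ℝ) < t := hst
  have h1 : ¬ r d (mix t c d) := by
    rw [h.indep' d c d ht, mix_self] at hcd; exact hcd
  set q : unitInterval := ⟨s / t, div_nonneg s.2.1 ht'.le, (div_le_one ht').2 hst'.le⟩ with hq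
  have hq1 : q < 1 := (div_lt_one ht').2 hst'
  have hmix : mix s c d = mix q (mix t c d) d := by
    ext1
    simp only [weights_mix, hq]
    have : (s : ℝ) = s / t * t := by field_simp
    rw [smul_add, smul_smul, smul_smul, ← this, add_assoc, ← add_smul]
    congr 2
    field_simp; ring
  rw [hmix, ← mix_symm]
  have h3 : 0 < unitInterval.symm q := by
    rw [← unitInterval.coe_pos, unitInterval.coe_symm_eq]; exact sub_pos.2 hq1
  rw [h.indep' _ _ (mix t c d) h3, mix_self] at h1
  exact h1

lemma segment_iff (h : IsVNM r) {c d : Lottery Z} (hcd : ¬ r d c) {s t : unitInterval} :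
    r (mix t c d) (mix s c d) ↔ s ≤ t := by
  constructor
  · intro h1; by_contra! h2; exact h.segment_strict hcd h2 h1
  · intro h1
    rcases eq_or_lt_of_le h1 with rfl | h1
    · exact h.refl _
    · exact ((h.total _ _).resolve_left (h.segment_strict hcd h1))

/-- The lottery `l` has value `y` on the scale on which `c` has value `1` and `d` value `0`. -/
def HasValue (r : Lottery Z → Lottery Z → Prop) (c d l : Lottery Z) (s : unitInterval) (y : ℝ) :
    Prop :=
  ∃ q : unitInterval, (q : ℝ) = s * y + (1 - s) / 2 ∧
    r (mix s l (mix ⟨1 / 2, by norm_num, by norm_num⟩ c d)) (mix q c d) ∧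
    r (mix q c d) (mix s l (mix ⟨1 / 2, by norm_num, by norm_num⟩ c d))

/-- Mixing both sides once more with the midpoint changes s but not y. Any two lotteries can
therefore be compared at a common small s. -/
lemma hasValue_mono (h : IsVNM r) {c d l : Lottery Z} {s t : unitInterval} {y : ℝ}
    (hs : 0 < s) (hst : s ≤ t) (hv : HasValue r c d l t y) : HasValue r c d l s y := by
  obtain ⟨q, hq, h1, h2⟩ := hv
  set mid := mix ⟨1 / 2, by norm_num, by norm_num⟩ c d with hmid
  have hs' : (0 : ℝ) < s := hs
  have hst' : (s : ℝ) ≤ t := hst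
  have ht' : (0 : ℝ) < t := hs'.trans_le hst'
  set k : unitInterval := ⟨s / t, div_nonneg hs'.le ht'.le, (div_le_one ht').2 hst'⟩ with hk
  have hk0 : 0 < k := div_pos hs' ht'
  have hkt : (k : ℝ) * t = s := by simp only [hk]; field_simp
  have e1 : mix k (mix t l mid) mid = mix s l mid := by
    ext1
    simp only [weights_mix]
    rw [← hkt]; module
  have hb : (0 : ℝ) ≤ k * q + (1 - k) / 2 ∧ (k : ℝ) * q + (1 - k) / 2 ≤ 1 := by
    have := k.2.1; have := k.2.2; have := q.2.1; have := q.2.2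
    constructor <;> nlinarith
  have e2 : mix k (mix q c d) mid = mix ⟨k * q + (1 - k) / 2, hb⟩ c d := by
    ext1
    simp only [weights_mix, hmid]
    module
  refine ⟨⟨k * q + (1 - k) / 2, hb⟩, ?_, ?_, ?_⟩
  · simp only [hq, ← hkt]; ring
  · rw [← e1, ← e2]; exact (h.indep' _ _ _ hk0).1 h1
  · rw [← e1, ← e2]; exact (h.indep' _ _ _ hk0).1 h2

/-- The midpoint of c and d is strictly between them, so by closedness it stays there after a small
admixture of l. Connectedness of [0,1] then gives an indifferent point of the segment. Working near
the midpoint treats lotteries beyond c or d like all others. -/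
lemma exists_hasValue (h : IsVNM r) {c d : Lottery Z} (hcd : ¬ r d c) (l : Lottery Z) :
    ∃ (s : unitInterval) (y : ℝ), 0 < s ∧ HasValue r c d l s y := by
  set mid := mix ⟨1 / 2, by norm_num, by norm_num⟩ c d with hmid
  have hc : ¬ r mid c := by
    have := h.segment_strict hcd (s := ⟨1 / 2, by norm_num, by norm_num⟩) (t := 1)
      (by rw [← Subtype.coe_lt_coe]; norm_num)
    rwa [mix_one] at this
  have hd : ¬ r d mid := by
    have := h.segment_strict hcd (s := 0) (t := ⟨1 / 2, by norm_num, by norm_num⟩)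
      (by rw [← Subtype.coe_lt_coe]; norm_num)
    rwa [mix_zero] at this
  have hopen : IsOpen ({t : unitInterval | r (mix t l mid) c}ᶜ ∩
      {t : unitInterval | r d (mix t l mid)}ᶜ) :=
    (h.closed l mid c).1.isOpen_compl.inter (h.closed l mid d).2.isOpen_compl
  have h0 : (0 : unitInterval) ∈ {t : unitInterval | r (mix t l mid) c}ᶜ ∩
      {t : unitInterval | r d (mix t l mid)}ᶜ := by
    simp only [Set.mem_inter_iff, Set.mem_compl_iff, Set.mem_ofPred_eq, mix_zero]
    exact ⟨hc, hd⟩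
  obtain ⟨s, hs, hs0⟩ : ∃ s : unitInterval, s ∈ ({t : unitInterval | r (mix t l mid) c}ᶜ ∩
      {t : unitInterval | r d (mix t l mid)}ᶜ) ∧ 0 < s := by
    obtain ⟨ε, hε, hball⟩ := Metric.isOpen_iff.1 hopen 0 h0
    refine ⟨⟨min (ε / 2) 1, by positivity, min_le_right _ _⟩, hball ?_, ?_⟩
    · rw [Metric.mem_ball, Subtype.dist_eq, Real.dist_eq]
      simp only [Set.Icc.coe_zero, sub_zero]
      rw [abs_of_pos (by positivity)]
      exact (min_le_left _ _).trans_lt (by linarith)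
    · rw [← Subtype.coe_lt_coe]; simpa using hε
  simp only [Set.mem_inter_iff, Set.mem_compl_iff, Set.mem_ofPred_eq] at hs
  have hx1 := (h.total _ _).resolve_left hs.1
  have hx2 := (h.total _ _).resolve_left hs.2
  obtain ⟨q, -, hq1, hq2⟩ : (Set.univ ∩ ({t : unitInterval | r (mix t c d) (mix s l mid)} ∩
      {t : unitInterval | r (mix s l mid) (mix t c d)})).Nonempty := by
    refine isPreconnected_closed_iff.1 isPreconnected_univ _ _ (h.closed c d _).1
      (h.closed c d _).2 ?_ ⟨1, trivial, by simpa [mix_one] using hx1⟩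
      ⟨0, trivial, by simpa [mix_zero] using hx2⟩
    intro t _
    exact h.total _ _
  have hs' : (0 : ℝ) < s := hs0
  -- The value solves q = s * y + (1 - s) / 2.
  exact ⟨s, (q - (1 - s) / 2) / s, hs0, q, by field_simp; ring, hq2, hq1⟩

/-- The von Neumann-Morgenstern theorem for finitely supported lotteries. -/
theorem exists_utility (h : IsVNM r) : ∃ u : Z → ℝ, ∀ l m, r l m ↔ eu u m ≤ eu u l := by
  by_cases hne : ∃ c d, ¬ r d c
  · obtain ⟨c, d, hcd⟩ := hne
    choose s y hs hv using h.exists_hasValue hcd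
    have hiff : ∀ {l m : Lottery Z} {t : unitInterval} {a b : ℝ}, 0 < t →
        HasValue r c d l t a → HasValue r c d m t b → (r l m ↔ b ≤ a) := by
      rintro l m t a b ht ⟨q, hq, h1, h2⟩ ⟨q', hq', h1', h2'⟩
      have ht' : (0 : ℝ) < t := ht
      rw [h.indep' l m _ ht]
      have : r (mix q c d) (mix q' c d) ↔ b ≤ a := by
        rw [h.segment_iff hcd, ← Subtype.coe_le_coe, hq, hq', add_le_add_iff_right,
          mul_le_mul_iff_right₀ ht']
      rw [← this]
      exact ⟨fun hx => h.trans h2 (h.trans hx h1'), fun hx => h.trans h1 (h.trans hx h2')⟩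
    have hy : ∀ l m, r l m ↔ y m ≤ y l := fun l m => by
      have ht : 0 < min (s l) (s m) := lt_min (hs l) (hs m)
      exact hiff ht (h.hasValue_mono ht (min_le_left _ _) (hv l))
        (h.hasValue_mono ht (min_le_right _ _) (hv m))
    have hmix : ∀ (k : unitInterval) l m, y (mix k l m) = k * y l + (1 - k) * y m := by
      intro k l m
      set t := min (s (mix k l m)) (min (s l) (s m)) with htdef
      have ht : 0 < t := lt_min (hs _) (lt_min (hs l) (hs m))
      obtain ⟨q, hq, h1, h2⟩ := h.hasValue_mono ht
        ((min_le_right _ _).trans (min_le_left _ _)) (hv l)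
      obtain ⟨q', hq', h1', h2'⟩ := h.hasValue_mono ht
        ((min_le_right _ _).trans (min_le_right _ _)) (hv m)
      have h3 := h.hasValue_mono ht (min_le_left _ _) (hv (mix k l m))
      set mid := mix ⟨1 / 2, by norm_num, by norm_num⟩ c d with hmid
      -- Mixing the calibrations of l and m calibrates the mixture. At a fixed scale the value is
      -- unique, by `hiff` and reflexivity, so y respects mixtures.
      have hval : HasValue r c d (mix k l m) t (k * y l + (1 - k) * y m) := by
        have hb : (0 : ℝ) ≤ k * q + (1 - k) * q' ∧ (k : ℝ) * q + (1 - k) * q' ≤ 1 := by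
          have := k.2.1; have := k.2.2; have := q.2.1; have := q.2.2
          have := q'.2.1; have := q'.2.2
          constructor <;> nlinarith
        have e1 : mix t (mix k l m) mid = mix k (mix t l mid) (mix t m mid) := by
          ext1; simp only [weights_mix]; module
        have e2 : mix ⟨k * q + (1 - k) * q', hb⟩ c d = mix k (mix q c d) (mix q' c d) := by
          ext1; simp only [weights_mix]; module
        have hcong : ∀ {a a' b b' : Lottery Z}, r a a' → r b b' → r (mix k a b) (mix k a' b') := by
          intro a a' b b' ha hb
          rcases eq_or_lt_of_le (unitInterval.nonneg' (t := k)) with h0 | h0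
          · rw [← h0, mix_zero, mix_zero]; exact hb
          · rcases eq_or_lt_of_le (unitInterval.le_one' (t := k)) with h0' | h0'
            · rw [h0', mix_one, mix_one]; exact ha
            · refine h.trans ((h.indep' a a' b h0).1 ha) ?_
              have h3 : 0 < unitInterval.symm k := by
                rw [← unitInterval.coe_pos, unitInterval.coe_symm_eq]; exact sub_pos.2 h0'
              rw [← mix_symm k b a', ← mix_symm k b' a']
              exact (h.indep' b b' a' h3).1 hb
        refine ⟨⟨k * q + (1 - k) * q', hb⟩, ?_, ?_, ?_⟩
        · simp only [hq, hq']; ring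
        · rw [e1, e2]; exact hcong h1 h1'
        · rw [e1, e2]; exact hcong h2 h2'
      exact le_antisymm ((hiff ht hval h3).1 (h.refl _)) ((hiff ht h3 hval).1 (h.refl _))
    refine ⟨fun z => y (StdSimplex.single z), fun l m => ?_⟩
    rw [← eq_eu_of_mix hmix, ← eq_eu_of_mix hmix]
    exact hy l m
  · push Not at hne
    exact ⟨fun _ => 0, fun l m => by simp [eu, hne m l]⟩

end IsVNM

end VonNeumannMorgenstern

end Lottery

end SimpleBounds

end

/-! ### Finitely additive integration, essential values and optimal N-valued lower functions -/

noncomputable section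

namespace SimpleBounds

open Set

variable {Ω : Type*} {𝓔 : BooleanSubalgebra (Set Ω)}

/-- Finitely valued functions that are measurable with respect to the algebra `𝓔`. -/
def IsSimple {X : Type*} (𝓔 : BooleanSubalgebra (Set Ω)) (φ : Ω → X) : Prop :=
  (range φ).Finite ∧ ∀ s, φ ⁻¹' s ∈ 𝓔

namespace IsSimple

variable {X Y : Type*} {φ : Ω → X} {ψ : Ω → Y}

lemma comp (hφ : IsSimple 𝓔 φ) (k : X → Y) : IsSimple 𝓔 (fun ω => k (φ ω)) :=
  ⟨(hφ.1.image k).subset (by rintro _ ⟨ω, rfl⟩; exact ⟨φ ω, ⟨ω, rfl⟩, rfl⟩),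
    fun s => hφ.2 (k ⁻¹' s)⟩

lemma of_fibers (h : (range φ).Finite) (h' : ∀ x, φ ⁻¹' {x} ∈ 𝓔) : IsSimple 𝓔 φ := by
  classical
  refine ⟨h, fun s => ?_⟩
  have e : φ ⁻¹' s = (h.toFinset.filter (· ∈ s)).sup
      fun x => φ ⁻¹' {x} := by
    ext ω; simp [Finset.sup_eq_iSup]
  rw [e]
  exact Finset.sup_induction 𝓔.bot_mem (fun _ ha _ hb => 𝓔.sup_mem ha hb) fun x _ => h' x

lemma prodMk (hφ : IsSimple 𝓔 φ) (hψ : IsSimple 𝓔 ψ) : IsSimple 𝓔 (fun ω => (φ ω, ψ ω)) := by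
  refine of_fibers ((hφ.1.prod hψ.1).subset
    (by rintro _ ⟨ω, rfl⟩; exact ⟨⟨ω, rfl⟩, ⟨ω, rfl⟩⟩)) ?_
  rintro ⟨x, y⟩
  have : (fun ω => (φ ω, ψ ω)) ⁻¹' {(x, y)} = φ ⁻¹' {x} ⊓ ψ ⁻¹' {y} := by ext ω; simp
  rw [this]
  exact 𝓔.inf_mem (hφ.2 _) (hψ.2 _)

lemma map₂ {W : Type*} (hφ : IsSimple 𝓔 φ) (hψ : IsSimple 𝓔 ψ) (k : X → Y → W) :
    IsSimple 𝓔 (fun ω => k (φ ω) (ψ ω)) :=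
  (hφ.prodMk hψ).comp fun p => k p.1 p.2

lemma const (x : X) : IsSimple 𝓔 (fun _ => x) :=
  ⟨(finite_singleton x).subset (by rintro _ ⟨ω, rfl⟩; rfl), fun s => by
    by_cases h : x ∈ s
    · rw [preimage_const_of_mem h]; exact 𝓔.top_mem
    · rw [preimage_const_of_notMem h]; exact 𝓔.bot_mem⟩

open Classical in
lemma mem {E : Set Ω} (hE : E ∈ 𝓔) : IsSimple 𝓔 (fun ω => ω ∈ E) := by
  refine ⟨toFinite _, fun s => ?_⟩
  have h : (fun ω => ω ∈ E) ⁻¹' s = (if True ∈ s then E else ∅) ⊔ (if False ∈ s then Eᶜ else ∅) := by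
    ext ω
    by_cases h : ω ∈ E <;> by_cases h1 : True ∈ s <;> by_cases h2 : False ∈ s <;> simp [h, h1, h2]
  rw [h]
  refine 𝓔.sup_mem ?_ ?_ <;> split_ifs
  · exact hE
  · exact 𝓔.bot_mem
  · exact 𝓔.compl_mem hE
  · exact 𝓔.bot_mem

end IsSimple

namespace Prob

variable (P : Prob 𝓔)

open Classical in
/-- The probability of a set, with value `0` outside the algebra. -/
def pr (s : Set Ω) : ℝ := if h : s ∈ 𝓔 then P.toFun ⟨s, h⟩ else 0

lemma pr_coe (E : 𝓔) : P.pr E = P.toFun E := dif_pos E.2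

lemma pr_nonneg (s : Set Ω) : 0 ≤ P.pr s := by
  unfold pr; split_ifs
  · exact P.nonneg _
  · exact le_rfl

lemma pr_univ : P.pr Set.univ = 1 := (P.pr_coe ⊤).trans P.univ

lemma pr_union {s t : Set Ω} (hs : s ∈ 𝓔) (ht : t ∈ 𝓔) (h : Disjoint s t) :
    P.pr (s ∪ t) = P.pr s + P.pr t := by
  have := P.additive ⟨s, hs⟩ ⟨t, ht⟩ h
  rw [← P.pr_coe, ← P.pr_coe, ← P.pr_coe] at this
  exact this

lemma pr_empty : P.pr ∅ = 0 := by
  have := P.pr_union (s := ∅) (t := ∅) 𝓔.bot_mem 𝓔.bot_mem (by simp)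
  simpa using this

lemma pr_compl {s : Set Ω} (hs : s ∈ 𝓔) : P.pr sᶜ = 1 - P.pr s := by
  have := P.pr_union hs (𝓔.compl_mem hs) disjoint_compl_right
  rw [union_compl_self, pr_univ] at this
  linarith

lemma pr_mono {s t : Set Ω} (hs : s ∈ 𝓔) (ht : t ∈ 𝓔) (h : s ⊆ t) : P.pr s ≤ P.pr t := by
  have := P.pr_union hs (𝓔.inf_mem ht (𝓔.compl_mem hs)) (t := t ⊓ sᶜ)
    (disjoint_compl_right.mono_right inter_subset_right)
  have e : s ∪ t ⊓ sᶜ = t := by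
    ext ω; by_cases hω : ω ∈ s
    · simp [hω, h hω]
    · simp [hω]
  rw [e] at this
  linarith [P.pr_nonneg (t ⊓ sᶜ)]

lemma nonempty (P : Prob 𝓔) : Nonempty Ω := by
  by_contra h
  rw [not_nonempty_iff] at h
  have h1 := P.pr_univ
  rw [Set.univ_eq_empty_iff.2 h, pr_empty] at h1
  exact zero_ne_one h1

/-- Subsets of events of probability zero. -/
def IsNull (s : Set Ω) : Prop := ∃ E ∈ 𝓔, P.pr E = 0 ∧ s ⊆ E

variable {P}

lemma IsNull.mono {s t : Set Ω} (ht : P.IsNull t) (h : s ⊆ t) : P.IsNull s :=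
  let ⟨E, hE, h0, hs⟩ := ht
  ⟨E, hE, h0, h.trans hs⟩

lemma IsNull.union {s t : Set Ω} (hs : P.IsNull s) (ht : P.IsNull t) : P.IsNull (s ∪ t) := by
  obtain ⟨E, hE, h0, hs⟩ := hs
  obtain ⟨F, hF, h0', ht⟩ := ht
  have hF' : F ⊓ Eᶜ ∈ 𝓔 := 𝓔.inf_mem hF (𝓔.compl_mem hE)
  refine ⟨E ∪ (F ⊓ Eᶜ), 𝓔.sup_mem hE hF', ?_, ?_⟩
  · rw [P.pr_union hE hF' (disjoint_compl_right.mono_right inter_subset_right), h0, zero_add]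
    exact le_antisymm ((P.pr_mono hF' hF inter_subset_left).trans h0'.le) (P.pr_nonneg _)
  · rintro ω (hω | hω)
    · exact Or.inl (hs hω)
    · by_cases hE : ω ∈ E
      · exact Or.inl hE
      · exact Or.inr ⟨ht hω, hE⟩

lemma isNull_iff {s : Set Ω} (hs : s ∈ 𝓔) : P.IsNull s ↔ P.pr s = 0 :=
  ⟨fun ⟨_, hE, h0, h⟩ => le_antisymm ((P.pr_mono hs hE h).trans h0.le) (P.pr_nonneg _),
    fun h => ⟨s, hs, h, subset_rfl⟩⟩

lemma isNull_empty : P.IsNull ∅ := (isNull_iff 𝓔.bot_mem).2 P.pr_empty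

lemma isNull_biUnion {ι : Type*} {t : Set ι} (ht : t.Finite) {s : ι → Set Ω}
    (h : ∀ i ∈ t, P.IsNull (s i)) : P.IsNull (⋃ i ∈ t, s i) := by
  induction t, ht using Set.Finite.induction_on with
  | empty => simpa using isNull_empty
  | insert _ _ ih =>
    rw [biUnion_insert]
    exact (h _ (mem_insert _ _)).union (ih fun i hi => h i (mem_insert_of_mem _ hi))

lemma not_isNull_univ : ¬ P.IsNull Set.univ := by
  rw [isNull_iff (s := Set.univ) 𝓔.top_mem, pr_univ]; exact one_ne_zero

variable (P)

lemma pr_preimage {X : Type*} {κ : Ω → X} (hκ : IsSimple 𝓔 κ) (t : Finset X) :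
    P.pr (κ ⁻¹' t) = ∑ x ∈ t, P.pr (κ ⁻¹' {x}) := by
  classical
  induction t using Finset.induction_on with
  | empty => simp [pr_empty]
  | insert a t ha ih =>
    rw [Finset.sum_insert ha, Finset.coe_insert, insert_eq, preimage_union,
      P.pr_union (hκ.2 _) (hκ.2 _) ?_, ih]
    exact Disjoint.preimage _ (by simpa using ha)

/-- The integral of a simple function. -/
def integ (φ : Ω → ℝ) : ℝ := ∑ᶠ v, P.pr (φ ⁻¹' {v}) * v

/-- Grouping the points of s by their image under k gives the defining sum. With κ a pair of
functions, several integrals become sums over one common partition. -/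
lemma integ_comp {X : Type*} {κ : Ω → X} (hκ : IsSimple 𝓔 κ) (k : X → ℝ) {s : Finset X}
    (hs : ∀ ω, κ ω ∈ s) : P.integ (fun ω => k (κ ω)) = ∑ x ∈ s, P.pr (κ ⁻¹' {x}) * k x := by
  classical
  have h1 : P.integ (fun ω => k (κ ω))
      = ∑ v ∈ s.image k, P.pr ((fun ω => k (κ ω)) ⁻¹' {v}) * v := by
    refine finsum_eq_sum_of_support_subset _ fun v hv => ?_
    by_contra hv'
    have : (fun ω => k (κ ω)) ⁻¹' {v} = ∅ := by
      ext ω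
      simp only [mem_preimage, mem_singleton_iff, mem_empty_iff_false, iff_false]
      rintro rfl
      exact hv' (Finset.mem_coe.2 (Finset.mem_image_of_mem k (hs ω)))
    rw [Function.mem_support, this, pr_empty, zero_mul] at hv
    exact hv rfl
  rw [h1, ← Finset.sum_fiberwise_of_maps_to (g := k) fun x hx => Finset.mem_image_of_mem k hx]
  refine Finset.sum_congr rfl fun v _ => ?_
  have h2 : (fun ω => k (κ ω)) ⁻¹' {v} = κ ⁻¹' (s.filter fun x => k x = v) := by
    ext ω; simp [hs ω]
  rw [h2, P.pr_preimage hκ, Finset.sum_mul]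
  exact Finset.sum_congr rfl fun x hx => by rw [(Finset.mem_filter.1 hx).2]

lemma integ_const (c : ℝ) : P.integ (fun _ => c) = c := by
  rw [P.integ_comp (IsSimple.const ()) (fun _ => c) (s := {()}) (by simp)]
  simp [pr_univ]

lemma integ_affine {φ : Ω → ℝ} (hφ : IsSimple 𝓔 φ) (a b : ℝ) :
    P.integ (fun ω => a * φ ω + b) = a * P.integ φ + b := by
  have hs : ∀ ω, φ ω ∈ hφ.1.toFinset := by simp
  have h1 : ∑ x ∈ hφ.1.toFinset, P.pr (φ ⁻¹' {x}) = 1 := by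
    have := P.integ_comp hφ (fun _ => 1) hs
    rw [integ_const] at this
    simpa using this.symm
  rw [P.integ_comp hφ (fun x => a * x + b) hs, P.integ_comp hφ (fun x => x) hs]
  calc _ = a * ∑ x ∈ hφ.1.toFinset, P.pr (φ ⁻¹' {x}) * x
        + b * ∑ x ∈ hφ.1.toFinset, P.pr (φ ⁻¹' {x}) := by
        rw [Finset.mul_sum, Finset.mul_sum, ← Finset.sum_add_distrib]
        exact Finset.sum_congr rfl fun x _ => by ring
    _ = _ := by rw [h1, mul_one]

lemma integ_add {φ ψ : Ω → ℝ} (hφ : IsSimple 𝓔 φ) (hψ : IsSimple 𝓔 ψ) :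
    P.integ (fun ω => φ ω + ψ ω) = P.integ φ + P.integ ψ := by
  have hκ := hφ.prodMk hψ
  have hs : ∀ ω, (φ ω, ψ ω) ∈ hκ.1.toFinset := fun ω => hκ.1.mem_toFinset.2 ⟨ω, rfl⟩
  rw [P.integ_comp hκ (fun x => x.1 + x.2) hs, P.integ_comp hκ (fun x => x.1) hs,
    P.integ_comp hκ (fun x => x.2) hs, ← Finset.sum_add_distrib]
  exact Finset.sum_congr rfl fun x _ => by ring

/-- `ψ ≤ φ` outside a null set. -/
def AELe (ψ φ : Ω → ℝ) : Prop := P.IsNull {ω | φ ω < ψ ω}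

variable {P}

lemma AELe.of_le {ψ φ : Ω → ℝ} (h : ∀ ω, ψ ω ≤ φ ω) : P.AELe ψ φ :=
  isNull_empty.mono fun ω hω => absurd (h ω) (not_le.2 hω)

lemma AELe.refl (φ : Ω → ℝ) : P.AELe φ φ := .of_le fun _ => le_rfl

lemma AELe.trans {φ ψ χ : Ω → ℝ} (h : P.AELe φ ψ) (h' : P.AELe ψ χ) : P.AELe φ χ := by
  refine (IsNull.union h h').mono fun ω hω => ?_
  by_contra! h2
  simp only [mem_union, mem_ofPred_eq, not_or, not_lt] at h2
  exact absurd (h2.1.trans h2.2) (not_le.2 hω)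

lemma AELe.off {φ ψ : Ω → ℝ} {E : Set Ω} (hE : P.IsNull E) (h : ∀ ω ∉ E, ψ ω ≤ φ ω) :
    P.AELe ψ φ :=
  hE.mono fun ω hω => by
    by_contra h'
    exact absurd (h ω h') (not_le.2 hω)

lemma AELe.affine {ψ φ : Ω → ℝ} (h : P.AELe ψ φ) {a : ℝ} (ha : 0 ≤ a) (b : ℝ) :
    P.AELe (fun ω => a * ψ ω + b) (fun ω => a * φ ω + b) :=
  IsNull.mono h fun ω hω => by
    by_contra h'
    simp only [mem_ofPred_eq, not_lt] at h' hω
    exact absurd hω (not_lt.2 (by nlinarith))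

lemma AELe.neg {ψ φ : Ω → ℝ} (h : P.AELe ψ φ) : P.AELe (fun ω => - φ ω) (fun ω => - ψ ω) :=
  IsNull.mono h fun ω hω => by simpa using hω

lemma pr_eq_zero_of_isNull {s : Set Ω} (h : P.IsNull s) : P.pr s = 0 := by
  by_cases hs : s ∈ 𝓔
  · exact (isNull_iff hs).1 h
  · exact dif_neg hs

lemma integ_mono {φ ψ : Ω → ℝ} (hφ : IsSimple 𝓔 φ) (hψ : IsSimple 𝓔 ψ) (h : P.AELe φ ψ) :
    P.integ φ ≤ P.integ ψ := by
  have hκ := hφ.prodMk hψ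
  have hs : ∀ ω, (φ ω, ψ ω) ∈ hκ.1.toFinset := fun ω => hκ.1.mem_toFinset.2 ⟨ω, rfl⟩
  rw [P.integ_comp hκ (fun x => x.1) hs, P.integ_comp hκ (fun x => x.2) hs]
  refine Finset.sum_le_sum fun x _ => ?_
  by_cases hx : x.1 ≤ x.2
  · exact mul_le_mul_of_nonneg_left hx (P.pr_nonneg _)
  · rw [pr_eq_zero_of_isNull (IsNull.mono h ?_)]
    · simp
    · rintro ω rfl; simpa using hx

lemma integ_congr {φ ψ : Ω → ℝ} (hφ : IsSimple 𝓔 φ) (hψ : IsSimple 𝓔 ψ) {E : Set Ω}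
    (hE : P.IsNull E) (h : ∀ ω ∉ E, φ ω = ψ ω) : P.integ φ = P.integ ψ :=
  le_antisymm (integ_mono hφ hψ (.off hE fun ω hω => (h ω hω).le))
    (integ_mono hψ hφ (.off hE fun ω hω => (h ω hω).ge))

/-- Summed over joint values, the two integrals compare term by term. Equality of the sums forces
equality of every term, so pairs of values with a strict inequality have probability zero. -/
lemma AELe.of_integ_le {φ ψ : Ω → ℝ} (hφ : IsSimple 𝓔 φ) (hψ : IsSimple 𝓔 ψ) (h : P.AELe φ ψ)
    (h' : P.integ ψ ≤ P.integ φ) : P.AELe ψ φ := by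
  have hκ := hφ.prodMk hψ
  have hs : ∀ ω, (φ ω, ψ ω) ∈ hκ.1.toFinset := fun ω => hκ.1.mem_toFinset.2 ⟨ω, rfl⟩
  have hle : ∀ x ∈ hκ.1.toFinset, P.pr ((fun ω => (φ ω, ψ ω)) ⁻¹' {x}) * x.1
      ≤ P.pr ((fun ω => (φ ω, ψ ω)) ⁻¹' {x}) * x.2 := by
    intro x _
    by_cases hx : x.1 ≤ x.2
    · exact mul_le_mul_of_nonneg_left hx (P.pr_nonneg _)
    · rw [pr_eq_zero_of_isNull (IsNull.mono h ?_)]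
      · simp
      · rintro ω rfl; simpa using hx
  have heq : P.integ φ = P.integ ψ := le_antisymm (integ_mono hφ hψ h) h'
  rw [P.integ_comp hκ (fun x => x.1) hs, P.integ_comp hκ (fun x => x.2) hs,
    Finset.sum_eq_sum_iff_of_le hle] at heq
  have : {ω | φ ω < ψ ω} ⊆ ⋃ x ∈ {x ∈ range (fun ω => (φ ω, ψ ω)) | x.1 < x.2},
      (fun ω => (φ ω, ψ ω)) ⁻¹' {x} := by
    intro ω hω
    simp only [mem_iUnion]
    exact ⟨(φ ω, ψ ω), ⟨⟨ω, rfl⟩, hω⟩, rfl⟩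
  refine IsNull.mono (isNull_biUnion (hκ.1.subset fun x hx => hx.1) fun x hx => ?_) this
  rw [isNull_iff (hκ.2 _)]
  have := heq x (by simpa using hx.1)
  have hlt : x.1 < x.2 := hx.2
  by_contra hne
  exact hlt.ne (mul_left_cancel₀ hne this)

variable (P)

/-- The values that a function takes with positive probability. -/
def essVals {X : Type*} (φ : Ω → X) : Set X := {v | ¬ P.IsNull (φ ⁻¹' {v})}

variable {P}

lemma essVals_subset_range {X : Type*} (φ : Ω → X) : P.essVals φ ⊆ range φ := by
  intro v hv
  by_contra h
  refine hv (isNull_empty.mono ?_)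
  rintro ω rfl
  exact h ⟨ω, rfl⟩

lemma essVals_congr {X : Type*} {φ ψ : Ω → X} {E : Set Ω} (hE : P.IsNull E)
    (h : ∀ ω ∉ E, φ ω = ψ ω) : P.essVals φ = P.essVals ψ := by
  ext v
  refine not_congr ⟨fun hv => (hv.union hE).mono fun ω hω => ?_,
    fun hv => (hv.union hE).mono fun ω hω => ?_⟩
  · by_cases hωE : ω ∈ E
    · exact Or.inr hωE
    · exact Or.inl ((h ω hωE).trans hω)
  · by_cases hωE : ω ∈ E
    · exact Or.inr hωE
    · exact Or.inl ((h ω hωE).symm.trans hω)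

lemma isNull_notMem_essVals {X : Type*} {φ : Ω → X} (hφ : IsSimple 𝓔 φ) :
    P.IsNull {ω | φ ω ∉ P.essVals φ} := by
  refine IsNull.mono (isNull_biUnion (t := {v ∈ range φ | v ∉ P.essVals φ})
    (s := fun v => φ ⁻¹' {v}) (hφ.1.subset fun v hv => hv.1) fun v hv => not_not.1 hv.2) ?_
  intro ω hω
  simp only [mem_iUnion]
  exact ⟨φ ω, ⟨⟨ω, rfl⟩, hω⟩, rfl⟩

lemma essVals_nonempty {X : Type*} {φ : Ω → X} (hφ : IsSimple 𝓔 φ) : (P.essVals φ).Nonempty := by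
  by_contra! h
  refine not_isNull_univ (P := P) ((isNull_notMem_essVals hφ).mono fun ω _ => ?_)
  simp [h]

lemma essVals_comp_subset {X Y : Type*} {φ : Ω → X} (hφ : IsSimple 𝓔 φ) (k : X → Y) :
    P.essVals (fun ω => k (φ ω)) ⊆ k '' P.essVals φ := by
  intro y hy
  by_contra h
  refine hy ((isNull_notMem_essVals hφ).mono ?_)
  rintro ω rfl
  exact fun h' => h ⟨φ ω, h', rfl⟩

/-- A function agrees outside a null set with one that takes only its essential values. -/
lemma exists_range_subset_essVals {X : Type*} {φ : Ω → X} (hφ : IsSimple 𝓔 φ) :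
    ∃ k : X → X, range (fun ω => k (φ ω)) ⊆ P.essVals φ ∧
      ∀ ω ∉ {ω | φ ω ∉ P.essVals φ}, k (φ ω) = φ ω := by
  classical
  obtain ⟨v₀, hv₀⟩ := essVals_nonempty (P := P) hφ
  refine ⟨fun v => if v ∈ P.essVals φ then v else v₀, ?_, ?_⟩
  · rintro _ ⟨ω, rfl⟩
    dsimp only
    split_ifs with h
    · exact h
    · exact hv₀
  · intro ω hω
    simp only [mem_ofPred_eq, not_not] at hω
    simp [hω]

variable (P)

/-- The simple functions with at most `N` values that are below `φ` outside a null set. -/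
structure IsLower (N : ℕ∞) (φ χ : Ω → ℝ) : Prop where
  isSimple : IsSimple 𝓔 χ
  encard_le : (range χ).encard ≤ N
  le : P.AELe χ φ

/-- The best lower bound for the integral of `φ` by functions with at most `N` values. -/
def lower (N : ℕ∞) (φ : Ω → ℝ) : ℝ := sSup (P.integ '' {χ | P.IsLower N φ χ})

variable {P} {N : ℕ∞} {φ ψ : Ω → ℝ}

/-- Rounding: replace each value of χ by the least value of φ above it, then send each value of φ to
the greatest rounded value below it. No step increases the number of values, and wherever χ ≤ φ the
result lies between the two. Values taken from φ are attained by lotteries of the act, so nothing is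
needed about the range of u. -/
lemma IsLower.exists_comp (hφ : IsSimple 𝓔 φ) {χ : Ω → ℝ} (hχ : P.IsLower N φ χ) :
    ∃ k : ℝ → ℝ, (∀ ω, k (φ ω) ∈ range φ) ∧ P.IsLower N φ (fun ω => k (φ ω)) ∧
      P.integ χ ≤ P.integ (fun ω => k (φ ω)) := by
  obtain ⟨ω₀⟩ := P.nonempty
  have hup : ∀ y, ∃ w ∈ range φ, (∃ l ∈ range φ, y ≤ l) →
      y ≤ w ∧ ∀ l ∈ range φ, y ≤ l → w ≤ l := by
    intro y
    by_cases h : ∃ l ∈ range φ, y ≤ l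
    · obtain ⟨w, hw, hmin⟩ := Set.exists_min_image {l ∈ range φ | y ≤ l} id
        (hφ.1.subset fun l hl => hl.1) (let ⟨l, h1, h2⟩ := h; ⟨l, h1, h2⟩)
      exact ⟨w, hw.1, fun _ => ⟨hw.2, fun l h1 h2 => hmin l ⟨h1, h2⟩⟩⟩
    -- An arbitrary value in the range, used only when nothing in the range of φ is above y.
    · exact ⟨φ ω₀, ⟨ω₀, rfl⟩, fun h' => absurd h' h⟩
  choose up hup1 hup2 using hup
  have hfl : ∀ v, ∃ w ∈ range (fun ω => up (χ ω)), (∃ l ∈ range (fun ω => up (χ ω)), l ≤ v) →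
      w ≤ v ∧ ∀ l ∈ range (fun ω => up (χ ω)), l ≤ v → l ≤ w := by
    intro v
    by_cases h : ∃ l ∈ range (fun ω => up (χ ω)), l ≤ v
    · obtain ⟨w, hw, hmax⟩ := Set.exists_max_image {l ∈ range (fun ω => up (χ ω)) | l ≤ v} id
        ((hχ.isSimple.comp up).1.subset fun l hl => hl.1) (let ⟨l, h1, h2⟩ := h; ⟨l, h1, h2⟩)
      exact ⟨w, hw.1, fun _ => ⟨hw.2, fun l h1 h2 => hmax l ⟨h1, h2⟩⟩⟩
    · exact ⟨up (χ ω₀), ⟨ω₀, rfl⟩, fun h' => absurd h' h⟩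
  choose k hk1 hk2 using hfl
  have key : ∀ ω, χ ω ≤ φ ω → χ ω ≤ k (φ ω) ∧ k (φ ω) ≤ φ ω := by
    intro ω hω
    have h1 := hup2 (χ ω) ⟨φ ω, ⟨ω, rfl⟩, hω⟩
    have h2 : up (χ ω) ≤ φ ω := h1.2 _ ⟨ω, rfl⟩ hω
    have h3 := hk2 (φ ω) ⟨_, ⟨ω, rfl⟩, h2⟩
    exact ⟨h1.1.trans (h3.2 _ ⟨ω, rfl⟩ h2), h3.1⟩
  have hsub : range (fun ω => k (φ ω)) ⊆ up '' range χ := by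
    rintro _ ⟨ω, rfl⟩
    obtain ⟨ω', h⟩ := hk1 (φ ω)
    exact ⟨χ ω', ⟨ω', rfl⟩, h⟩
  refine ⟨k, fun ω => ?_, ⟨hφ.comp k, ?_, ?_⟩, ?_⟩
  · obtain ⟨ω', h⟩ := hk1 (φ ω)
    rw [← h]; exact hup1 _
  · exact (encard_le_encard hsub).trans ((encard_image_le _ _).trans hχ.encard_le)
  · exact IsNull.mono hχ.le fun ω hω => by
      by_contra h; exact absurd (key ω (not_lt.1 h)).2 (not_le.2 hω)
  · refine integ_mono hχ.isSimple (hφ.comp k) (IsNull.mono hχ.le fun ω hω => ?_)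
    by_contra h; exact absurd (key ω (not_lt.1 h)).1 (not_le.2 hω)

/-- After rounding only maps of the finite set `range φ` into itself compete, so the supremum in
`lower` is a maximum. The constant function at the minimum of φ shows that there is a competitor. -/
lemma exists_isGreatest_lower (hN : 1 ≤ N) (hφ : IsSimple 𝓔 φ) :
    ∃ k : ℝ → ℝ, (∀ ω, k (φ ω) ∈ range φ) ∧ P.IsLower N φ (fun ω => k (φ ω)) ∧
      IsGreatest (P.integ '' {χ | P.IsLower N φ χ}) (P.integ fun ω => k (φ ω)) := by
  obtain ⟨ω₀⟩ := P.nonempty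
  let S : Set (Ω → ℝ) := {χ | ∃ k : ℝ → ℝ, χ = (fun ω => k (φ ω)) ∧ (∀ ω, k (φ ω) ∈ range φ) ∧
    P.IsLower N φ χ}
  have hS : S.Finite := by
    have : Finite (range φ) := hφ.1
    refine (finite_range fun g : range φ → range φ => fun ω => (g ⟨φ ω, ω, rfl⟩ : ℝ)).subset ?_
    rintro _ ⟨k, rfl, hk, -⟩
    exact ⟨fun v => ⟨k v, by obtain ⟨_, ω, rfl⟩ := v; exact hk ω⟩, rfl⟩
  obtain ⟨m, ⟨ω₁, rfl⟩, hmin⟩ := Set.exists_min_image (range φ) id hφ.1 ⟨_, ω₀, rfl⟩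
  have hconst : P.IsLower N φ (fun _ => φ ω₁) := by
    refine ⟨IsSimple.const _, (encard_le_encard ?_).trans ((encard_singleton (φ ω₁)).le.trans hN),
      .of_le fun ω => hmin _ ⟨ω, rfl⟩⟩
    rintro _ ⟨_, rfl⟩; rfl
  obtain ⟨_, ⟨k, rfl, hk, hlow⟩, hmax⟩ := Set.exists_max_image S P.integ hS
    ⟨_, fun _ => φ ω₁, rfl, fun ω => ⟨ω₁, rfl⟩, hconst⟩
  refine ⟨k, hk, hlow, ⟨_, hlow, rfl⟩, ?_⟩
  rintro _ ⟨χ, hχ, rfl⟩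
  obtain ⟨k', h1, h2, h3⟩ := hχ.exists_comp hφ
  exact h3.trans (hmax _ ⟨k', rfl, h1, h2⟩)

lemma exists_lower_eq (hN : 1 ≤ N) (hφ : IsSimple 𝓔 φ) :
    ∃ k : ℝ → ℝ, (∀ ω, k (φ ω) ∈ range φ) ∧ P.IsLower N φ (fun ω => k (φ ω)) ∧
      P.integ (fun ω => k (φ ω)) = P.lower N φ := by
  obtain ⟨k, h1, h2, h3⟩ := exists_isGreatest_lower (P := P) hN hφ
  exact ⟨k, h1, h2, h3.csSup_eq.symm⟩

lemma IsLower.integ_le (hN : 1 ≤ N) (hφ : IsSimple 𝓔 φ) {χ : Ω → ℝ} (hχ : P.IsLower N φ χ) :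
    P.integ χ ≤ P.lower N φ := by
  obtain ⟨k, h1, h2, h3⟩ := exists_isGreatest_lower (P := P) hN hφ
  rw [lower, h3.csSup_eq]
  exact h3.2 ⟨χ, hχ, rfl⟩

lemma lower_mono (hN : 1 ≤ N) (hφ : IsSimple 𝓔 φ) (hψ : IsSimple 𝓔 ψ) (h : P.AELe φ ψ) :
    P.lower N φ ≤ P.lower N ψ := by
  obtain ⟨k, -, h2, h3⟩ := exists_lower_eq (P := P) hN hφ
  rw [← h3]
  exact IsLower.integ_le hN hψ ⟨h2.1, h2.2, h2.3.trans h⟩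

lemma lower_le_integ (hN : 1 ≤ N) (hφ : IsSimple 𝓔 φ) : P.lower N φ ≤ P.integ φ := by
  obtain ⟨k, -, h2, h3⟩ := exists_lower_eq (P := P) hN hφ
  rw [← h3]
  exact integ_mono h2.1 hφ h2.3

lemma IsLower.affine {χ : Ω → ℝ} (hχ : P.IsLower N φ χ) {a : ℝ} (ha : 0 ≤ a) (b : ℝ) :
    P.IsLower N (fun ω => a * φ ω + b) (fun ω => a * χ ω + b) where
  isSimple := hχ.1.comp fun x => a * x + b
  encard_le := by
    refine (encard_le_encard ?_).trans ((encard_image_le (fun x => a * x + b) _).trans hχ.2)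
    rintro _ ⟨ω, rfl⟩
    exact ⟨χ ω, ⟨ω, rfl⟩, rfl⟩
  le := hχ.3.affine ha b

lemma lower_affine_ge (hN : 1 ≤ N) (hφ : IsSimple 𝓔 φ) {a : ℝ} (ha : 0 ≤ a) (b : ℝ) :
    a * P.lower N φ + b ≤ P.lower N (fun ω => a * φ ω + b) := by
  obtain ⟨k, -, h2, h3⟩ := exists_lower_eq (P := P) hN hφ
  rw [← h3, ← P.integ_affine h2.1]
  exact IsLower.integ_le hN (hφ.comp fun x => a * x + b) (h2.affine ha b)

lemma lower_affine (hN : 1 ≤ N) (hφ : IsSimple 𝓔 φ) {a : ℝ} (ha : 0 < a) (b : ℝ) :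
    P.lower N (fun ω => a * φ ω + b) = a * P.lower N φ + b := by
  refine le_antisymm ?_ (lower_affine_ge hN hφ ha.le b)
  -- The other inequality comes from the inverse affine map.
  have h := lower_affine_ge (P := P) hN (hφ.comp fun x => a * x + b) (inv_nonneg.2 ha.le)
    (- (a⁻¹ * b))
  have e : (fun ω => a⁻¹ * (a * φ ω + b) + -(a⁻¹ * b)) = φ := by
    ext ω; field_simp; ring
  rw [e] at h
  have := mul_le_mul_of_nonneg_left h ha.le
  rw [mul_add, ← mul_assoc, mul_inv_cancel₀ ha.ne'] at this
  have e2 : a * -(a⁻¹ * b) = - b := by field_simp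
  rw [e2] at this
  linarith

lemma lower_const (hN : 1 ≤ N) (c : ℝ) : P.lower N (fun _ => c) = c := by
  refine le_antisymm ((lower_le_integ hN (.const c)).trans (P.integ_const c).le) ?_
  conv_lhs => rw [← P.integ_const c]
  refine IsLower.integ_le hN (.const c) ⟨.const c, ?_, .refl _⟩
  exact (encard_le_encard (by rintro _ ⟨_, rfl⟩; rfl)).trans ((encard_singleton c).le.trans hN)

/-- A change on a null set leaves only the essential values, after which the function is its own
lower function. -/
lemma lower_eq_integ_of_essVals (hN : 1 ≤ N) (hφ : IsSimple 𝓔 φ)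
    (h : (P.essVals φ).encard ≤ N) : P.lower N φ = P.integ φ := by
  refine le_antisymm (lower_le_integ hN hφ) ?_
  obtain ⟨k, hk, hk'⟩ := exists_range_subset_essVals (P := P) hφ
  have h0 := isNull_notMem_essVals (P := P) hφ
  rw [← integ_congr (hφ.comp k) hφ h0 hk']
  exact IsLower.integ_le hN hφ ⟨hφ.comp k, (encard_le_encard hk).trans h,
    .off h0 fun ω hω => (hk' ω hω).le⟩

/-- An optimal lower function with the integral of φ agrees with φ outside a null set, so both have
the same essential values. With the previous lemma, this characterises when `lower` reaches the
integral. -/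
lemma essVals_encard_le_of_lower (hN : 1 ≤ N) (hφ : IsSimple 𝓔 φ)
    (h : P.integ φ ≤ P.lower N φ) : (P.essVals φ).encard ≤ N := by
  obtain ⟨k, -, h2, h3⟩ := exists_lower_eq (P := P) hN hφ
  rw [← h3] at h
  have h4 := AELe.of_integ_le h2.1 hφ h2.3 h
  rw [essVals_congr (IsNull.union h2.3 h4) (ψ := fun ω => k (φ ω))]
  · exact (encard_le_encard (essVals_subset_range _)).trans h2.2
  · intro ω hω
    simp only [mem_union, mem_ofPred_eq, not_or, not_lt] at hω
    exact le_antisymm hω.2 hω.1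

end Prob

end SimpleBounds

end

/-! ### Utility profiles of acts, and simple bounds as optimal N-valued functions -/

noncomputable section

namespace SimpleBounds

open Set

variable {Ω Z : Type*} {𝓔 : BooleanSubalgebra (Set Ω)}

/-- The utility profile of an act. -/
def prof (u : Z → ℝ) (f : Act 𝓔 Z) (ω : Ω) : ℝ := Lottery.eu u (f ω)

lemma Act.isSimple (f : Act 𝓔 Z) : IsSimple 𝓔 f.toFun := ⟨f.finite_range, f.measurable⟩

lemma isSimple_prof (u : Z → ℝ) (f : Act 𝓔 Z) : IsSimple 𝓔 (prof u f) :=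
  f.isSimple.comp (Lottery.eu u)

lemma expectedUtility_eq_integ (P : Prob 𝓔) (u : Z → ℝ) (f : Act 𝓔 Z) :
    expectedUtility P u f = P.integ (prof u f) := by
  have hs : ∀ ω, f ω ∈ f.finite_range.toFinset := fun ω => f.finite_range.mem_toFinset.2 ⟨ω, rfl⟩
  have h := P.integ_comp f.isSimple (Lottery.eu u) hs
  refine Eq.trans ?_ h.symm
  refine Finset.sum_congr rfl fun l _ => ?_
  rw [← P.pr_coe]

lemma exists_prof_eq (u : Z → ℝ) {χ : Ω → ℝ} (hχ : IsSimple 𝓔 χ)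
    (h : ∀ ω, ∃ l, Lottery.eu u l = χ ω) : ∃ f : Act 𝓔 Z, prof u f = χ := by
  classical
  rcases isEmpty_or_nonempty Ω with hΩ | ⟨⟨ω₀⟩⟩
  · exact ⟨⟨fun ω => isEmptyElim ω, toFinite _, fun s => by
      rw [Set.eq_empty_of_isEmpty (_ ⁻¹' s)]; exact 𝓔.bot_mem⟩, by ext ω; exact isEmptyElim ω⟩
  · obtain ⟨l₀, -⟩ := h ω₀
    have : ∀ v, ∃ l, v ∈ range χ → Lottery.eu u l = v := by
      intro v
      by_cases hv : v ∈ range χ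
      · obtain ⟨ω, rfl⟩ := hv
        obtain ⟨l, hl⟩ := h ω
        exact ⟨l, fun _ => hl⟩
      · exact ⟨l₀, fun h' => absurd h' hv⟩
    choose k hk using this
    refine ⟨⟨fun ω => k (χ ω), (hχ.comp k).1, (hχ.comp k).2⟩, ?_⟩
    ext ω
    exact hk _ ⟨ω, rfl⟩

@[simp] lemma prof_const (u : Z → ℝ) (l : Lottery Z) :
    prof u (Act.const 𝓔 l) = fun _ => Lottery.eu u l := rfl

lemma prof_splice_of_mem (u : Z → ℝ) {E : 𝓔} (f g : Act 𝓔 Z) {ω : Ω} (h : ω ∈ (E : Set Ω)) :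
    prof u (Act.splice E f g) ω = prof u f ω := by
  simp [prof, Act.splice, h]

lemma prof_splice_of_notMem (u : Z → ℝ) {E : 𝓔} (f g : Act 𝓔 Z) {ω : Ω} (h : ω ∉ (E : Set Ω)) :
    prof u (Act.splice E f g) ω = prof u g ω := by
  simp [prof, Act.splice, h]

open Classical in
lemma prof_splice (u : Z → ℝ) (E : 𝓔) (f g : Act 𝓔 Z) :
    prof u (Act.splice E f g) = fun ω => if ω ∈ (E : Set Ω) then prof u f ω else prof u g ω := by
  ext ω
  split_ifs with h
  · exact prof_splice_of_mem u f g h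
  · exact prof_splice_of_notMem u f g h

lemma prof_mix (u : Z → ℝ) (t : unitInterval) (f g : Act 𝓔 Z) :
    prof u (Act.mix t f g) = fun ω => t * prof u f ω + (1 - t) * prof u g ω := by
  ext ω; exact Lottery.eu_mix u t (f ω) (g ω)

lemma prof_affine (u : Z → ℝ) (a b : ℝ) (f : Act 𝓔 Z) :
    prof (fun z => a * u z + b) f = fun ω => a * prof u f ω + b := by
  ext ω; exact Lottery.eu_affine u a b (f ω)

lemma prof_neg (u : Z → ℝ) (f : Act 𝓔 Z) :
    prof (fun z => - u z) f = fun ω => - prof u f ω := by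
  ext ω; exact Lottery.eu_neg u (f ω)

lemma Prob.integ_neg (P : Prob 𝓔) {φ : Ω → ℝ} (hφ : IsSimple 𝓔 φ) :
    P.integ (fun ω => - φ ω) = - P.integ φ := by
  simpa using P.integ_affine hφ (-1) 0

open Classical in
lemma Prob.integ_ite (P : Prob 𝓔) {E : Set Ω} (hE : E ∈ 𝓔) (a b : ℝ) :
    P.integ (fun ω => if ω ∈ E then a else b) = P.pr E * a + (1 - P.pr E) * b := by
  rw [P.integ_comp (IsSimple.mem hE) (fun p => if p then a else b) (s := Finset.univ) (fun _ => Finset.mem_univ _)]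
  have h1 : (fun ω => ω ∈ E) ⁻¹' {True} = E := by ext; simp
  have h2 : (fun ω => ω ∈ E) ⁻¹' {False} = Eᶜ := by ext; simp
  simp [h1, h2, P.pr_compl hE]

lemma integ_prof_splice (P : Prob 𝓔) (u : Z → ℝ) (E : 𝓔) (c d : Lottery Z) :
    P.integ (prof u (Act.splice E (.const 𝓔 c) (.const 𝓔 d)))
      = P.pr E * Lottery.eu u c + (1 - P.pr E) * Lottery.eu u d := by
  classical
  rw [prof_splice]
  exact P.integ_ite E.2 (Lottery.eu u c) (Lottery.eu u d)

lemma exists_prof_le [Nonempty Ω] (u : Z → ℝ) (f : Act 𝓔 Z) :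
    ∃ ω₀, ∀ ω, prof u f ω ≤ prof u f ω₀ := by
  obtain ⟨m, ⟨ω₀, rfl⟩, hm⟩ := Set.exists_max_image (range (prof u f)) id (isSimple_prof u f).1
    (range_nonempty _)
  exact ⟨ω₀, fun ω => hm _ ⟨ω, rfl⟩⟩

lemma exists_le_prof [Nonempty Ω] (u : Z → ℝ) (f : Act 𝓔 Z) :
    ∃ ω₀, ∀ ω, prof u f ω₀ ≤ prof u f ω := by
  obtain ⟨m, ⟨ω₀, rfl⟩, hm⟩ := Set.exists_min_image (range (prof u f)) id (isSimple_prof u f).1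
    (range_nonempty _)
  exact ⟨ω₀, fun ω => hm _ ⟨ω, rfl⟩⟩

lemma exists_eu_lt {u : Z → ℝ} (h : ∃ z z', u z ≠ u z') :
    ∃ c d : Lottery Z, Lottery.eu u d < Lottery.eu u c := by
  obtain ⟨z, z', h⟩ := h
  rcases lt_or_gt_of_ne h with h | h
  · exact ⟨.single z', .single z, by simpa only [Lottery.eu_single] using h⟩
  · exact ⟨.single z, .single z', by simpa only [Lottery.eu_single] using h⟩

section Utility

variable {R : Act 𝓔 Z → Act 𝓔 Z → Prop} {u : Z → ℝ} {P : Prob 𝓔} {N : ℕ∞}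

/-- The expected utility of `u` represents the relation on constant acts. -/
def IsUtility (R : Act 𝓔 Z → Act 𝓔 Z → Prop) (u : Z → ℝ) : Prop :=
  ∀ l m : Lottery Z, R (.const 𝓔 l) (.const 𝓔 m) ↔ Lottery.eu u m ≤ Lottery.eu u l

lemma IsUtility.dominates_iff (hu : IsUtility R u) {f g : Act 𝓔 Z} :
    Dominates R f g ↔ ∀ ω, prof u g ω ≤ prof u f ω :=
  forall_congr' fun _ => hu _ _

lemma IsUtility.indiff_iff (hu : IsUtility R u) {l m : Lottery Z} :
    Indiff R (.const 𝓔 l) (.const 𝓔 m) ↔ Lottery.eu u l = Lottery.eu u m := by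
  rw [Indiff, hu, hu]
  exact ⟨fun h => le_antisymm h.2 h.1, fun h => ⟨h.ge, h.le⟩⟩

lemma IsUtility.strict_iff (hu : IsUtility R u) {l m : Lottery Z} :
    Strict R (.const 𝓔 l) (.const 𝓔 m) ↔ Lottery.eu u m < Lottery.eu u l := by
  rw [Strict, hu, hu, not_le]
  exact ⟨fun h => h.2, fun h => ⟨h.le, h⟩⟩

lemma IsUtility.partition_eq (hu : IsUtility R u) (f : Act 𝓔 Z) :
    partition R f = range fun ω => {ω' | prof u f ω' = prof u f ω} := by
  unfold partition
  congr 1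
  ext ω ω'
  exact hu.indiff_iff

lemma encard_range_fiber {X : Type*} (φ : Ω → X) :
    (range fun ω => {ω' | φ ω' = φ ω}).encard = (range φ).encard := by
  have h : (range fun ω => {ω' | φ ω' = φ ω}) = (fun v => {ω' | φ ω' = v}) '' range φ := by
    rw [← range_comp]; rfl
  rw [h, InjOn.encard_image]
  rintro _ ⟨ω, rfl⟩ _ ⟨ω', rfl⟩ h
  have : ω ∈ {ω'' | φ ω'' = φ ω'} := by
    rw [← show {ω'' | φ ω'' = φ ω} = {ω'' | φ ω'' = φ ω'} from h]; rfl
  exact this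

lemma IsUtility.nsimple_iff (hu : IsUtility R u) {f : Act 𝓔 Z} :
    NSimple R N f ↔ (range (prof u f)).encard ≤ N := by
  rw [NSimple, hu.partition_eq, encard_range_fiber]

lemma IsUtility.essDominates_iff (hu : IsUtility R u) (hnull : ∀ E : 𝓔, Null R E ↔ P.pr E = 0)
    {f g : Act 𝓔 Z} : EssDominates R f g ↔ P.AELe (prof u g) (prof u f) := by
  constructor
  · rintro ⟨E, hE, h⟩
    exact .off ((Prob.isNull_iff E.2).2 ((hnull E).1 hE)) fun ω hω => (hu _ _).1 (h ω hω)
  · rintro ⟨E, hE, h0, hsub⟩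
    refine ⟨⟨E, hE⟩, (hnull _).2 h0, fun ω hω => (hu _ _).2 ?_⟩
    by_contra h
    exact hω (hsub (not_le.1 h))

/-- The competitors in `simInf` are the acts whose profiles satisfy `IsLower`, and being undominated
among them means having maximal integral. An optimal profile takes values of the profile of f, so
some act has it. Only the ranking of N-simple acts enters, so the lemma serves both R itself and
`euPref`. -/
lemma mem_simInf_iff (hu : IsUtility R u) (hnull : ∀ E : 𝓔, Null R E ↔ P.pr E = 0)
    (hN : 1 ≤ N) (hR : ∀ f g, NSimple R N f → NSimple R N g →
      (R f g ↔ P.integ (prof u g) ≤ P.integ (prof u f))) {f h : Act 𝓔 Z} :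
    h ∈ simInf R N f ↔ (range (prof u h)).encard ≤ N ∧ P.AELe (prof u h) (prof u f) ∧
      P.integ (prof u h) = P.lower N (prof u f) := by
  have hf := isSimple_prof u f
  constructor
  · rintro ⟨h1, h2, h3⟩
    rw [hu.essDominates_iff hnull] at h2
    refine ⟨hu.nsimple_iff.1 h1, h2, le_antisymm
      (Prob.IsLower.integ_le hN hf ⟨isSimple_prof u h, hu.nsimple_iff.1 h1, h2⟩) ?_⟩
    by_contra! h4
    obtain ⟨k, hk1, hk2, hk3⟩ := Prob.exists_lower_eq (P := P) hN hf
    obtain ⟨g, hg⟩ := exists_prof_eq (u := u) hk2.1 fun ω => by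
      obtain ⟨ω', h⟩ := hk1 ω
      exact ⟨f ω', h⟩
    have hgN : NSimple R N g := by rw [hu.nsimple_iff, hg]; exact hk2.2
    refine h3 ⟨g, hgN, by rw [hu.essDominates_iff hnull, hg]; exact hk2.3, ?_⟩
    rw [Strict, hR _ _ hgN h1, hR _ _ h1 hgN, not_le, hg, hk3]
    exact ⟨h4.le, h4⟩
  · rintro ⟨h1, h2, h3⟩
    refine ⟨hu.nsimple_iff.2 h1, (hu.essDominates_iff hnull).2 h2, ?_⟩
    rintro ⟨k, hk1, hk2, hk3⟩
    refine hk3.2 ((hR _ _ (hu.nsimple_iff.2 h1) hk1).2 ?_)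
    rw [h3]
    exact Prob.IsLower.integ_le hN hf ⟨isSimple_prof u k, hu.nsimple_iff.1 hk1,
      (hu.essDominates_iff hnull).1 hk2⟩

lemma null_flip {E : 𝓔} : Null (flip R) E ↔ Null R E :=
  not_congr ⟨fun ⟨a, b, c, h⟩ => ⟨a, c, b, h⟩, fun ⟨a, b, c, h⟩ => ⟨a, c, b, h⟩⟩

lemma nsimple_flip {f : Act 𝓔 Z} : NSimple (flip R) N f ↔ NSimple R N f := by
  have : partition (flip R) f = partition R f := by
    unfold partition
    congr 1
    ext ω ω'
    exact and_comm
  rw [NSimple, NSimple, this]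

lemma essDominates_flip {f g : Act 𝓔 Z} : EssDominates (flip R) f g ↔ EssDominates R g f :=
  exists_congr fun _ => and_congr_left fun _ => null_flip

/-- Duality: reversing the preference while negating u exchanges lower and upper bounds, so each
fact need be proved for lower bounds only. -/
lemma simInf_flip (f : Act 𝓔 Z) : simInf (flip R) N f = simSup R N f := by
  ext h
  simp only [simInf, simSup, mem_ofPred_eq, nsimple_flip, essDominates_flip]
  rfl

lemma simSup_flip (f : Act 𝓔 Z) : simSup (flip R) N f = simInf R N f := by
  ext h
  simp only [simInf, simSup, mem_ofPred_eq, nsimple_flip, essDominates_flip]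
  rfl

lemma IsUtility.flip (hu : IsUtility R u) : IsUtility (flip R) (fun z => - u z) := by
  intro l m
  rw [Lottery.eu_neg, Lottery.eu_neg, neg_le_neg_iff]
  exact hu m l

/-- The best upper bound for the integral of `φ` by functions with at most `N` values. -/
def Prob.upper (P : Prob 𝓔) (N : ℕ∞) (φ : Ω → ℝ) : ℝ := - P.lower N (fun ω => - φ ω)

lemma integ_prof_neg (P : Prob 𝓔) (u : Z → ℝ) (f : Act 𝓔 Z) :
    P.integ (prof (fun z => - u z) f) = - P.integ (prof u f) := by
  rw [prof_neg, P.integ_neg (isSimple_prof u f)]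

lemma encard_range_neg (φ : Ω → ℝ) : (range fun ω => - φ ω).encard = (range φ).encard := by
  have : (range fun ω => - φ ω) = (fun x => - x) '' range φ := by rw [← range_comp]; rfl
  rw [this, neg_injective.encard_image]

lemma Prob.aeLe_neg_iff {φ ψ : Ω → ℝ} :
    P.AELe (fun ω => - φ ω) (fun ω => - ψ ω) ↔ P.AELe ψ φ := by
  constructor <;> intro h <;> simpa using h.neg

lemma mem_simSup_iff (hu : IsUtility R u) (hnull : ∀ E : 𝓔, Null R E ↔ P.pr E = 0)
    (hN : 1 ≤ N) (hR : ∀ f g, NSimple R N f → NSimple R N g →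
      (R f g ↔ P.integ (prof u g) ≤ P.integ (prof u f))) {f h : Act 𝓔 Z} :
    h ∈ simSup R N f ↔ (range (prof u h)).encard ≤ N ∧ P.AELe (prof u f) (prof u h) ∧
      P.integ (prof u h) = P.upper N (prof u f) := by
  rw [← simInf_flip, mem_simInf_iff hu.flip (fun E => null_flip.trans (hnull E)) hN,
    prof_neg, prof_neg, encard_range_neg, Prob.aeLe_neg_iff, P.integ_neg (isSimple_prof u h),
    neg_eq_iff_eq_neg]
  · rfl
  · intro f g hf hg
    rw [integ_prof_neg, integ_prof_neg, neg_le_neg_iff]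
    exact hR g f (nsimple_flip.1 hg) (nsimple_flip.1 hf)

lemma isUtility_euPref (P : Prob 𝓔) (u : Z → ℝ) : IsUtility (euPref P u) u := by
  intro l m
  rw [euPref, expectedUtility_eq_integ, expectedUtility_eq_integ, prof_const, prof_const,
    P.integ_const, P.integ_const]

lemma null_euPref_iff (hu : ∃ z z', u z ≠ u z') (E : 𝓔) : Null (euPref P u) E ↔ P.pr E = 0 := by
  simp only [Null, Strict, euPref, expectedUtility_eq_integ, integ_prof_splice, not_le]
  constructor
  · intro h
    obtain ⟨c, d, hcd⟩ := exists_eu_lt hu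
    by_contra hne
    have hpos := lt_of_le_of_ne (P.pr_nonneg _) (Ne.symm hne)
    have := mul_lt_mul_of_pos_left hcd hpos
    exact h ⟨c, c, d, by linarith, by linarith⟩
  · rintro h ⟨c₁, c₂, c₃, -, h'⟩
    rw [h] at h'
    linarith

lemma mem_simInf_euPref_iff (hu : ∃ z z', u z ≠ u z') (hN : 1 ≤ N) {f h : Act 𝓔 Z} :
    h ∈ simInf (euPref P u) N f ↔ (range (prof u h)).encard ≤ N ∧
      P.AELe (prof u h) (prof u f) ∧ P.integ (prof u h) = P.lower N (prof u f) :=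
  mem_simInf_iff (isUtility_euPref P u) (null_euPref_iff hu) hN fun f g _ _ => by
    rw [euPref, expectedUtility_eq_integ, expectedUtility_eq_integ]

lemma mem_simSup_euPref_iff (hu : ∃ z z', u z ≠ u z') (hN : 1 ≤ N) {f h : Act 𝓔 Z} :
    h ∈ simSup (euPref P u) N f ↔ (range (prof u h)).encard ≤ N ∧
      P.AELe (prof u f) (prof u h) ∧ P.integ (prof u h) = P.upper N (prof u f) :=
  mem_simSup_iff (isUtility_euPref P u) (null_euPref_iff hu) hN fun f g _ _ => by
    rw [euPref, expectedUtility_eq_integ, expectedUtility_eq_integ]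

lemma exists_act_lower (P : Prob 𝓔) (u : Z → ℝ) (hN : 1 ≤ N) (f : Act 𝓔 Z) :
    ∃ h : Act 𝓔 Z, (range (prof u h)).encard ≤ N ∧ P.AELe (prof u h) (prof u f) ∧
      P.integ (prof u h) = P.lower N (prof u f) := by
  obtain ⟨k, hk1, hk2, hk3⟩ := Prob.exists_lower_eq (P := P) hN (isSimple_prof u f)
  obtain ⟨g, hg⟩ := exists_prof_eq (u := u) hk2.1 fun ω => by
    obtain ⟨ω', h⟩ := hk1 ω
    exact ⟨f ω', h⟩
  exact ⟨g, by rw [hg]; exact ⟨hk2.2, hk2.3, hk3⟩⟩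

lemma exists_act_upper (P : Prob 𝓔) (u : Z → ℝ) (hN : 1 ≤ N) (f : Act 𝓔 Z) :
    ∃ h : Act 𝓔 Z, (range (prof u h)).encard ≤ N ∧ P.AELe (prof u f) (prof u h) ∧
      P.integ (prof u h) = P.upper N (prof u f) := by
  obtain ⟨h, h1, h2, h3⟩ := exists_act_lower P (fun z => - u z) hN f
  rw [prof_neg] at h1 h2 h3
  rw [encard_range_neg] at h1
  rw [prof_neg, Prob.aeLe_neg_iff] at h2
  rw [prof_neg, P.integ_neg (isSimple_prof u h)] at h3
  exact ⟨h, h1, h2, by rw [Prob.upper, ← h3, neg_neg]⟩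

/-- The relation obtained from `(N, P, u)` by comparing utility profiles and their bounds. -/
structure IsBoundRep (R : Act 𝓔 Z → Act 𝓔 Z → Prop) (N : ℕ∞) (P : Prob 𝓔) (u : Z → ℝ) :
    Prop where
  two_le : 2 ≤ N
  nonconstant : ∃ z z', u z ≠ u z'
  rel_iff : ∀ f g, R f g ↔ (∀ ω, prof u g ω ≤ prof u f ω) ∨
    P.upper N (prof u g) ≤ P.lower N (prof u f)

lemma isExplicitRep_iff : IsExplicitRep R N P u ↔ IsBoundRep R N P u := by
  have key : 2 ≤ N → (∃ z z', u z ≠ u z') → ∀ f g : Act 𝓔 Z,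
      (∃ h ∈ simInf (euPref P u) N f, ∃ k ∈ simSup (euPref P u) N g,
        expectedUtility P u k ≤ expectedUtility P u h) ↔
      P.upper N (prof u g) ≤ P.lower N (prof u f) := by
    intro h2 hu f g
    have hN : 1 ≤ N := le_trans (by norm_num) h2
    constructor
    · rintro ⟨h, hh, k, hk, hle⟩
      rw [expectedUtility_eq_integ, expectedUtility_eq_integ] at hle
      rw [← ((mem_simInf_euPref_iff hu hN).1 hh).2.2, ← ((mem_simSup_euPref_iff hu hN).1 hk).2.2]
      exact hle
    · intro hle
      obtain ⟨h, hh⟩ := exists_act_lower P u hN f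
      obtain ⟨k, hk⟩ := exists_act_upper P u hN g
      refine ⟨h, (mem_simInf_euPref_iff hu hN).2 hh, k, (mem_simSup_euPref_iff hu hN).2 hk, ?_⟩
      rw [expectedUtility_eq_integ, expectedUtility_eq_integ, hh.2.2, hk.2.2]
      exact hle
  constructor
  · rintro ⟨h1, h2, h3⟩
    exact ⟨h1, h2, fun f g => (h3 f g).trans (or_congr Iff.rfl (key h1 h2 f g))⟩
  · rintro ⟨h1, h2, h3⟩
    exact ⟨h1, h2, fun f g => (h3 f g).trans (or_congr Iff.rfl (key h1 h2 f g).symm)⟩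

namespace Prob

variable {φ ψ : Ω → ℝ}

lemma upper_mono (hN : 1 ≤ N) (hφ : IsSimple 𝓔 φ) (hψ : IsSimple 𝓔 ψ) (h : P.AELe φ ψ) :
    P.upper N φ ≤ P.upper N ψ :=
  neg_le_neg (lower_mono hN (hψ.comp Neg.neg) (hφ.comp Neg.neg) h.neg)

lemma integ_le_upper (hN : 1 ≤ N) (hφ : IsSimple 𝓔 φ) : P.integ φ ≤ P.upper N φ := by
  rw [upper, le_neg, ← P.integ_neg hφ]
  exact lower_le_integ hN (hφ.comp Neg.neg)

lemma lower_le_upper (hN : 1 ≤ N) (hφ : IsSimple 𝓔 φ) : P.lower N φ ≤ P.upper N φ :=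
  (lower_le_integ hN hφ).trans (integ_le_upper hN hφ)

lemma upper_affine (hN : 1 ≤ N) (hφ : IsSimple 𝓔 φ) {a : ℝ} (ha : 0 < a) (b : ℝ) :
    P.upper N (fun ω => a * φ ω + b) = a * P.upper N φ + b := by
  have : (fun ω => -(a * φ ω + b)) = fun ω => a * (- φ ω) + -b := by ext ω; ring
  rw [upper, this, lower_affine hN (hφ.comp Neg.neg) ha, upper]
  ring

lemma upper_const (hN : 1 ≤ N) (c : ℝ) : P.upper N (fun _ => c) = c := by
  rw [upper, lower_const hN, neg_neg]

lemma encard_essVals_neg (φ : Ω → ℝ) :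
    (P.essVals fun ω => - φ ω).encard = (P.essVals φ).encard := by
  have : (P.essVals fun ω => - φ ω) = (fun x => - x) '' P.essVals φ := by
    ext v
    constructor
    · intro hv
      refine ⟨-v, fun h => hv (h.mono fun ω hω => ?_), neg_neg v⟩
      have : - φ ω = v := hω
      rw [mem_preimage, mem_singleton_iff, ← this, neg_neg]
    · rintro ⟨v, hv, rfl⟩ h
      refine hv (h.mono ?_)
      rintro ω rfl
      rfl
  rw [this, neg_injective.encard_image]

lemma upper_eq_integ_of_essVals (hN : 1 ≤ N) (hφ : IsSimple 𝓔 φ)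
    (h : (P.essVals φ).encard ≤ N) : P.upper N φ = P.integ φ := by
  rw [upper, lower_eq_integ_of_essVals hN (hφ.comp Neg.neg), P.integ_neg hφ, neg_neg]
  rwa [encard_essVals_neg]

lemma essVals_encard_le_of_range (h : (range φ).encard ≤ N) : (P.essVals φ).encard ≤ N :=
  (encard_le_encard (essVals_subset_range φ)).trans h

end Prob

lemma encard_range_ite_le {E : Set Ω} (x y : ℝ) {χ : Ω → ℝ}
    (h1 : ∀ ω ∈ E, χ ω = x) (h2 : ∀ ω ∉ E, χ ω = y) : (range χ).encard ≤ 2 := by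
  refine (encard_le_encard (t := {x, y}) ?_).trans 
    ((encard_insert_le _ _).trans (by rw [encard_singleton]; norm_num))
  rintro _ ⟨ω, rfl⟩
  by_cases h : ω ∈ E
  · exact Or.inl (h1 ω h)
  · exact Or.inr (h2 ω h)

lemma encard_range_prof_splice_le (u : Z → ℝ) (E : 𝓔) (c d : Lottery Z) :
    (range (prof u (Act.splice E (.const 𝓔 c) (.const 𝓔 d)))).encard ≤ 2 :=
  encard_range_ite_le (E := E) (Lottery.eu u c) (Lottery.eu u d)
    (fun _ h => prof_splice_of_mem u _ _ h) fun _ h => prof_splice_of_notMem u _ _ h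

lemma encard_range_prof_const_le (u : Z → ℝ) (c : Lottery Z) :
    (range (prof u (Act.const 𝓔 c))).encard ≤ 1 := by
  refine (encard_le_encard ?_).trans (encard_singleton (Lottery.eu u c)).le
  rintro _ ⟨_, rfl⟩; rfl

namespace IsBoundRep

lemma one_le (h : IsBoundRep R N P u) : 1 ≤ N := le_trans (by norm_num) h.two_le

lemma rel_of_le (h : IsBoundRep R N P u) {f g : Act 𝓔 Z} (hle : ∀ ω, prof u g ω ≤ prof u f ω) :
    R f g := (h.rel_iff f g).2 (Or.inl hle)

/-- Dominance is absorbed by monotonicity of the bounds. Two comparisons through bounds chain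
because the lower value of the middle act is at most its upper value. -/
lemma trans (hr : IsBoundRep R N P u) {f g h : Act 𝓔 Z} (h1 : R f g) (h2 : R g h) : R f h := by
  have hN := hr.one_le
  rw [hr.rel_iff] at h1 h2 ⊢
  have hf := isSimple_prof u f
  have hg := isSimple_prof u g
  have hh := isSimple_prof u h
  rcases h1 with h1 | h1 <;> rcases h2 with h2 | h2
  · exact Or.inl fun ω => (h2 ω).trans (h1 ω)
  · exact Or.inr (h2.trans (Prob.lower_mono hN hg hf (.of_le h1)))
  · exact Or.inr ((Prob.upper_mono hN hh hg (.of_le h2)).trans h1)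
  · exact Or.inr (h2.trans ((Prob.lower_le_upper hN hg).trans h1))

/-- Between acts with at most `N` essential values, the relation compares expected utilities. -/
lemma rel_iff_integ (hr : IsBoundRep R N P u) {f g : Act 𝓔 Z}
    (hf : (P.essVals (prof u f)).encard ≤ N) (hg : (P.essVals (prof u g)).encard ≤ N) :
    R f g ↔ P.integ (prof u g) ≤ P.integ (prof u f) := by
  have hN := hr.one_le
  rw [hr.rel_iff, Prob.lower_eq_integ_of_essVals hN (isSimple_prof u f) hf,
    Prob.upper_eq_integ_of_essVals hN (isSimple_prof u g) hg, or_iff_right_of_imp]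
  exact fun h => Prob.integ_mono (isSimple_prof u g) (isSimple_prof u f) (.of_le h)

/-- A constant is its own bound, and dominating it already implies the inequality of bounds, so the
dominance clause is redundant. -/
lemma rel_const_iff (hr : IsBoundRep R N P u) {f : Act 𝓔 Z} {c : Lottery Z} :
    R f (.const 𝓔 c) ↔ Lottery.eu u c ≤ P.lower N (prof u f) := by
  have hN := hr.one_le
  rw [hr.rel_iff, prof_const, Prob.upper_const hN, or_iff_right_of_imp]
  intro h
  rw [← Prob.lower_const (P := P) hN (Lottery.eu u c)]
  exact Prob.lower_mono hN (.const _) (isSimple_prof u f) (.of_le h)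

lemma const_rel_iff (hr : IsBoundRep R N P u) {f : Act 𝓔 Z} {c : Lottery Z} :
    R (.const 𝓔 c) f ↔ P.upper N (prof u f) ≤ Lottery.eu u c := by
  have hN := hr.one_le
  rw [hr.rel_iff, prof_const, Prob.lower_const hN, or_iff_right_of_imp]
  intro h
  conv_rhs => rw [← Prob.upper_const (P := P) hN (Lottery.eu u c)]
  exact Prob.upper_mono hN (isSimple_prof u f) (.const _) (.of_le h)

lemma isUtility (hr : IsBoundRep R N P u) : IsUtility R u := by
  intro l m
  rw [hr.rel_const_iff, prof_const, Prob.lower_const hr.one_le]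

lemma essVals_splice_le (hr : IsBoundRep R N P u) (E : 𝓔) (c d : Lottery Z) :
    (P.essVals (prof u (Act.splice E (.const 𝓔 c) (.const 𝓔 d)))).encard ≤ N :=
  Prob.essVals_encard_le_of_range ((encard_range_prof_splice_le u E c d).trans hr.two_le)

/-- The bets that define nullity have at most two values. Since 2 ≤ N, they are ranked by expected
utility. -/
lemma null_iff (hr : IsBoundRep R N P u) (E : 𝓔) : Null R E ↔ P.pr E = 0 := by
  rw [← null_euPref_iff hr.nonconstant (P := P)]
  simp only [Null, Strict, euPref, expectedUtility_eq_integ,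
    hr.rel_iff_integ (hr.essVals_splice_le _ _ _) (hr.essVals_splice_le _ _ _)]

lemma isSimpleBoundsRep (hr : IsBoundRep R N P u) : IsSimpleBoundsRep R N P u := by
  have hu := hr.isUtility
  have hN := hr.one_le
  have hR : ∀ f g, NSimple R N f → NSimple R N g →
      (R f g ↔ P.integ (prof u g) ≤ P.integ (prof u f)) := fun f g hf hg =>
    hr.rel_iff_integ (Prob.essVals_encard_le_of_range (hu.nsimple_iff.1 hf))
      (Prob.essVals_encard_le_of_range (hu.nsimple_iff.1 hg))
  have hinf : ∀ f, simInf R N f = simInf (euPref P u) N f := fun f => by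
    ext h
    rw [mem_simInf_iff hu hr.null_iff hN hR, mem_simInf_euPref_iff hr.nonconstant hN]
  have hsup : ∀ f, simSup R N f = simSup (euPref P u) N f := fun f => by
    ext h
    rw [mem_simSup_iff hu hr.null_iff hN hR, mem_simSup_euPref_iff hr.nonconstant hN]
  refine ⟨fun f => hr.rel_of_le fun _ => le_rfl, fun f g h => hr.trans, hr.two_le, hr.nonconstant,
    hu, fun f => ⟨?_, fun h hh h' hh' => ?_⟩, fun f => ⟨?_, fun h hh h' hh' => ?_⟩,
    fun f g => ?_⟩
  · obtain ⟨h, hh⟩ := exists_act_lower P u hN f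
    exact ⟨h, (mem_simInf_iff hu hr.null_iff hN hR).2 hh⟩
  · rw [expectedUtility_eq_integ, expectedUtility_eq_integ,
      ((mem_simInf_iff hu hr.null_iff hN hR).1 hh).2.2,
      ((mem_simInf_iff hu hr.null_iff hN hR).1 hh').2.2]
  · obtain ⟨h, hh⟩ := exists_act_upper P u hN f
    exact ⟨h, (mem_simSup_iff hu hr.null_iff hN hR).2 hh⟩
  · rw [expectedUtility_eq_integ, expectedUtility_eq_integ,
      ((mem_simSup_iff hu hr.null_iff hN hR).1 hh).2.2,
      ((mem_simSup_iff hu hr.null_iff hN hR).1 hh').2.2]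
  · rw [hinf, hsup, hu.dominates_iff]
    exact (isExplicitRep_iff.2 hr).represents f g

end IsBoundRep

end Utility

end SimpleBounds

end

/-! ### From Simple Bounds representations to the explicit form -/

noncomputable section

namespace SimpleBounds

open Set

variable {Ω Z : Type*} {𝓔 : BooleanSubalgebra (Set Ω)} {R : Act 𝓔 Z → Act 𝓔 Z → Prop}
  {u : Z → ℝ} {P : Prob 𝓔} {N : ℕ∞}

lemma splice_self (E : 𝓔) (f : Act 𝓔 Z) : Act.splice E f f = f := by
  ext ω; simp [Act.splice]

lemma splice_bot (f g : Act 𝓔 Z) : Act.splice ⊥ f g = g := by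
  ext ω; simp [Act.splice]

lemma null_bot : Null R (⊥ : 𝓔) := by
  rintro ⟨c₁, c₂, c₃, h, h'⟩
  rw [splice_bot, splice_bot] at h h'
  exact h' h

lemma encard_range_prof_splice_const_le (u : Z → ℝ) (E : 𝓔) (c : Lottery Z) (f : Act 𝓔 Z) :
    (range (prof u (Act.splice E (.const 𝓔 c) f))).encard
      ≤ (prof u f '' (E : Set Ω)ᶜ).encard + 1 := by
  refine (encard_le_encard ?_).trans (encard_insert_le _ (Lottery.eu u c))
  rintro _ ⟨ω, rfl⟩
  by_cases h : ω ∈ (E : Set Ω)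
  · exact Or.inl (prof_splice_of_mem u _ _ h)
  · exact Or.inr ⟨ω, h, (prof_splice_of_notMem u _ _ h).symm⟩

namespace IsSimpleBoundsRep

lemma flip (hr : IsSimpleBoundsRep R N P u) :
    IsSimpleBoundsRep (flip R) N P (fun z => - u z) := by
  have hneg : ∀ f : Act 𝓔 Z, expectedUtility P (fun z => - u z) f = - expectedUtility P u f :=
    fun f => by rw [expectedUtility_eq_integ, expectedUtility_eq_integ, integ_prof_neg]
  refine ⟨hr.refl, fun f g h h1 h2 => hr.trans _ _ _ h2 h1, hr.two_le, ?_, IsUtility.flip hr.utility,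
    fun f => ?_, fun f => ?_, fun f g => ?_⟩
  · obtain ⟨z, z', h⟩ := hr.nonconstant
    exact ⟨z, z', neg_injective.ne h⟩
  · simp only [simInf_flip, hneg, neg_inj]
    exact hr.upper f
  · simp only [simSup_flip, hneg, neg_inj]
    exact hr.lower f
  · simp only [simInf_flip, simSup_flip, hneg, neg_le_neg_iff]
    refine (hr.represents g f).trans (or_congr Iff.rfl ?_)
    exact ⟨fun ⟨h, hh, k, hk, hle⟩ => ⟨k, hk, h, hh, hle⟩,
      fun ⟨h, hh, k, hk, hle⟩ => ⟨k, hk, h, hh, hle⟩⟩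

lemma isUtility (hr : IsSimpleBoundsRep R N P u) : IsUtility R u := hr.utility

lemma rel_of_le (hr : IsSimpleBoundsRep R N P u) {f g : Act 𝓔 Z}
    (h : ∀ ω, prof u g ω ≤ prof u f ω) : R f g :=
  (hr.represents f g).2 (Or.inl (hr.isUtility.dominates_iff.2 h))

lemma integ_eq_of_mem (hr : IsSimpleBoundsRep R N P u) {f h h' : Act 𝓔 Z}
    (hh : h ∈ simInf R N f) (hh' : h' ∈ simInf R N f) :
    P.integ (prof u h) = P.integ (prof u h') := by
  rw [← expectedUtility_eq_integ, ← expectedUtility_eq_integ]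
  exact (hr.lower f).2 h hh h' hh'

lemma essDominates_of_le (hr : IsSimpleBoundsRep R N P u) {f g : Act 𝓔 Z} {E : 𝓔} (hE : Null R E)
    (h : ∀ ω ∉ (E : Set Ω), prof u g ω ≤ prof u f ω) : EssDominates R f g :=
  ⟨E, hE, fun ω hω => (hr.utility _ _).2 (h ω hω)⟩

/-- Dominance gives one of the two directions. Failure of the other would be a strict preference
between bets, witnessing that E is not null. -/
lemma splice_const_rel (hr : IsSimpleBoundsRep R N P u) {E : 𝓔} (hE : Null R E)
    (x y c : Lottery Z) :
    R (Act.splice E (.const 𝓔 x) (.const 𝓔 c)) (Act.splice E (.const 𝓔 y) (.const 𝓔 c)) := by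
  have hle : ∀ x y : Lottery Z, Lottery.eu u y ≤ Lottery.eu u x →
      R (Act.splice E (.const 𝓔 x) (.const 𝓔 c)) (Act.splice E (.const 𝓔 y) (.const 𝓔 c)) := by
    intro x y h
    refine hr.rel_of_le fun ω => ?_
    by_cases hω : ω ∈ (E : Set Ω)
    · rw [prof_splice_of_mem u _ _ hω, prof_splice_of_mem u _ _ hω]; exact h
    · rw [prof_splice_of_notMem u _ _ hω, prof_splice_of_notMem u _ _ hω]
  rcases le_total (Lottery.eu u y) (Lottery.eu u x) with h | h
  · exact hle x y h
  · by_contra h'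
    exact hE ⟨c, y, x, hle y x h, h'⟩

lemma mem_simInf_of_rel (hr : IsSimpleBoundsRep R N P u) {f h m : Act 𝓔 Z}
    (hh : h ∈ simInf R N f) (hm : NSimple R N m) (hfm : EssDominates R f m) (hmh : R m h) :
    m ∈ simInf R N f :=
  ⟨hm, hfm, fun ⟨k, hk1, hk2, hk3, hk4⟩ => hh.2.2 ⟨k, hk1, hk2, hr.trans _ _ _ hk3 hmh,
    fun hhk => hk4 (hr.trans _ _ _ hmh hhk)⟩⟩

/-- A competitor exceeds c only on a null event E. It is dominated by the bet paying its best
lottery on E and c elsewhere, which nullity makes no better than c. -/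
lemma const_mem_simInf (hr : IsSimpleBoundsRep R N P u) (c : Lottery Z) :
    Act.const 𝓔 c ∈ simInf R N (.const 𝓔 c) := by
  have := P.nonempty
  refine ⟨?_, hr.essDominates_of_le null_bot fun ω _ => le_rfl, ?_⟩
  · rw [hr.isUtility.nsimple_iff]
    exact (encard_range_prof_const_le u c).trans (le_trans (by norm_num) hr.two_le)
  · rintro ⟨k, -, ⟨E, hE, hk⟩, -, hk'⟩
    refine hk' ?_
    obtain ⟨ω₀, h₀⟩ := exists_prof_le u k
    have h1 : R (Act.splice E (.const 𝓔 (k ω₀)) (.const 𝓔 c)) k := hr.rel_of_le fun ω => by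
      by_cases hω : ω ∈ (E : Set Ω)
      · rw [prof_splice_of_mem u _ _ hω]; exact h₀ ω
      · rw [prof_splice_of_notMem u _ _ hω]; exact (hr.utility _ _).1 (hk ω hω)
    have h2 := hr.splice_const_rel hE c (k ω₀) c
    rw [splice_self] at h2
    exact hr.trans _ _ _ h2 h1

/-- Lowering c to d on a null event gives an act as good as c, hence another lower bound of c. Both
must have the same expected utility, which forces the probability of E to vanish. -/
lemma pr_eq_zero_of_null (hr : IsSimpleBoundsRep R N P u) {E : 𝓔} (hE : Null R E) :
    P.pr E = 0 := by
  obtain ⟨c, d, hcd⟩ := exists_eu_lt hr.nonconstant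
  have h1 : R (Act.splice E (.const 𝓔 d) (.const 𝓔 c)) (.const 𝓔 c) := by
    have := hr.splice_const_rel hE d c c
    rwa [splice_self] at this
  have h2 := hr.mem_simInf_of_rel (hr.const_mem_simInf c)
    (hr.isUtility.nsimple_iff.2 ((encard_range_prof_splice_le u E d c).trans hr.two_le))
    (hr.essDominates_of_le hE fun ω hω => (prof_splice_of_notMem u _ _ hω).le) h1
  have h3 := hr.integ_eq_of_mem h2 (hr.const_mem_simInf c)
  rw [integ_prof_splice, prof_const, P.integ_const] at h3
  have h4 : P.pr E * (Lottery.eu u c - Lottery.eu u d) = 0 := by linarith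
  exact (mul_eq_zero.1 h4).resolve_right (sub_pos.2 hcd).ne'

lemma isNull_of_null (hr : IsSimpleBoundsRep R N P u) {E : 𝓔} (hE : Null R E) :
    P.IsNull (E : Set Ω) := (Prob.isNull_iff E.2).2 (hr.pr_eq_zero_of_null hE)

lemma aeLe_of_essDominates (hr : IsSimpleBoundsRep R N P u) {f g : Act 𝓔 Z}
    (h : EssDominates R f g) : P.AELe (prof u g) (prof u f) := by
  obtain ⟨E, hE, h⟩ := h
  exact .off (hr.isNull_of_null hE) fun ω hω => (hr.utility _ _).1 (h ω hω)

lemma integ_splice_of_null (hr : IsSimpleBoundsRep R N P u) {E : 𝓔} (hE : Null R E)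
    (f g : Act 𝓔 Z) : P.integ (prof u (Act.splice E f g)) = P.integ (prof u g) :=
  Prob.integ_congr (isSimple_prof u _) (isSimple_prof u _) (hr.isNull_of_null hE)
    fun _ hω => prof_splice_of_notMem u _ _ hω

/-- If there is room for one more value off a null event, the lower bound is attained at the
expected utility of the act. -/
lemma exists_mem_simInf_of_room (hr : IsSimpleBoundsRep R N P u) {f h : Act 𝓔 Z} {E : 𝓔}
    (hE : Null R E) (hh : h ∈ simInf R N f)
    (hle : ∀ ω ∉ (E : Set Ω), prof u h ω ≤ prof u f ω)
    (hroom : (prof u f '' (E : Set Ω)ᶜ).encard + 1 ≤ N) :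
    ∃ m ∈ simInf R N f, P.integ (prof u m) = P.integ (prof u f) := by
  have := P.nonempty
  obtain ⟨ω₀, h₀⟩ := exists_prof_le u h
  -- Paying the best lottery of h on E makes the act dominate h everywhere, at the cost of at most
  -- one additional value.
  refine ⟨Act.splice E (.const 𝓔 (h ω₀)) f, hr.mem_simInf_of_rel hh ?_
    (hr.essDominates_of_le hE fun ω hω => (prof_splice_of_notMem u _ _ hω).le)
    (hr.rel_of_le fun ω => ?_), hr.integ_splice_of_null hE _ _⟩
  · exact hr.isUtility.nsimple_iff.2 ((encard_range_prof_splice_const_le u E _ f).trans hroom)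
  · by_cases hω : ω ∈ (E : Set Ω)
    · rw [prof_splice_of_mem u _ _ hω]; exact h₀ ω
    · rw [prof_splice_of_notMem u _ _ hω]; exact hle ω hω

/-- Changes on a null event of an act with room for one more value are immaterial. -/
def NullChangesImmaterial (R : Act 𝓔 Z → Act 𝓔 Z → Prop) (u : Z → ℝ) (N : ℕ∞) : Prop :=
  ∀ (h : Act 𝓔 Z) (E : 𝓔), Null R E → (prof u h '' (E : Set Ω)ᶜ).encard + 1 ≤ N →
    ∀ y t : Lottery Z, R (Act.splice E (.const 𝓔 y) h) (Act.splice E (.const 𝓔 t) h)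

/-- Take a lower bound h, below f off a null event E. If the maximum of h is at most that of f,
paying the best lottery of f on E dominates h and creates no new value. Otherwise h takes its
maximum only on E, so it has a value to spare off E. Changing it there to the worst lottery of f is
then immaterial, so f itself is as good as h. -/
lemma exists_mem_simInf_of_nsimple (hr : IsSimpleBoundsRep R N P u)
    (H : NullChangesImmaterial R u N) {f : Act 𝓔 Z} (hf : (range (prof u f)).encard ≤ N) :
    ∃ m ∈ simInf R N f, P.integ (prof u m) = P.integ (prof u f) := by
  have := P.nonempty
  obtain ⟨h, hh⟩ := (hr.lower f).1
  obtain ⟨E, hE, hle⟩ := hh.2.1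
  replace hle : ∀ ω ∉ (E : Set Ω), prof u h ω ≤ prof u f ω := fun ω hω =>
    (hr.utility _ _).1 (hle ω hω)
  obtain ⟨ω₀, h₀⟩ := exists_prof_le u h
  obtain ⟨ω₁, h₁⟩ := exists_prof_le u f
  rcases le_or_gt (prof u h ω₀) (prof u f ω₁) with hcase | hcase
  · refine ⟨Act.splice E (.const 𝓔 (f ω₁)) f, hr.mem_simInf_of_rel hh ?_
      (hr.essDominates_of_le hE fun ω hω => (prof_splice_of_notMem u _ _ hω).le)
      (hr.rel_of_le fun ω => ?_), hr.integ_splice_of_null hE _ _⟩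
    · refine hr.isUtility.nsimple_iff.2 ((encard_le_encard ?_).trans hf)
      rintro _ ⟨ω, rfl⟩
      by_cases hω : ω ∈ (E : Set Ω)
      · rw [prof_splice_of_mem u _ _ hω]; exact ⟨ω₁, rfl⟩
      · rw [prof_splice_of_notMem u _ _ hω]; exact ⟨ω, rfl⟩
    · by_cases hω : ω ∈ (E : Set Ω)
      · rw [prof_splice_of_mem u _ _ hω]; exact (h₀ ω).trans hcase
      · rw [prof_splice_of_notMem u _ _ hω]; exact hle ω hω
  · have hroom : (prof u h '' (E : Set Ω)ᶜ).encard + 1 ≤ N := by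
      have hnot : prof u h ω₀ ∉ prof u h '' (E : Set Ω)ᶜ := by
        rintro ⟨ω, hω, h'⟩
        have := hle ω hω
        rw [h'] at this
        exact absurd (this.trans (h₁ ω)) (not_le.2 hcase)
      rw [← encard_insert_of_notMem hnot]
      refine (encard_le_encard ?_).trans (hr.isUtility.nsimple_iff.1 hh.1)
      rintro _ (rfl | ⟨ω, -, rfl⟩)
      · exact ⟨ω₀, rfl⟩
      · exact ⟨ω, rfl⟩
    obtain ⟨ω₂, h₂⟩ := exists_le_prof u f
    have hfh : R f h := by
      refine hr.trans _ (Act.splice E (.const 𝓔 (f ω₂)) h) _ (hr.rel_of_le fun ω => ?_)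
        (hr.trans _ (Act.splice E (.const 𝓔 (h ω₀)) h) _ (H h E hE hroom _ _)
          (hr.rel_of_le fun ω => ?_))
      · by_cases hω : ω ∈ (E : Set Ω)
        · rw [prof_splice_of_mem u _ _ hω]; exact h₂ ω
        · rw [prof_splice_of_notMem u _ _ hω]; exact hle ω hω
      · by_cases hω : ω ∈ (E : Set Ω)
        · rw [prof_splice_of_mem u _ _ hω]; exact h₀ ω
        · rw [prof_splice_of_notMem u _ _ hω]
    exact ⟨f, hr.mem_simInf_of_rel hh (hr.isUtility.nsimple_iff.2 hf)
      (hr.essDominates_of_le null_bot fun _ _ => le_rfl) hfh, rfl⟩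

/-- For N = 2, an act with room for one more value is constant off E, so that `splice_const_rel`
applies. For N > 2, a two-valued act has room itself. This case comes first because it handles bets,
which identify the null events, and the general case needs to know these. -/
lemma exists_mem_simInf_of_encard_le_two (hr : IsSimpleBoundsRep R N P u) {f : Act 𝓔 Z}
    (hf : (range (prof u f)).encard ≤ 2) :
    ∃ m ∈ simInf R N f, P.integ (prof u m) = P.integ (prof u f) := by
  rcases eq_or_lt_of_le hr.two_le with hN | hN
  · refine hr.exists_mem_simInf_of_nsimple (fun h E hE hroom y t => ?_) (hN ▸ hf)
    obtain ⟨ω₁, hω₁⟩ : ∃ ω, ω ∉ (E : Set Ω) := by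
      by_contra! hall
      refine Prob.not_isNull_univ (P := P) ((hr.isNull_of_null hE).mono fun ω _ => hall ω)
    have hsub : (prof u h '' (E : Set Ω)ᶜ).Subsingleton := by
      rw [← encard_le_one_iff_subsingleton]
      rw [← hN, ← one_add_one_eq_two] at hroom
      exact (ENat.add_le_add_iff_right (by simp)).1 hroom
    have heq : ∀ (y : Lottery Z) ω, prof u (Act.splice E (.const 𝓔 y) h) ω
        = prof u (Act.splice E (.const 𝓔 y) (.const 𝓔 (h ω₁))) ω := by
      intro y ω
      by_cases hω : ω ∈ (E : Set Ω)
      · rw [prof_splice_of_mem u _ _ hω, prof_splice_of_mem u _ _ hω]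
      · rw [prof_splice_of_notMem u _ _ hω, prof_splice_of_notMem u _ _ hω]
        exact hsub ⟨ω, hω, rfl⟩ ⟨ω₁, hω₁, rfl⟩
    exact hr.trans _ _ _ (hr.rel_of_le fun ω => (heq y ω).ge)
      (hr.trans _ _ _ (hr.splice_const_rel hE y t _) (hr.rel_of_le fun ω => (heq t ω).le))
  · obtain ⟨h, hh⟩ := (hr.lower f).1
    obtain ⟨E, hE, hle⟩ := hh.2.1
    refine hr.exists_mem_simInf_of_room hE hh (fun ω hω => (hr.utility _ _).1 (hle ω hω)) ?_
    have h1 : (prof u f '' (E : Set Ω)ᶜ).encard + 1 ≤ 2 + 1 := by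
      gcongr
      exact (encard_le_encard (image_subset_range _ _)).trans hf
    exact h1.trans (ENat.add_one_le_iff (by simp) |>.2 hN)

lemma rel_of_exists (hr : IsSimpleBoundsRep R N P u) {f g : Act 𝓔 Z}
    (hf : ∃ m ∈ simInf R N f, P.integ (prof u m) = P.integ (prof u f))
    (hg : ∃ m ∈ simSup R N g, P.integ (prof u m) = P.integ (prof u g))
    (hle : P.integ (prof u g) ≤ P.integ (prof u f)) : R f g := by
  obtain ⟨h, hh, h1⟩ := hf
  obtain ⟨k, hk, h2⟩ := hg
  refine (hr.represents f g).2 (Or.inr ⟨h, hh, k, hk, ?_⟩)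
  rw [expectedUtility_eq_integ, expectedUtility_eq_integ, h1, h2]
  exact hle

/-- The statement on upper bounds that corresponds by duality to one on lower bounds. -/
lemma exists_mem_simSup_of_flip {f : Act 𝓔 Z}
    (h : ∃ m ∈ simInf (Function.swap R) N f,
      P.integ (prof (fun z => - u z) m) = P.integ (prof (fun z => - u z) f)) :
    ∃ m ∈ simSup R N f, P.integ (prof u m) = P.integ (prof u f) := by
  obtain ⟨m, hm, h⟩ := h
  rw [integ_prof_neg, integ_prof_neg, neg_inj] at h
  exact ⟨m, by rw [← simInf_flip]; exact hm, h⟩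

lemma exists_mem_simSup_of_encard_le_two (hr : IsSimpleBoundsRep R N P u) {f : Act 𝓔 Z}
    (hf : (range (prof u f)).encard ≤ 2) :
    ∃ m ∈ simSup R N f, P.integ (prof u m) = P.integ (prof u f) :=
  exists_mem_simSup_of_flip (hr.flip.exists_mem_simInf_of_encard_le_two
    (by rw [prof_neg, encard_range_neg]; exact hf))

lemma null_iff (hr : IsSimpleBoundsRep R N P u) (E : 𝓔) : Null R E ↔ P.pr E = 0 := by
  refine ⟨hr.pr_eq_zero_of_null, fun h => ?_⟩
  rintro ⟨c₁, c₂, c₃, -, h'⟩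
  refine h' (hr.rel_of_exists
    (hr.exists_mem_simInf_of_encard_le_two (encard_range_prof_splice_le u E _ _))
    (hr.exists_mem_simSup_of_encard_le_two (encard_range_prof_splice_le u E _ _)) ?_)
  rw [integ_prof_splice, integ_prof_splice, h]
  linarith

/-- The event on which a given lower bound exceeds f need not be E. The union of both is null for R,
because nullity is now known to mean probability zero. -/
lemma exists_mem_simInf_of_room' (hr : IsSimpleBoundsRep R N P u) {f : Act 𝓔 Z} {E : 𝓔}
    (hE : Null R E) (hroom : (prof u f '' (E : Set Ω)ᶜ).encard + 1 ≤ N) :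
    ∃ m ∈ simInf R N f, P.integ (prof u m) = P.integ (prof u f) := by
  obtain ⟨h, hh⟩ := (hr.lower f).1
  obtain ⟨E', hE', hle⟩ := hh.2.1
  have hnull : Null R (E ⊔ E') := by
    rw [hr.null_iff, ← Prob.isNull_iff (E ⊔ E').2]
    exact (hr.isNull_of_null hE).union (hr.isNull_of_null hE')
  refine hr.exists_mem_simInf_of_room hnull hh (fun ω hω => (hr.utility _ _).1
    (hle ω fun h => hω (Or.inr h))) (le_trans ?_ hroom)
  gcongr
  exact subset_union_left (s := (E : Set Ω)) (t := (E' : Set Ω))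

lemma exists_mem_simSup_of_room' (hr : IsSimpleBoundsRep R N P u) {f : Act 𝓔 Z} {E : 𝓔}
    (hE : Null R E) (hroom : (prof u f '' (E : Set Ω)ᶜ).encard + 1 ≤ N) :
    ∃ m ∈ simSup R N f, P.integ (prof u m) = P.integ (prof u f) := by
  refine exists_mem_simSup_of_flip (hr.flip.exists_mem_simInf_of_room' (null_flip.2 hE) ?_)
  have : prof (fun z => - u z) f '' (E : Set Ω)ᶜ = (fun x => - x) '' (prof u f '' (E : Set Ω)ᶜ) := by
    rw [prof_neg, image_image]
  rw [this, neg_injective.encard_image]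
  exact hroom

/-- Both modified acts have room, so their bounds attain their expected utilities, and these
coincide since E has probability zero. -/
lemma nullChangesImmaterial (hr : IsSimpleBoundsRep R N P u) : NullChangesImmaterial R u N := by
  intro h E hE hroom y t
  have himg : ∀ c : Lottery Z, prof u (Act.splice E (.const 𝓔 c) h) '' (E : Set Ω)ᶜ
      = prof u h '' (E : Set Ω)ᶜ := fun c =>
    image_congr fun ω hω => prof_splice_of_notMem u _ _ hω
  refine hr.rel_of_exists (hr.exists_mem_simInf_of_room' hE (by rwa [himg]))
    (hr.exists_mem_simSup_of_room' hE (by rwa [himg])) ?_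
  rw [hr.integ_splice_of_null hE, hr.integ_splice_of_null hE]

lemma exists_mem_simSup_of_nsimple (hr : IsSimpleBoundsRep R N P u) {f : Act 𝓔 Z}
    (hf : (range (prof u f)).encard ≤ N) :
    ∃ m ∈ simSup R N f, P.integ (prof u m) = P.integ (prof u f) :=
  exists_mem_simSup_of_flip (hr.flip.exists_mem_simInf_of_nsimple hr.flip.nullChangesImmaterial
    (by rw [prof_neg, encard_range_neg]; exact hf))

lemma rel_iff_of_nsimple (hr : IsSimpleBoundsRep R N P u) {f g : Act 𝓔 Z} (hf : NSimple R N f)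
    (hg : NSimple R N g) : R f g ↔ P.integ (prof u g) ≤ P.integ (prof u f) := by
  constructor
  · intro h
    rcases (hr.represents f g).1 h with h | ⟨h, hh, k, hk, hle⟩
    · exact Prob.integ_mono (isSimple_prof u g) (isSimple_prof u f)
        (.of_le (hr.isUtility.dominates_iff.1 h))
    · rw [expectedUtility_eq_integ, expectedUtility_eq_integ] at hle
      exact (Prob.integ_mono (isSimple_prof u g) (isSimple_prof u k)
        (hr.aeLe_of_essDominates hk.2.1)).trans (hle.trans (Prob.integ_mono (isSimple_prof u h)
          (isSimple_prof u f) (hr.aeLe_of_essDominates hh.2.1)))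
  · rw [hr.isUtility.nsimple_iff] at hf hg
    exact hr.rel_of_exists (hr.exists_mem_simInf_of_nsimple hr.nullChangesImmaterial hf)
      (hr.exists_mem_simSup_of_nsimple hg)

lemma isExplicitRep (hr : IsSimpleBoundsRep R N P u) : IsExplicitRep R N P u := by
  have hN : 1 ≤ N := le_trans (by norm_num) hr.two_le
  have hR : ∀ f g, NSimple R N f → NSimple R N g →
      (R f g ↔ P.integ (prof u g) ≤ P.integ (prof u f)) := fun f g => hr.rel_iff_of_nsimple
  have hinf : ∀ f, simInf R N f = simInf (euPref P u) N f := fun f => by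
    ext h
    rw [mem_simInf_iff hr.isUtility hr.null_iff hN hR, mem_simInf_euPref_iff hr.nonconstant hN]
  have hsup : ∀ f, simSup R N f = simSup (euPref P u) N f := fun f => by
    ext h
    rw [mem_simSup_iff hr.isUtility hr.null_iff hN hR, mem_simSup_euPref_iff hr.nonconstant hN]
  refine ⟨hr.two_le, hr.nonconstant, fun f g => ?_⟩
  rw [hr.represents f g, hr.isUtility.dominates_iff, hinf, hsup]
  rfl

end IsSimpleBoundsRep

lemma isSimpleBoundsRep_iff_isBoundRep : IsSimpleBoundsRep R N P u ↔ IsBoundRep R N P u :=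
  ⟨fun h => isExplicitRep_iff.1 h.isExplicitRep, fun h => h.isSimpleBoundsRep⟩

lemma isSimpleBoundsRep_iff_isExplicitRep : IsSimpleBoundsRep R N P u ↔ IsExplicitRep R N P u :=
  isSimpleBoundsRep_iff_isBoundRep.trans isExplicitRep_iff.symm

/-! ### Uniqueness of utility and probability -/

namespace IsBoundRep

lemma affine (hr : IsBoundRep R N P u) {a : ℝ} (ha : 0 < a) (b : ℝ) :
    IsBoundRep R N P (fun z => a * u z + b) := by
  refine ⟨hr.two_le, ?_, fun f g => ?_⟩
  · obtain ⟨z, z', h⟩ := hr.nonconstant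
    exact ⟨z, z', fun h' => h (mul_left_cancel₀ ha.ne' (add_right_cancel h'))⟩
  · rw [hr.rel_iff, prof_affine, prof_affine, Prob.upper_affine hr.one_le (isSimple_prof u g) ha,
      Prob.lower_affine hr.one_le (isSimple_prof u f) ha]
    simp only [add_le_add_iff_right, mul_le_mul_iff_right₀ ha]

lemma utility_unique (hr : IsBoundRep R N P u) {N' : ℕ∞} {P' : Prob 𝓔} {u' : Z → ℝ}
    (hr' : IsBoundRep R N' P' u') : ∃ a b : ℝ, 0 < a ∧ ∀ z, u' z = a * u z + b := by
  obtain ⟨c, d, hcd⟩ := exists_eu_lt hr.nonconstant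
  have hiff : ∀ l m, Lottery.eu u m ≤ Lottery.eu u l ↔ Lottery.eu u' m ≤ Lottery.eu u' l :=
    fun l m => (hr.isUtility l m).symm.trans (hr'.isUtility l m)
  have heq : ∀ l m, Lottery.eu u m = Lottery.eu u l → Lottery.eu u' m = Lottery.eu u' l :=
    fun l m h => le_antisymm ((hiff l m).1 h.le) ((hiff m l).1 h.ge)
  have hcd' : Lottery.eu u' d < Lottery.eu u' c := by
    rw [← not_le, ← hiff, not_le]; exact hcd
  have h0 : 0 < Lottery.eu u c - Lottery.eu u d := sub_pos.2 hcd
  have h0' : 0 < Lottery.eu u' c - Lottery.eu u' d := sub_pos.2 hcd'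
  -- Of l, c and d, the middle one has the utility of a mixture of the other two, and the same
  -- weight must serve u'. The three cases are the three positions of l.
  have key : ∀ l, (Lottery.eu u' l - Lottery.eu u' d) * (Lottery.eu u c - Lottery.eu u d)
      = (Lottery.eu u' c - Lottery.eu u' d) * (Lottery.eu u l - Lottery.eu u d) := by
    intro l
    rcases lt_or_ge (Lottery.eu u l) (Lottery.eu u d) with h1 | h1
    · have hp : 0 < Lottery.eu u c - Lottery.eu u l := by linarith
      let t : unitInterval := ⟨(Lottery.eu u d - Lottery.eu u l) / (Lottery.eu u c - Lottery.eu u l),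
        div_nonneg (by linarith) hp.le, (div_le_one hp).2 (by linarith)⟩
      have ht : (t : ℝ) * (Lottery.eu u c - Lottery.eu u l) = Lottery.eu u d - Lottery.eu u l :=
        div_mul_cancel₀ _ hp.ne'
      have := heq d (Lottery.mix t c l) (by rw [Lottery.eu_mix]; linarith)
      rw [Lottery.eu_mix] at this
      have h2 : (t : ℝ) * (Lottery.eu u' c - Lottery.eu u' l)
        = Lottery.eu u' d - Lottery.eu u' l := by linarith
      have ht1 : 1 - (t : ℝ) ≠ 0 := by
        intro h3
        have : (t : ℝ) = 1 := by linarith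
        rw [this] at ht
        linarith
      apply mul_left_cancel₀ ht1
      linear_combination (-(Lottery.eu u' c - Lottery.eu u' d)) * ht
        + (Lottery.eu u c - Lottery.eu u d) * h2
    rcases le_or_gt (Lottery.eu u l) (Lottery.eu u c) with h2 | h2
    · let t : unitInterval := ⟨(Lottery.eu u l - Lottery.eu u d) / (Lottery.eu u c - Lottery.eu u d),
        div_nonneg (by linarith) h0.le, (div_le_one h0).2 (by linarith)⟩
      have ht : (t : ℝ) * (Lottery.eu u c - Lottery.eu u d) = Lottery.eu u l - Lottery.eu u d :=
        div_mul_cancel₀ _ h0.ne'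
      have := heq l (Lottery.mix t c d) (by rw [Lottery.eu_mix]; linarith)
      rw [Lottery.eu_mix] at this
      linear_combination (-(Lottery.eu u c - Lottery.eu u d)) * this
        + (Lottery.eu u' c - Lottery.eu u' d) * ht
    · have hp : 0 < Lottery.eu u l - Lottery.eu u d := by linarith
      let t : unitInterval := ⟨(Lottery.eu u c - Lottery.eu u d) / (Lottery.eu u l - Lottery.eu u d),
        div_nonneg (by linarith) hp.le, (div_le_one hp).2 (by linarith)⟩
      have ht : (t : ℝ) * (Lottery.eu u l - Lottery.eu u d) = Lottery.eu u c - Lottery.eu u d :=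
        div_mul_cancel₀ _ hp.ne'
      have := heq c (Lottery.mix t l d) (by rw [Lottery.eu_mix]; linarith)
      rw [Lottery.eu_mix] at this
      linear_combination (-(Lottery.eu u' l - Lottery.eu u' d)) * ht
        + (Lottery.eu u l - Lottery.eu u d) * this
  refine ⟨(Lottery.eu u' c - Lottery.eu u' d) / (Lottery.eu u c - Lottery.eu u d),
    Lottery.eu u' d - (Lottery.eu u' c - Lottery.eu u' d) / (Lottery.eu u c - Lottery.eu u d)
      * Lottery.eu u d, div_pos h0' h0, fun z => ?_⟩
  have := key (.single z)
  rw [Lottery.eu_single, Lottery.eu_single] at this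
  field_simp
  linarith

lemma prob_unique (hr : IsBoundRep R N P u) {N' : ℕ∞} {P' : Prob 𝓔}
    (hr' : IsBoundRep R N' P' u) : P' = P := by
  obtain ⟨c, d, hcd⟩ := exists_eu_lt hr.nonconstant
  ext E
  rw [← P.pr_coe, ← P'.pr_coe]
  have h1 : P.pr E ≤ 1 := by
    rw [← P.pr_univ]
    exact P.pr_mono E.2 𝓔.top_mem (subset_univ _)
  have hlow := Prob.lower_eq_integ_of_essVals hr.one_le (isSimple_prof u _)
    (hr.essVals_splice_le E c d)
  have hup := Prob.upper_eq_integ_of_essVals hr.one_le (isSimple_prof u _)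
    (hr.essVals_splice_le E c d)
  have hlow' := Prob.lower_eq_integ_of_essVals hr'.one_le (isSimple_prof u _)
    (hr'.essVals_splice_le E c d)
  have hup' := Prob.upper_eq_integ_of_essVals hr'.one_le (isSimple_prof u _)
    (hr'.essVals_splice_le E c d)
  rw [integ_prof_splice] at hlow hup hlow' hup'
  -- The lottery that the first representation makes indifferent to the bet on E. Read through the
  -- second one, this indifference reveals the other probability.
  set e := Lottery.mix ⟨P.pr E, P.pr_nonneg _, h1⟩ c d with he
  have heu : Lottery.eu u e = P.pr E * Lottery.eu u c + (1 - P.pr E) * Lottery.eu u d :=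
    Lottery.eu_mix _ _ _ _
  have h2 := hr'.rel_const_iff.1 (hr.rel_const_iff.2 (heu.le.trans hlow.ge))
  have h3 := hr'.const_rel_iff.1 (hr.const_rel_iff.2 (hup.le.trans heu.ge))
  rw [hlow', heu] at h2
  rw [hup', heu] at h3
  have h4 : (P'.pr E - P.pr E) * (Lottery.eu u c - Lottery.eu u d) = 0 := by linarith
  exact sub_eq_zero.1 ((mul_eq_zero.1 h4).resolve_right (sub_pos.2 hcd).ne')

end IsBoundRep

lemma IsSimpleBoundsRep.unique (hr : IsSimpleBoundsRep R N P u) {N' : ℕ∞} {P' : Prob 𝓔}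
    {u' : Z → ℝ} (hr' : IsSimpleBoundsRep R N' P' u') :
    P' = P ∧ ∃ a b : ℝ, 0 < a ∧ ∀ z, u' z = a * u z + b := by
  rw [isSimpleBoundsRep_iff_isBoundRep] at hr hr'
  obtain ⟨a, b, ha, hab⟩ := hr.utility_unique hr'
  refine ⟨?_, a, b, ha, hab⟩
  have : u' = fun z => a * u z + b := funext hab
  subst this
  exact (hr.affine ha b).prob_unique hr'

lemma IsSimpleBoundsRep.affine (hr : IsSimpleBoundsRep R N P u) {a : ℝ} (ha : 0 < a) (b : ℝ) :
    IsSimpleBoundsRep R N P fun z => a * u z + b :=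
  ((isSimpleBoundsRep_iff_isBoundRep.1 hr).affine ha b).isSimpleBoundsRep

end SimpleBounds

end

/-! ### Necessity of the axioms -/

noncomputable section

namespace SimpleBounds

open Set

variable {Ω Z : Type*} {𝓔 : BooleanSubalgebra (Set Ω)} {R : Act 𝓔 Z → Act 𝓔 Z → Prop}
  {u : Z → ℝ} {P : Prob 𝓔} {N : ℕ∞}

namespace Prob

/-- `lower` is monotone and commutes with adding constants, hence is non-expansive for the uniform
distance. -/
lemma continuous_lower (hN : 1 ≤ N) {φ : unitInterval → Ω → ℝ} (hφ : ∀ t, IsSimple 𝓔 (φ t)) {C : ℝ}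
    (hC : ∀ s t ω, |φ s ω - φ t ω| ≤ C * |(s : ℝ) - t|) :
    Continuous fun t => P.lower N (φ t) := by
  have key : ∀ s t, P.lower N (φ s) ≤ P.lower N (φ t) + C * |(s : ℝ) - t| := by
    intro s t
    have h := lower_affine (P := P) hN (hφ t) one_pos (C * |(s : ℝ) - t|)
    rw [one_mul] at h
    rw [← h]
    refine lower_mono hN (hφ s) ((hφ t).comp fun x => 1 * x + C * |(s : ℝ) - t|) (.of_le fun ω => ?_)
    have := (le_abs_self _).trans (hC s t ω)
    linarith
  refine (LipschitzWith.of_dist_le_mul (K := C.toNNReal) fun s t => ?_).continuous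
  rw [Real.dist_eq, Subtype.dist_eq, Real.dist_eq, abs_le]
  have h1 := key s t
  have h2 := key t s
  rw [abs_sub_comm] at h2
  have h3 : C * |(s : ℝ) - t| ≤ C.toNNReal * |(s : ℝ) - t| :=
    mul_le_mul_of_nonneg_right (Real.le_coe_toNNReal C) (abs_nonneg _)
  constructor <;> linarith

lemma continuous_upper (hN : 1 ≤ N) {φ : unitInterval → Ω → ℝ} (hφ : ∀ t, IsSimple 𝓔 (φ t)) {C : ℝ}
    (hC : ∀ s t ω, |φ s ω - φ t ω| ≤ C * |(s : ℝ) - t|) :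
    Continuous fun t => P.upper N (φ t) := by
  refine (continuous_lower hN (φ := fun t ω => - φ t ω) (fun t => (hφ t).comp Neg.neg) (C := C)
    fun s t ω => ?_).neg
  rw [neg_sub_neg, abs_sub_comm]
  exact hC s t ω

end Prob

lemma IsSimple.bounded {φ : Ω → ℝ} (hφ : IsSimple 𝓔 φ) : ∃ C, ∀ ω, |φ ω| ≤ C := by
  obtain ⟨C, hC⟩ := (hφ.1.image fun x => |x|).bddAbove
  exact ⟨C, fun ω => hC ⟨φ ω, ⟨ω, rfl⟩, rfl⟩⟩

lemma isSimple_prof_mix (u : Z → ℝ) (f g : Act 𝓔 Z) (t : unitInterval) :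
    IsSimple 𝓔 fun ω => (t : ℝ) * prof u f ω + (1 - t) * prof u g ω := by
  rw [← prof_mix]; exact isSimple_prof u _

lemma exists_prof_mix_lipschitz (u : Z → ℝ) (f g : Act 𝓔 Z) : ∃ C : ℝ, ∀ (s t : unitInterval) ω,
    |((s : ℝ) * prof u f ω + (1 - s) * prof u g ω) - ((t : ℝ) * prof u f ω + (1 - t) * prof u g ω)|
      ≤ C * |(s : ℝ) - t| := by
  obtain ⟨C, hC⟩ := ((isSimple_prof u f).map₂ (isSimple_prof u g) fun x y => x - y).bounded
  refine ⟨C, fun s t ω => ?_⟩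
  have : ((s : ℝ) * prof u f ω + (1 - s) * prof u g ω)
      - ((t : ℝ) * prof u f ω + (1 - t) * prof u g ω) = (prof u f ω - prof u g ω) * (s - t) := by ring
  rw [this, abs_mul]
  exact mul_le_mul_of_nonneg_right (hC ω) (abs_nonneg _)

namespace IsBoundRep

/-- A certainty equivalent squeezes the upper value below the lower one, so the lower value reaches
the integral and at most N values are essential. Conversely both bounds equal the integral, which
lies between the extreme utilities of f and so is the utility of some lottery. -/
lemma wellUnderstood_iff (hr : IsBoundRep R N P u) {f : Act 𝓔 Z} :
    WellUnderstood R f ↔ (P.essVals (prof u f)).encard ≤ N := by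
  have hN := hr.one_le
  have hf := isSimple_prof u f
  have := P.nonempty
  constructor
  · rintro ⟨c, h1, h2⟩
    rw [hr.rel_const_iff] at h1
    rw [hr.const_rel_iff] at h2
    exact Prob.essVals_encard_le_of_lower hN hf
      ((Prob.integ_le_upper hN hf).trans (h2.trans h1))
  · intro h
    obtain ⟨ω₀, h₀⟩ := exists_prof_le u f
    obtain ⟨ω₁, h₁⟩ := exists_le_prof u f
    obtain ⟨c, hc⟩ := Lottery.exists_eu_eq u (l := f ω₁) (m := f ω₀) (y := P.integ (prof u f))
      (by
        refine (P.integ_const _).symm.le.trans (Prob.integ_mono (.const _) hf (.of_le h₁)))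
      ((Prob.integ_mono hf (.const _) (.of_le h₀)).trans (P.integ_const _).le)
    refine ⟨c, ?_, ?_⟩
    · rw [hr.rel_const_iff, Prob.lower_eq_integ_of_essVals hN hf h, hc]
    · rw [hr.const_rel_iff, Prob.upper_eq_integ_of_essVals hN hf h, hc]

lemma rel_iff_of_wellUnderstood (hr : IsBoundRep R N P u) {f g : Act 𝓔 Z}
    (hf : WellUnderstood R f) (hg : WellUnderstood R g) :
    R f g ↔ P.integ (prof u g) ≤ P.integ (prof u f) :=
  hr.rel_iff_integ (hr.wellUnderstood_iff.1 hf) (hr.wellUnderstood_iff.1 hg)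

lemma basicConditions (hr : IsBoundRep R N P u) : BasicConditions R := by
  have hN := hr.one_le
  obtain ⟨c, d, hcd⟩ := exists_eu_lt hr.nonconstant
  have hcd' : Strict R (.const 𝓔 c) (.const 𝓔 d) := hr.isUtility.strict_iff.2 hcd
  refine ⟨⟨fun f => hr.rel_of_le fun _ => le_rfl, fun f g h => hr.trans⟩,
    fun f g h => hr.rel_of_le (hr.isUtility.dominates_iff.1 h), fun f g h => ?_, ⟨_, _, hcd'⟩,
    fun l m => ?_, fun f c₁ c₂ t h0 h1 => ?_⟩
  · obtain ⟨C, hC⟩ := exists_prof_mix_lipschitz u f g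
    have hc : ∀ ω, Continuous fun t : unitInterval => (t : ℝ) * prof u f ω + (1 - t) * prof u g ω :=
      fun ω => by fun_prop
    simp only [hr.rel_iff, prof_mix]
    constructor
    · refine IsClosed.union (s₁ := {t : unitInterval | ∀ ω, prof u h ω ≤ _}) ?_ ?_
      · simp only [ofPred_forall]
        exact isClosed_iInter fun ω => isClosed_le continuous_const (hc ω)
      · exact isClosed_le continuous_const (Prob.continuous_lower hN (isSimple_prof_mix u f g) hC)
    · refine IsClosed.union (s₁ := {t : unitInterval | ∀ ω, _ ≤ prof u h ω}) ?_ ?_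
      · simp only [ofPred_forall]
        exact isClosed_iInter fun ω => isClosed_le (hc ω) continuous_const
      · exact isClosed_le (Prob.continuous_upper hN (isSimple_prof_mix u f g) hC) continuous_const
  · rw [hr.isUtility, hr.isUtility]; exact le_total _ _
  · have ht : (0 : ℝ) < t := h0
    have hmix : Act.mix t (.const 𝓔 c₁) (.const 𝓔 c₂) = .const 𝓔 (Lottery.mix t c₁ c₂) := rfl
    have hp : prof u (Act.mix t f (.const 𝓔 c₂))
        = fun ω => t * prof u f ω + (1 - t) * Lottery.eu u c₂ := prof_mix u t f _
    constructor
    · rw [hmix, hr.rel_const_iff, hr.rel_const_iff, Lottery.eu_mix, hp,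
        Prob.lower_affine hN (isSimple_prof u f) ht, add_le_add_iff_right, mul_le_mul_iff_right₀ ht]
    · rw [hmix, hr.const_rel_iff, hr.const_rel_iff, Lottery.eu_mix, hp,
        Prob.upper_affine hN (isSimple_prof u f) ht, add_le_add_iff_right, mul_le_mul_iff_right₀ ht]

lemma sIndependence (hr : IsBoundRep R N P u) : SIndependence R := by
  intro f g h hf hg hh t h0 h1 hfh hgh
  have ht : (0 : ℝ) < t := h0
  have key : ∀ f' : Act 𝓔 Z, P.integ (prof u (Act.mix t f' h))
      = t * P.integ (prof u f') + (1 - t) * P.integ (prof u h) := by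
    intro f'
    rw [prof_mix, P.integ_add ((isSimple_prof u f').comp _) ((isSimple_prof u h).comp _)]
    have h1 := P.integ_affine (isSimple_prof u f') t 0
    have h2 := P.integ_affine (isSimple_prof u h) (1 - t) 0
    simp only [add_zero] at h1 h2
    rw [h1, h2]
  rw [hr.rel_iff_of_wellUnderstood hf hg, hr.rel_iff_of_wellUnderstood hfh hgh, key, key,
    add_le_add_iff_right, mul_le_mul_iff_right₀ ht]

lemma uniformComparability (hr : IsBoundRep R N P u) : UniformComparability R := by
  have hN := hr.one_le
  have hu := hr.isUtility
  intro f g hfg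
  constructor
  · intro h
    rw [hr.rel_iff, ← hu.dominates_iff, or_iff_right hfg] at h
    obtain ⟨h₁, hN₁, ⟨E, hE, hE0, hEs⟩, h₁i⟩ := exists_act_lower P u hN f
    obtain ⟨k₁, kN₁, ⟨F, hF, hF0, hFs⟩, k₁i⟩ := exists_act_upper P u hN g
    have hEn : P.IsNull E := ⟨E, hE, hE0, subset_rfl⟩
    have hFn : P.IsNull F := ⟨F, hF, hF0, subset_rfl⟩
    -- The optimal lower act is below f only off the null event E. Copying f on E gives dominance
    -- everywhere. This may create further values, but no further essential ones.
    have hh : (P.essVals (prof u (Act.splice ⟨E, hE⟩ f h₁))).encard ≤ N := by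
      rw [Prob.essVals_congr hEn fun ω hω => prof_splice_of_notMem u (E := ⟨E, hE⟩) f h₁ hω]
      exact Prob.essVals_encard_le_of_range hN₁
    have hk : (P.essVals (prof u (Act.splice ⟨F, hF⟩ g k₁))).encard ≤ N := by
      rw [Prob.essVals_congr hFn fun ω hω => prof_splice_of_notMem u (E := ⟨F, hF⟩) g k₁ hω]
      exact Prob.essVals_encard_le_of_range kN₁
    refine ⟨_, _, hr.wellUnderstood_iff.2 hh, hr.wellUnderstood_iff.2 hk,
      hu.dominates_iff.2 fun ω => ?_, ?_, hu.dominates_iff.2 fun ω => ?_⟩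
    · by_cases hω : ω ∈ E
      · exact (prof_splice_of_mem u (E := ⟨E, hE⟩) f h₁ hω).le
      · refine (prof_splice_of_notMem u (E := ⟨E, hE⟩) f h₁ hω).le.trans (not_lt.1 fun h' => ?_)
        exact hω (hEs h')
    · rw [hr.rel_iff_integ hh hk,
        Prob.integ_congr (isSimple_prof u _) (isSimple_prof u h₁) hEn
          fun ω hω => prof_splice_of_notMem u (E := ⟨E, hE⟩) f h₁ hω,
        Prob.integ_congr (isSimple_prof u _) (isSimple_prof u k₁) hFn
          fun ω hω => prof_splice_of_notMem u (E := ⟨F, hF⟩) g k₁ hω, h₁i, k₁i]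
      exact h
    · by_cases hω : ω ∈ F
      · exact (prof_splice_of_mem u (E := ⟨F, hF⟩) g k₁ hω).ge
      · refine le_trans (not_lt.1 fun h' => ?_) (prof_splice_of_notMem u (E := ⟨F, hF⟩) g k₁ hω).ge
        exact hω (hFs h')
  · rintro ⟨h, k, -, -, h1, h2, h3⟩
    exact hr.trans (hr.rel_of_le (hu.dominates_iff.1 h1))
      (hr.trans h2 (hr.rel_of_le (hu.dominates_iff.1 h3)))

lemma a1 (hr : IsBoundRep R N P u) {f : Act 𝓔 Z} (hf : WellUnderstood R f) {τ : Set (Set Ω)}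
    (hτ : Setoid.IsPartition τ)
    (hcoarse : ∀ T ∈ partition R f, ∃ T' ∈ τ, T ⊆ T') :
    ∃ g, WellUnderstood R g ∧ partition R g = τ := by
  have hu := hr.isUtility
  have hφ := isSimple_prof u f
  choose cell hcell huniq using fun ω => hτ.2 ω
  have hcell_eq : ∀ {T ω}, T ∈ τ → ω ∈ T → T = cell ω := fun hT hω => huniq _ _ ⟨hT, hω⟩
  have hfactor : ∀ ω ω', prof u f ω = prof u f ω' → cell ω = cell ω' := by
    intro ω ω' h
    obtain ⟨T', hT', hsub⟩ := hcoarse {ω'' | prof u f ω'' = prof u f ω}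
      (by rw [hu.partition_eq]; exact ⟨ω, rfl⟩)
    rw [← hcell_eq hT' (hsub (by rfl : ω ∈ {ω'' | prof u f ω'' = prof u f ω})),
      ← hcell_eq hT' (hsub (h.symm : ω' ∈ {ω'' | prof u f ω'' = prof u f ω}))]
  obtain ⟨k, hk⟩ : ∃ k : ℝ → Set Ω, ∀ ω, k (prof u f ω) = cell ω := by
    refine ⟨Function.extend (prof u f) cell fun _ => ∅, fun ω => ?_⟩
    exact Function.FactorsThrough.extend_apply (fun ω ω' h => hfactor ω ω' h) _ ω
  obtain ⟨c, d, hcd⟩ := exists_eu_lt hr.nonconstant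
  have hfin : (range cell).Finite := by
    have : cell = fun ω => k (prof u f ω) := funext fun ω => (hk ω).symm
    rw [this]; exact (hφ.comp k).1
  -- Distinct attainable utilities for the finitely many cells: with an injective numbering n, use
  -- u(d) + (u(c) - u(d)) / (n + 1).
  obtain ⟨e, heI, hinj⟩ : ∃ e : Set Ω → ℝ, (∀ T, e T ∈ Icc (Lottery.eu u d) (Lottery.eu u c)) ∧
      InjOn e (range cell) := by
    obtain ⟨n, hn⟩ := countable_iff_exists_injOn.1 hfin.countable
    have hpos : 0 < Lottery.eu u c - Lottery.eu u d := sub_pos.2 hcd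
    refine ⟨fun T => Lottery.eu u d + (Lottery.eu u c - Lottery.eu u d) / (n T + 1),
      fun T => ⟨?_, ?_⟩, fun T hT T' hT' h => hn hT hT' ?_⟩
    · have : 0 ≤ (Lottery.eu u c - Lottery.eu u d) / ((n T : ℝ) + 1) := by positivity
      linarith
    · have : (Lottery.eu u c - Lottery.eu u d) / ((n T : ℝ) + 1) ≤ Lottery.eu u c - Lottery.eu u d :=
        div_le_self hpos.le (by linarith [(n T).cast_nonneg (α := ℝ)])
      linarith
    · have h1 := add_left_cancel h
      rw [div_eq_mul_inv, div_eq_mul_inv, mul_right_inj' hpos.ne', inv_inj] at h1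
      exact_mod_cast add_right_cancel h1
  have hsimple : IsSimple 𝓔 fun ω => e (k (prof u f ω)) := hφ.comp fun x => e (k x)
  obtain ⟨g, hg⟩ := exists_prof_eq u hsimple fun ω =>
    Lottery.exists_eu_eq u (heI _).1 (heI _).2
  refine ⟨g, hr.wellUnderstood_iff.2 ?_, ?_⟩
  · rw [hg]
    exact (encard_le_encard (Prob.essVals_comp_subset hφ fun x => e (k x))).trans
      ((encard_image_le _ _).trans (hr.wellUnderstood_iff.1 hf))
  · rw [hu.partition_eq, hg]
    have hfib : ∀ ω, {ω' | e (k (prof u f ω')) = e (k (prof u f ω))} = cell ω := by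
      intro ω
      ext ω'
      simp only [hk, mem_ofPred_eq]
      constructor
      · intro h
        rw [← hinj ⟨ω', rfl⟩ ⟨ω, rfl⟩ h]; exact (hcell ω').2
      · intro h
        rw [hcell_eq (hcell ω).1 h]
    simp only [hfib]
    ext T
    constructor
    · rintro ⟨ω, rfl⟩; exact (hcell ω).1
    · intro hT
      obtain ⟨ω, hω⟩ : T.Nonempty := by
        by_contra! h
        exact hτ.1 (h ▸ hT)
      exact ⟨ω, (hcell_eq hT hω).symm⟩

lemma simplicityConditions (hr : IsBoundRep R N P u) : SimplicityConditions R := by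
  have hu := hr.isUtility
  refine ⟨fun E => ?_, fun f hf τ hτ _ h => hr.a1 hf hτ h, fun f g hf hg _ _ t _ _ => ?_,
    fun f hf T T' hT hT' hne hTn hTn' S S' hS hS' hdisj hunion => ?_, fun f hf E hE g => ?_⟩
  · obtain ⟨c, d, hcd⟩ := exists_eu_lt hr.nonconstant
    exact ⟨c, d, hu.strict_iff.2 hcd, hr.wellUnderstood_iff.2 (hr.essVals_splice_le _ _ _)⟩
  · rw [hr.wellUnderstood_iff] at hf ⊢
    -- A2: the mixture's profile is a function of the profile of f, so it has no more essential
    -- values.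
    have hfac : Function.FactorsThrough (prof u g) (prof u f) := by
      intro ω ω' h
      refine hu.indiff_iff.1 (hg {ω'' | prof u f ω'' = prof u f ω'} ?_ ω h ω' rfl)
      rw [hu.partition_eq]; exact ⟨ω', rfl⟩
    obtain ⟨k, hk⟩ : ∃ k : ℝ → ℝ, prof u (Act.mix t f g) = fun ω => k (prof u f ω) := by
      refine ⟨fun x => t * x + (1 - t) * Function.extend (prof u f) (prof u g) (fun _ => 0) x, ?_⟩
      rw [prof_mix]
      ext ω
      dsimp only
      rw [hfac.extend_apply]
    rw [hk]
    exact (encard_le_encard (Prob.essVals_comp_subset (isSimple_prof u f) k)).trans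
      ((encard_image_le _ _).trans hf)
  · rw [hu.partition_eq] at hT hT'
    obtain ⟨ω₁, hω₁⟩ := hT
    obtain ⟨ω₂, hω₂⟩ := hT'
    dsimp only at hω₁ hω₂
    have hv : prof u f ω₁ ≠ prof u f ω₂ := fun h => hne (Subtype.ext (by rw [← hω₁, ← hω₂, h]))
    have hSsub : ∀ ω, ω ∈ (S : Set Ω) ∨ ω ∈ (S' : Set Ω) ↔
        prof u f ω = prof u f ω₁ ∨ prof u f ω = prof u f ω₂ := by
      intro ω
      have : ω ∈ (S : Set Ω) ∪ S' ↔ ω ∈ (T : Set Ω) ∪ T' := by rw [hunion]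
      rw [mem_union, mem_union, ← hω₁, ← hω₂] at this
      exact this
    have hSd : ∀ ω, ω ∈ (S : Set Ω) → ω ∉ (S' : Set Ω) := fun ω h h' =>
      Set.disjoint_left.1 hdisj h h'
    -- A3: pay on S and S' the lotteries that f gives at representatives of T and T'.
    set g := Act.splice S (.const 𝓔 (f ω₁)) (Act.splice S' (.const 𝓔 (f ω₂)) f) with hgdef
    have hg1 : ∀ ω ∈ (S : Set Ω), prof u g ω = prof u f ω₁ := fun ω h =>
      prof_splice_of_mem u _ _ h
    have hg2 : ∀ ω ∈ (S' : Set Ω), prof u g ω = prof u f ω₂ := fun ω h => by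
      rw [hgdef, prof_splice_of_notMem u _ _ fun h' => hSd ω h' h, prof_splice_of_mem u _ _ h]
      rfl
    have hg3 : ∀ ω, ω ∉ (S : Set Ω) → ω ∉ (S' : Set Ω) → prof u g ω = prof u f ω := by
      intro ω h h'
      rw [hgdef, prof_splice_of_notMem u _ _ h, prof_splice_of_notMem u _ _ h']
    have hgS : ∀ ω, prof u g ω = prof u f ω₁ ↔ ω ∈ (S : Set Ω) := by
      intro ω
      refine ⟨fun h => ?_, hg1 ω⟩
      by_contra hS1
      by_cases hS2 : ω ∈ (S' : Set Ω)
      · rw [hg2 ω hS2] at h; exact hv h.symm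
      · rw [hg3 ω hS1 hS2] at h
        rcases (hSsub ω).2 (Or.inl h) with h' | h'
        exacts [hS1 h', hS2 h']
    have hgS' : ∀ ω, prof u g ω = prof u f ω₂ ↔ ω ∈ (S' : Set Ω) := by
      intro ω
      refine ⟨fun h => ?_, hg2 ω⟩
      by_contra hS2
      by_cases hS1 : ω ∈ (S : Set Ω)
      · rw [hg1 ω hS1] at h; exact hv h
      · rw [hg3 ω hS1 hS2] at h
        rcases (hSsub ω).2 (Or.inr h) with h' | h'
        exacts [hS1 h', hS2 h']
    have hgv : ∀ v, v ≠ prof u f ω₁ → v ≠ prof u f ω₂ → ∀ ω, prof u g ω = v ↔ prof u f ω = v := by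
      intro v h1 h2 ω
      by_cases hS : ω ∈ (S : Set Ω) ∨ ω ∈ (S' : Set Ω)
      · have ha : prof u g ω ≠ v := by
          rcases hS with h | h
          · rw [hg1 ω h]; exact h1.symm
          · rw [hg2 ω h]; exact h2.symm
        have hb : prof u f ω ≠ v := by
          rcases (hSsub ω).1 hS with h | h
          · rw [h]; exact h1.symm
          · rw [h]; exact h2.symm
        exact iff_of_false ha hb
      · rw [not_or] at hS
        rw [hg3 ω hS.1 hS.2]
    refine ⟨g, ?_, ?_⟩
    · rw [hr.wellUnderstood_iff] at hf ⊢
      -- The two moved values were essential for f, since T and T' are not null. All other values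
      -- keep their fibres.
      refine (encard_le_encard fun v hv => ?_).trans hf
      by_cases h1 : v = prof u f ω₁
      · intro hn
        refine hTn ((hr.null_iff T).2 ((Prob.isNull_iff T.2).1 (hn.mono ?_)))
        rw [← hω₁, h1]; exact fun _ h => h
      · by_cases h2 : v = prof u f ω₂
        · intro hn
          refine hTn' ((hr.null_iff T').2 ((Prob.isNull_iff T'.2).1 (hn.mono ?_)))
          rw [← hω₂, h2]; exact fun _ h => h
        · intro hn
          exact hv (hn.mono fun ω hω => (hgv v h1 h2 ω).1 hω)
    · have hS1 : (S : Set Ω) = {ω' | prof u g ω' = prof u f ω₁} := by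
        ext ω; exact (hgS ω).symm
      have hS2 : (S' : Set Ω) = {ω' | prof u g ω' = prof u f ω₂} := by
        ext ω; exact (hgS' ω).symm
      rw [hu.partition_eq, hu.partition_eq]
      ext A
      constructor
      · rintro ⟨ω, rfl⟩
        dsimp only
        by_cases h1 : prof u g ω = prof u f ω₁
        · left; left; rw [h1, hS1]
        by_cases h2 : prof u g ω = prof u f ω₂
        · left; right; rw [h2, hS2]; rfl
        have h3 : prof u f ω = prof u g ω := (hgv _ h1 h2 ω).1 rfl
        have h4 : {ω' | prof u g ω' = prof u g ω} = {ω' | prof u f ω' = prof u f ω} := by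
          ext ω'; rw [h3]; exact hgv _ h1 h2 ω'
        right
        refine ⟨⟨ω, h4.symm⟩, ?_⟩
        rintro (h | h)
        · rw [← hω₁] at h
          have : ω ∈ {ω' | prof u f ω' = prof u f ω₁} := by rw [← h]; rfl
          exact h1 (h3 ▸ this)
        · rw [mem_singleton_iff, ← hω₂] at h
          have : ω ∈ {ω' | prof u f ω' = prof u f ω₂} := by rw [← h]; rfl
          exact h2 (h3 ▸ this)
      · rintro ((rfl | h) | ⟨⟨ω, rfl⟩, h⟩)
        · obtain ⟨ω, hω⟩ := hS
          exact ⟨ω, by dsimp only; rw [hg1 ω hω, hS1]⟩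
        · rw [mem_singleton_iff] at h
          obtain ⟨ω, hω⟩ := hS'
          exact ⟨ω, by dsimp only; rw [hg2 ω hω, h, hS2]⟩
        · dsimp only at h ⊢
          have h1 : prof u f ω ≠ prof u f ω₁ := fun h' => h (Or.inl (by rw [h', hω₁]))
          have h2 : prof u f ω ≠ prof u f ω₂ := fun h' => h (Or.inr (by rw [h', hω₂]; rfl))
          have h3 : prof u g ω = prof u f ω := (hgv _ h1 h2 ω).2 rfl
          refine ⟨ω, ?_⟩
          ext ω'
          change prof u g ω' = prof u g ω ↔ prof u f ω' = prof u f ω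
          rw [h3]; exact hgv _ h1 h2 ω'
  · have hEn : P.IsNull (E : Set Ω) := (Prob.isNull_iff E.2).2 ((hr.null_iff E).1 hE)
    have hf' := hr.wellUnderstood_iff.1 hf
    have hg : (P.essVals (prof u (Act.splice E g f))).encard ≤ N := by
      rwa [Prob.essVals_congr hEn fun ω hω => prof_splice_of_notMem u g f hω]
    have hi : P.integ (prof u (Act.splice E g f)) = P.integ (prof u f) :=
      Prob.integ_congr (isSimple_prof u _) (isSimple_prof u f) hEn
        fun ω hω => prof_splice_of_notMem u g f hω
    exact ⟨(hr.rel_iff_integ hg hf').2 hi.ge, (hr.rel_iff_integ hf' hg).2 hi.le⟩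

end IsBoundRep

end SimpleBounds

end

/-! ### Two combinatorial lemmas: families of surjections, and sets of vectors stable under
contraction -/

noncomputable section

namespace SimpleBounds

open Set Function

/-- A family of surjections that is stable under relabelling and under changing one value (as long
as the map stays surjective) contains all surjections as soon as it contains one. -/
lemma surjective_mem_of_update_mem {X L : Type*} [Finite X] [DecidableEq X] {F : Set (X → L)}
    (hperm : ∀ p ∈ F, ∀ σ : Equiv.Perm L, (fun x => σ (p x)) ∈ F)
    (hup : ∀ p ∈ F, ∀ x j, Surjective p → Surjective (update p x j) → update p x j ∈ F)
    {p q : X → L} (hpF : p ∈ F) (hp : Surjective p) (hq : Surjective q) : q ∈ F := by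
  classical
  have := Fintype.ofFinite X
  let agree : (X → L) → Finset X := fun r => Finset.univ.filter fun x => r x = q x
  -- Choose a surjective member that agrees with q at as many points as possible. Any disagreement
  -- will contradict maximality.
  obtain ⟨⟨r, hrF, hr⟩, hmax⟩ : ∃ r : {r : X → L // r ∈ F ∧ Surjective r},
      ∀ r' : {r : X → L // r ∈ F ∧ Surjective r}, (agree r'.1).card ≤ (agree r.1).card := by
    have : Nonempty {r : X → L // r ∈ F ∧ Surjective r} := ⟨⟨p, hpF, hp⟩⟩
    have hfin : (range fun r : {r : X → L // r ∈ F ∧ Surjective r} => (agree r.1).card).Finite :=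
      (finite_Iic (Fintype.card X)).subset (by rintro _ ⟨r, rfl⟩; exact Finset.card_le_univ _)
    obtain ⟨_, ⟨r, rfl⟩, h⟩ := Set.exists_max_image _ id hfin (range_nonempty _)
    exact ⟨r, fun r' => h _ ⟨r', rfl⟩⟩
  by_cases hD : ∃ x₀, r x₀ ≠ q x₀
  swap
  · push Not at hD
    rwa [← funext hD]
  exfalso
  -- If a point of disagreement shared its label, correcting it would keep the map surjective and
  -- gain an agreement.
  have hsingle : ∀ x, r x ≠ q x → ∀ y, r y = r x → y = x := by
    intro x hx y hy
    by_contra hne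
    have hs : Surjective (update r x (q x)) := by
      intro l
      obtain ⟨z, rfl⟩ := hr l
      by_cases hz : z = x
      · exact ⟨y, by rw [update_of_ne hne, hy, hz]⟩
      · exact ⟨z, update_of_ne hz _ _⟩
    have := hmax ⟨_, hup r hrF x (q x) hr hs, hs⟩
    refine absurd this (not_le.2 (Finset.card_lt_card (Finset.ssubset_iff.2 ⟨x, ?_, ?_⟩)))
    · simpa [agree] using hx
    · intro z hz
      simp only [agree, Finset.mem_insert, Finset.mem_filter, Finset.mem_univ, true_and] at hz ⊢
      by_cases hzx : z = x
      · rw [hzx, update_self]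
      · rw [update_of_ne hzx]; exact hz.resolve_left hzx
  let D : Finset X := Finset.univ.filter fun x => r x ≠ q x
  have hmemD : ∀ x, x ∈ D ↔ r x ≠ q x := fun x => by simp [D]
  have hinj : InjOn r D := fun x hx y hy h => (hsingle y ((hmemD y).1 hy) x h)
  -- Counting: r is injective on D, and every label in r(D) is taken by q at a point of D. If q x₀
  -- were not among these labels, D without x₀ would already suffice, having too few points.
  obtain ⟨x₀, hx₀, hl⟩ : ∃ x ∈ D, q x ∉ D.image r → False := by
    obtain ⟨x₀, hx₀⟩ := hD
    refine ⟨x₀, (hmemD _).2 hx₀, fun hnot => ?_⟩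
    have hsurj : SurjOn q (D.erase x₀ : Finset X) (D.image r : Finset L) := by
      intro l hl
      obtain ⟨x, hx, rfl⟩ := Finset.mem_image.1 (Finset.mem_coe.1 hl)
      obtain ⟨y, hy⟩ := hq (r x)
      refine ⟨y, Finset.mem_coe.2 (Finset.mem_erase.2 ⟨?_, ?_⟩), hy⟩
      · rintro rfl
        exact hnot (hy ▸ Finset.mem_image_of_mem r hx)
      · rw [hmemD]
        intro h
        have := hsingle x ((hmemD x).1 hx) y (h.trans hy)
        rw [this] at hy
        exact (hmemD x).1 hx hy.symm
    have h1 := Finset.card_le_card_of_surjOn q hsurj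
    rw [Finset.card_image_of_injOn hinj, Finset.card_erase_of_mem ((hmemD _).2 hx₀)] at h1
    have : 0 < D.card := Finset.card_pos.2 ⟨x₀, (hmemD _).2 hx₀⟩
    omega
  obtain ⟨x₁, hx₁, h₁⟩ := Finset.mem_image.1 (not_not.1 hl)
  have hne := (hmemD _).1 hx₀
  -- Both swapped labels occur under r only at points of disagreement, so the transposition corrects
  -- x₀ and spoils no agreement.
  have := hmax ⟨_, hperm r hrF (Equiv.swap (r x₀) (q x₀)), (Equiv.surjective _).comp hr⟩
  refine absurd this (not_le.2 (Finset.card_lt_card (Finset.ssubset_iff.2 ⟨x₀, ?_, ?_⟩)))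
  · simpa [agree] using hne
  · intro z hz
    simp only [agree, Finset.mem_insert, Finset.mem_filter, Finset.mem_univ, true_and] at hz ⊢
    by_cases hzx : z = x₀
    · rw [hzx, Equiv.swap_apply_left]
    · have hz' := hz.resolve_left hzx
      rw [Equiv.swap_apply_of_ne_of_ne, hz']
      · exact fun h => hzx (hsingle x₀ hne z h)
      · intro h
        have := hsingle x₁ ((hmemD _).1 hx₁) z (h.trans h₁.symm)
        rw [this] at hz'
        exact (hmemD _).1 hx₁ hz'

lemma injective_update {ι X : Type*} [DecidableEq ι] {v : ι → X} (hinj : Injective v) {i : ι} {x : X}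
    (hx : ∀ j, j ≠ i → x ≠ v j) :
    Injective (update v i x) := by
  intro a b hab
  by_cases ha : a = i <;> by_cases hb : b = i
  · rw [ha, hb]
  · rw [ha, update_self, update_of_ne hb] at hab; exact absurd hab (hx b hb)
  · rw [hb, update_self, update_of_ne ha] at hab; exact absurd hab.symm (hx a ha)
  · rw [update_of_ne ha, update_of_ne hb] at hab; exact hinj hab

section Contraction

variable {ι : Type*} [Fintype ι] [DecidableEq ι] {D : Set (ι → ℝ)}

/-- Stability of a set of vectors under positive affine maps and under contracting some coordinates
of a vector with distinct coordinates towards another coordinate. -/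
structure ContractionStable (D : Set (ι → ℝ)) : Prop where
  not_injective : ∀ v, ¬ Injective v → v ∈ D
  affine : ∀ v ∈ D, ∀ a b : ℝ, 0 < a → (fun i => a * v i + b) ∈ D
  contract : ∀ v ∈ D, Injective v → ∀ (S : Finset ι) (j : ι) (t : ℝ), 0 < t → t < 1 →
    (fun i => if i ∈ S then t * v i + (1 - t) * v j else v i) ∈ D

namespace ContractionStable

/-- For s < 1 this is a contraction of the coordinate i. For s > 1, contract all other coordinates
towards v j by 1/s, then rescale by s. -/
lemma update_ray (h : ContractionStable D) {v : ι → ℝ} (hv : v ∈ D) (hinj : Injective v)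
    {i j : ι} (hij : j ≠ i) {s : ℝ} (hs : 0 < s) : update v i (v j + s * (v i - v j)) ∈ D := by
  rcases lt_trichotomy s 1 with h1 | rfl | h1
  · have := h.contract v hv hinj {i} j s hs h1
    convert this using 1
    ext k
    by_cases hk : k = i
    · subst hk; simp; ring
    · simp [hk]
  · rw [one_mul, add_sub_cancel, update_eq_self]; exact hv
  · have h0 := h.contract v hv hinj {i}ᶜ j s⁻¹ (inv_pos.2 hs) (inv_lt_one_of_one_lt₀ h1)
    have := h.affine _ h0 s (v j - s * v j) hs
    convert this using 1
    ext k
    by_cases hk : k = i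
    · subst hk; simp; ring
    · simp [hk]; field_simp; ring

lemma update_same_side (h : ContractionStable D) {v : ι → ℝ} (hv : v ∈ D) (hinj : Injective v)
    {i j : ι} (hij : j ≠ i) {x : ℝ} (hx : 0 < (x - v j) * (v i - v j)) : update v i x ∈ D := by
  have hne : v i - v j ≠ 0 := fun h0 => by rw [h0, mul_zero] at hx; exact lt_irrefl _ hx
  have hs : 0 < (x - v j) / (v i - v j) := by
    have : (x - v j) / (v i - v j) = (x - v j) * (v i - v j) / (v i - v j) ^ 2 := by field_simp
    rw [this]; positivity
  have := h.update_ray hv hinj hij hs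
  rwa [div_mul_cancel₀ _ hne, add_sub_cancel] at this

/-- A coordinate can move freely on its side of any other one. With two other coordinates, a target
separated from v i by both is reached in two moves, through a point m strictly between them. -/
lemma update_mem (h : ContractionStable D) (hι : 3 ≤ Fintype.card ι) {v : ι → ℝ} (hv : v ∈ D)
    (hinj : Injective v) (i : ι) (x : ℝ) : update v i x ∈ D := by
  by_cases hx : ∃ j, j ≠ i ∧ x = v j
  · obtain ⟨j, hj, rfl⟩ := hx
    refine h.not_injective _ fun h' => hj (h' ?_)
    rw [update_of_ne hj, update_self]
  push Not at hx
  obtain ⟨j₁, hj₁, j₂, hj₂, hlt⟩ : ∃ j₁, j₁ ≠ i ∧ ∃ j₂, j₂ ≠ i ∧ v j₁ < v j₂ := by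
    have hcard : 1 < (Finset.univ.erase i).card := by
      rw [Finset.card_erase_of_mem (Finset.mem_univ i), Finset.card_univ]; omega
    obtain ⟨a, ha, b, hb, hab⟩ := Finset.one_lt_card.1 hcard
    rcases lt_or_gt_of_ne (hinj.ne hab) with h' | h'
    · exact ⟨a, Finset.ne_of_mem_erase ha, b, Finset.ne_of_mem_erase hb, h'⟩
    · exact ⟨b, Finset.ne_of_mem_erase hb, a, Finset.ne_of_mem_erase ha, h'⟩
  by_cases h1 : 0 < (x - v j₁) * (v i - v j₁)
  · exact h.update_same_side hv hinj hj₁ h1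
  by_cases h2 : 0 < (x - v j₂) * (v i - v j₂)
  · exact h.update_same_side hv hinj hj₂ h2
  obtain ⟨m, hm, hmv⟩ := (Ioo_infinite hlt).exists_notMem_finite (finite_range v)
  have hm1 : ∀ j, j ≠ i → m ≠ v j := fun j _ h' => hmv ⟨j, h'.symm⟩
  have hinj' := injective_update hinj hm1
  have hx1 := hx j₁ hj₁
  have hx2 := hx j₂ hj₂
  have hi1 := hinj.ne hj₁.symm
  have hi2 := hinj.ne hj₂.symm
  have hfin : ∀ {j}, j ≠ i → update v i m ∈ D → 0 < (x - v j) * (m - v j) → update v i x ∈ D := by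
    intro j hj hmem hpos
    have := h.update_same_side hmem hinj' hj (x := x)
      (by rw [update_self, update_of_ne hj]; exact hpos)
    rwa [update_idem] at this
  rcases lt_or_gt_of_ne hi1 with ha | ha
  · have hx3 : v j₁ < x := by
      by_contra h'
      exact h1 (mul_pos_of_neg_of_neg (sub_neg.2 (lt_of_le_of_ne (not_lt.1 h') hx1)) (sub_neg.2 ha))
    refine hfin hj₁ (h.update_same_side hv hinj hj₂ (mul_pos_of_neg_of_neg (sub_neg.2 hm.2)
      (sub_neg.2 (ha.trans hlt)))) (mul_pos (sub_pos.2 hx3) (sub_pos.2 hm.1))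
  · have hx3 : x < v j₁ := by
      by_contra h'
      exact h1 (mul_pos (sub_pos.2 (lt_of_le_of_ne (not_lt.1 h') hx1.symm)) (sub_pos.2 ha))
    refine hfin hj₂ (h.update_same_side hv hinj hj₁ (mul_pos (sub_pos.2 hm.1) (sub_pos.2 ha)))
      (mul_pos_of_neg_of_neg (sub_neg.2 (hx3.trans hlt)) (sub_neg.2 hm.2))

lemma mem_of_injective_mem (h : ContractionStable D) (hι : 3 ≤ Fintype.card ι) {v : ι → ℝ}
    (hv : v ∈ D) (hinj : Injective v) (w : ι → ℝ) : w ∈ D := by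
  by_cases hw : Injective w
  swap
  · exact h.not_injective w hw
  -- Shift w away from all values of v, so that replacing coordinates one at a time keeps the vector
  -- injective. The shift is undone at the end.
  obtain ⟨c, -, hc⟩ := (infinite_univ (α := ℝ)).exists_notMem_finite
    (finite_range fun x : ι × ι => v x.1 - w x.2)
  have hc' : ∀ i j, w i + c ≠ v j := fun i j h' => hc ⟨(j, i), by dsimp only; linarith⟩
  have key : ∀ S : Finset ι, S.piecewise (fun i => w i + c) v ∈ D ∧
      Injective (S.piecewise (fun i => w i + c) v) := by
    intro S
    induction S using Finset.induction_on with
    | empty => simpa using ⟨hv, hinj⟩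
    | insert i S hi ih =>
      rw [Finset.piecewise_insert]
      refine ⟨h.update_mem hι ih.1 ih.2 i _, injective_update ih.2 fun j hj => ?_⟩
      by_cases hjS : j ∈ S
      · rw [Finset.piecewise_eq_of_mem _ _ _ hjS]
        exact fun h' => hj (hw (add_right_cancel h')).symm
      · rw [Finset.piecewise_eq_of_notMem _ _ _ hjS]
        exact hc' i j
  have h1 := h.affine _ (key Finset.univ).1 1 (-c) one_pos
  convert h1 using 1
  ext i
  simp

end ContractionStable

end Contraction

end SimpleBounds

end

/-! ### Certainty equivalents and revealed probability -/

noncomputable section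

namespace SimpleBounds

open Set

variable {Ω Z : Type*} {𝓔 : BooleanSubalgebra (Set Ω)} {R : Act 𝓔 Z → Act 𝓔 Z → Prop}
  {u : Z → ℝ}

/-- The axioms, together with a utility for the relation on constant acts. -/
structure SatisfiesAxioms (R : Act 𝓔 Z → Act 𝓔 Z → Prop) (u : Z → ℝ) : Prop where
  basic : BasicConditions R
  simplicity : SimplicityConditions R
  sIndependence : SIndependence R
  uniform : UniformComparability R
  utility : IsUtility R u

lemma BasicConditions.isVNM (h : BasicConditions R) :
    Lottery.IsVNM fun l m => R (.const 𝓔 l) (.const 𝓔 m) where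
  refl _ := h.preorder.1 _
  trans h1 h2 := h.preorder.2 _ _ _ h1 h2
  total := h.cCompleteness
  closed l m n := h.archimedean (.const 𝓔 l) (.const 𝓔 m) (.const 𝓔 n)
  indep l m n t h0 h1 := (h.weakCIndependence (.const 𝓔 l) m n t h0 h1).1

/-- `f` is indifferent to a constant act of utility `y`. -/
def HasCE (R : Act 𝓔 Z → Act 𝓔 Z → Prop) (u : Z → ℝ) (f : Act 𝓔 Z) (y : ℝ) : Prop :=
  ∃ c, Indiff R f (.const 𝓔 c) ∧ Lottery.eu u c = y

/-- Acts whose utility profile is a positive affine image of `φ` have certainty equivalents, of the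
utility that is the same affine image of `y`. -/
def HasVal (R : Act 𝓔 Z → Act 𝓔 Z → Prop) (u : Z → ℝ) (φ : Ω → ℝ) (y : ℝ) : Prop :=
  ∃ (f : Act 𝓔 Z) (a b : ℝ), 0 < a ∧ (prof u f = fun ω => a * φ ω + b) ∧ HasCE R u f (a * y + b)

lemma wellUnderstood_iff_hasCE {f : Act 𝓔 Z} : WellUnderstood R f ↔ ∃ y, HasCE R u f y :=
  ⟨fun ⟨c, hc⟩ => ⟨_, c, hc, rfl⟩, fun ⟨_, c, hc, _⟩ => ⟨c, hc⟩⟩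

namespace SatisfiesAxioms

section CertaintyEquivalents

lemma rel_refl (h : SatisfiesAxioms R u) (f : Act 𝓔 Z) : R f f := h.basic.preorder.1 f

lemma rel_trans (h : SatisfiesAxioms R u) {f g k : Act 𝓔 Z} (h1 : R f g) (h2 : R g k) : R f k :=
  h.basic.preorder.2 _ _ _ h1 h2

lemma rel_of_le (h : SatisfiesAxioms R u) {f g : Act 𝓔 Z} (hle : ∀ ω, prof u g ω ≤ prof u f ω) :
    R f g := h.basic.monotonicity _ _ (h.utility.dominates_iff.2 hle)

lemma exists_eu_lt (h : SatisfiesAxioms R u) : ∃ c d : Lottery Z, Lottery.eu u d < Lottery.eu u c := by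
  by_contra! hall
  obtain ⟨f, g, -, h2⟩ := h.basic.nontriviality
  exact h2 (h.rel_of_le fun ω => hall _ _)

lemma nonconstant (h : SatisfiesAxioms R u) : ∃ z z', u z ≠ u z' := by
  by_contra! hall
  obtain ⟨c, d, hcd⟩ := h.exists_eu_lt
  obtain ⟨z₀⟩ := c.nonempty
  have : ∀ l : Lottery Z, Lottery.eu u l = u z₀ := fun l => by
    have := Lottery.eu_affine u 0 (u z₀) l
    rw [zero_mul, zero_add] at this
    rw [← this]
    congr 1
    ext z
    rw [zero_mul, zero_add, hall z z₀]
  rw [this, this] at hcd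
  exact lt_irrefl _ hcd

lemma nonempty (h : SatisfiesAxioms R u) : Nonempty Ω := by
  by_contra hne
  rw [not_nonempty_iff] at hne
  obtain ⟨f, g, -, h2⟩ := h.basic.nontriviality
  exact h2 (h.rel_of_le fun ω => isEmptyElim ω)

lemma hasCE_congr (h : SatisfiesAxioms R u) {f g : Act 𝓔 Z} (hfg : prof u f = prof u g) {y : ℝ}
    (hf : HasCE R u f y) : HasCE R u g y := by
  obtain ⟨c, ⟨h1, h2⟩, hc⟩ := hf
  exact ⟨c, ⟨h.rel_trans (h.rel_of_le fun ω => by rw [hfg]) h1,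
    h.rel_trans h2 (h.rel_of_le fun ω => by rw [hfg])⟩, hc⟩

lemma rel_iff_of_hasCE (h : SatisfiesAxioms R u) {f g : Act 𝓔 Z} {y z : ℝ} (hf : HasCE R u f y)
    (hg : HasCE R u g z) : R f g ↔ z ≤ y := by
  obtain ⟨c, ⟨h1, h2⟩, rfl⟩ := hf
  obtain ⟨d, ⟨h3, h4⟩, rfl⟩ := hg
  rw [← h.utility]
  exact ⟨fun hfg => h.rel_trans h2 (h.rel_trans hfg h3),
    fun hcd => h.rel_trans h1 (h.rel_trans hcd h4)⟩

lemma hasCE_unique (h : SatisfiesAxioms R u) {f : Act 𝓔 Z} {y z : ℝ} (hf : HasCE R u f y)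
    (hf' : HasCE R u f z) : y = z :=
  le_antisymm ((h.rel_iff_of_hasCE hf' hf).1 (h.rel_refl f))
    ((h.rel_iff_of_hasCE hf hf').1 (h.rel_refl f))

lemma hasCE_const (h : SatisfiesAxioms R u) (c : Lottery Z) :
    HasCE R u (.const 𝓔 c) (Lottery.eu u c) := ⟨c, ⟨h.rel_refl _, h.rel_refl _⟩, rfl⟩

lemma hasCE_mix (h : SatisfiesAxioms R u) {f : Act 𝓔 Z} {y : ℝ} (hf : HasCE R u f y) (c : Lottery Z)
    {t : unitInterval} (h0 : 0 < t) (h1 : t < 1) :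
    HasCE R u (.mix t f (.const 𝓔 c)) (t * y + (1 - t) * Lottery.eu u c) := by
  obtain ⟨e, ⟨h2, h3⟩, rfl⟩ := hf
  exact ⟨Lottery.mix t e c, ⟨(h.basic.weakCIndependence f e c t h0 h1).1.1 h2,
    (h.basic.weakCIndependence f e c t h0 h1).2.1 h3⟩, Lottery.eu_mix _ _ _ _⟩

/-- By monotonicity w lies between the utilities obtained by mixing the worst and the best lottery
of f with c. So some e mixed with c has utility w, and Weak C-Independence cancels c. -/
lemma exists_hasCE_of_mix (h : SatisfiesAxioms R u) {f : Act 𝓔 Z} {w : ℝ} {c : Lottery Z}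
    {t : unitInterval} (h0 : 0 < t) (h1 : t < 1) (hf : HasCE R u (.mix t f (.const 𝓔 c)) w) :
    ∃ y, HasCE R u f y := by
  have := h.nonempty
  have ht : (0 : ℝ) < t := h0
  obtain ⟨ω₀, hω₀⟩ := exists_prof_le u f
  obtain ⟨ω₁, hω₁⟩ := exists_le_prof u f
  have hmix : ∀ l : Lottery Z, Lottery.eu u (Lottery.mix t l c)
      = t * Lottery.eu u l + (1 - t) * Lottery.eu u c := fun l => Lottery.eu_mix _ _ _ _
  have hup : w ≤ t * Lottery.eu u (f ω₀) + (1 - t) * Lottery.eu u c := by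
    rw [← hmix, ← h.rel_iff_of_hasCE (h.hasCE_const (Lottery.mix t (f ω₀) c)) hf]
    refine h.rel_of_le fun ω => ?_
    rw [prof_mix, prof_const, prof_const, hmix]
    have := mul_le_mul_of_nonneg_left (hω₀ ω) ht.le
    exact add_le_add_left this _
  have hlow : t * Lottery.eu u (f ω₁) + (1 - t) * Lottery.eu u c ≤ w := by
    rw [← hmix, ← h.rel_iff_of_hasCE hf (h.hasCE_const (Lottery.mix t (f ω₁) c))]
    refine h.rel_of_le fun ω => ?_
    rw [prof_mix, prof_const, prof_const, hmix]
    have := mul_le_mul_of_nonneg_left (hω₁ ω) ht.le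
    exact add_le_add_left this _
  obtain ⟨e, he⟩ := Lottery.exists_eu_eq u (l := f ω₁) (m := f ω₀)
    (y := (w - (1 - t) * Lottery.eu u c) / t) (by rw [le_div_iff₀ ht]; linarith)
    (by rw [div_le_iff₀ ht]; linarith)
  have he' : t * Lottery.eu u e + (1 - t) * Lottery.eu u c = w := by rw [he]; field_simp; ring
  have h2 : HasCE R u (.mix t (.const 𝓔 e) (.const 𝓔 c)) w := by
    rw [← he', ← hmix]; exact h.hasCE_const (Lottery.mix t e c)
  exact ⟨_, e, ⟨(h.basic.weakCIndependence f e c t h0 h1).1.2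
    ((h.rel_iff_of_hasCE hf h2).2 le_rfl), (h.basic.weakCIndependence f e c t h0 h1).2.2
    ((h.rel_iff_of_hasCE h2 hf).2 le_rfl)⟩, rfl⟩

/-- For suitable constants, mixing g with e at weight t gives the same profile as mixing f with e'
at weight t * r. The utility required of e' tends to the interior value m as t → 0, so it is
attainable for small t. Certainty equivalents then pass from f to the common mixture and back to g.
-/
lemma hasCE_affine (h : SatisfiesAxioms R u) {f g : Act 𝓔 Z} {y r s : ℝ} (hf : HasCE R u f y)
    (hr : 0 < r) (hg : prof u g = fun ω => r * prof u f ω + s) : HasCE R u g (r * y + s) := by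
  obtain ⟨c, d, hcd⟩ := h.exists_eu_lt
  set m := (Lottery.eu u c + Lottery.eu u d) / 2 with hm
  obtain ⟨e, he⟩ := Lottery.exists_eu_eq u (l := d) (m := c) (y := m) (by linarith) (by linarith)
  obtain ⟨t, ⟨⟨ht1, htr⟩, htl, htu⟩, ht0⟩ : ∃ t : ℝ, ((t < 1 ∧ t * r < 1) ∧
      Lottery.eu u d < (t * s + (1 - t) * m) / (1 - t * r) ∧
      (t * s + (1 - t) * m) / (1 - t * r) < Lottery.eu u c) ∧ 0 < t := by
    have hcont : ContinuousAt (fun t : ℝ => (t * s + (1 - t) * m) / (1 - t * r)) 0 :=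
      ContinuousAt.div (by fun_prop) (by fun_prop) (by simp)
    have h1 : ∀ᶠ t : ℝ in nhds 0, t < 1 := eventually_lt_nhds one_pos
    have h2 : ∀ᶠ t : ℝ in nhds 0, t * r < 1 :=
      (ContinuousAt.eventually_lt (f := fun t : ℝ => t * r) (g := fun _ => 1) (by fun_prop)
        (by fun_prop) (by simp))
    have h0 : (0 * s + (1 - 0) * m) / (1 - 0 * r) = m := by simp
    have h3 := hcont.eventually (lt_mem_nhds
      (show Lottery.eu u d < (0 * s + (1 - 0) * m) / (1 - 0 * r) by rw [h0]; linarith))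
    have h4 := hcont.eventually (gt_mem_nhds
      (show (0 * s + (1 - 0) * m) / (1 - 0 * r) < Lottery.eu u c by rw [h0]; linarith))
    exact ((((h1.and h2).and (h3.and h4)).filter_mono nhdsWithin_le_nhds).and
      (self_mem_nhdsWithin (a := (0 : ℝ)) (s := Ioi 0))).exists
  obtain ⟨e', he'⟩ := Lottery.exists_eu_eq u htl.le htu.le
  have hd : 1 - t * r ≠ 0 := by linarith
  rw [eq_div_iff hd] at he'
  let T : unitInterval := ⟨t, ht0.le, ht1.le⟩
  let T' : unitInterval := ⟨t * r, by positivity, htr.le⟩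
  have hT' : 0 < T' := mul_pos ht0 hr
  have h1 := h.hasCE_mix hf e' hT' (show T' < 1 from htr)
  have h2 : prof u (Act.mix T' f (.const 𝓔 e')) = prof u (Act.mix T g (.const 𝓔 e)) := by
    rw [prof_mix, prof_mix, hg, prof_const, prof_const]
    ext ω
    simp only [T, T', he]
    linarith
  have h3 := h.hasCE_congr h2 h1
  obtain ⟨z, hz⟩ := h.exists_hasCE_of_mix (show 0 < T from ht0) (show T < 1 from ht1) h3
  have h4 := h.hasCE_unique h3 (h.hasCE_mix hz e (show 0 < T from ht0) (show T < 1 from ht1))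
  simp only [T, T', he] at h4
  have h5 : t * (r * y + s) = t * z := by linarith
  rw [mul_left_cancel₀ ht0.ne' h5]
  exact hz

lemma hasCE_of_hasVal (h : SatisfiesAxioms R u) {φ : Ω → ℝ} {y : ℝ} (hφ : HasVal R u φ y)
    {f : Act 𝓔 Z} {a b : ℝ} (ha : 0 < a) (hf : prof u f = fun ω => a * φ ω + b) :
    HasCE R u f (a * y + b) := by
  obtain ⟨g, a', b', ha', hg, hce⟩ := hφ
  have := h.hasCE_affine (g := f) hce (div_pos ha ha') (s := b - a / a' * b') (by
    rw [hf, hg]; ext ω; field_simp; ring)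
  convert this using 1
  field_simp; ring

lemma hasVal_prof {f : Act 𝓔 Z} {y : ℝ} (hf : HasCE R u f y) : HasVal R u (prof u f) y :=
  ⟨f, 1, 0, one_pos, by simp, by simpa using hf⟩

lemma hasVal_prof_iff (h : SatisfiesAxioms R u) {f : Act 𝓔 Z} {y : ℝ} :
    HasVal R u (prof u f) y ↔ HasCE R u f y := by
  refine ⟨fun hf => ?_, hasVal_prof⟩
  have := h.hasCE_of_hasVal hf one_pos (f := f) (b := 0) (by simp)
  simpa using this

lemma hasVal_affine {φ : Ω → ℝ} {y : ℝ} (hφ : HasVal R u φ y) {a : ℝ} (ha : 0 < a) (b : ℝ) :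
    HasVal R u (fun ω => a * φ ω + b) (a * y + b) := by
  obtain ⟨f, a', b', ha', hf, hce⟩ := hφ
  refine ⟨f, a' / a, b' - a' / a * b, div_pos ha' ha, ?_, ?_⟩
  · rw [hf]; ext ω; field_simp; ring
  · convert hce using 1; field_simp; ring

lemma isSimple_of_hasVal {φ : Ω → ℝ} {y : ℝ} (hφ : HasVal R u φ y) : IsSimple 𝓔 φ := by
  obtain ⟨f, a, b, ha, hf, -⟩ := hφ
  have : φ = fun ω => (prof u f ω - b) / a := by rw [hf]; ext ω; field_simp; ring
  rw [this]
  exact (isSimple_prof u f).comp fun x => (x - b) / a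

/-- Bounded functions fit, after a positive affine map, into the attainable utilities. This lets
`HasVal` be used for arbitrary simple functions even if u is bounded. -/
lemma exists_scale (h : SatisfiesAxioms R u) (C : ℝ) :
    ∃ a b : ℝ, 0 < a ∧ ∀ x, |x| ≤ C → ∃ l : Lottery Z, Lottery.eu u l = a * x + b := by
  obtain ⟨c, d, hcd⟩ := h.exists_eu_lt
  have h0 : 0 < Lottery.eu u c - Lottery.eu u d := sub_pos.2 hcd
  have hC : 0 < |C| + 1 := by positivity
  refine ⟨(Lottery.eu u c - Lottery.eu u d) / 2 / (|C| + 1), (Lottery.eu u c + Lottery.eu u d) / 2,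
    by positivity, fun x hx => ?_⟩
  have h1 : |(Lottery.eu u c - Lottery.eu u d) / 2 / (|C| + 1) * x|
      ≤ (Lottery.eu u c - Lottery.eu u d) / 2 := by
    rw [abs_mul, abs_of_pos (by positivity : 0 < (Lottery.eu u c - Lottery.eu u d) / 2 / (|C| + 1)),
      div_mul_eq_mul_div, div_le_iff₀ hC]
    exact mul_le_mul_of_nonneg_left (by linarith [le_abs_self C]) (by positivity)
  rw [abs_le] at h1
  exact Lottery.exists_eu_eq u (l := d) (m := c) (by linarith) (by linarith)

lemma exists_acts (h : SatisfiesAxioms R u) {φ ψ : Ω → ℝ} (hφ : IsSimple 𝓔 φ) (hψ : IsSimple 𝓔 ψ) :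
    ∃ (a b : ℝ) (f g : Act 𝓔 Z), 0 < a ∧ (prof u f = fun ω => a * φ ω + b) ∧
      prof u g = fun ω => a * ψ ω + b := by
  obtain ⟨C, hC⟩ := hφ.bounded
  obtain ⟨C', hC'⟩ := hψ.bounded
  obtain ⟨a, b, ha, hab⟩ := h.exists_scale (max C C')
  obtain ⟨f, hf⟩ := exists_prof_eq (𝓔 := 𝓔) u (hφ.comp fun x => a * x + b)
    fun ω => hab _ ((hC ω).trans (le_max_left _ _))
  obtain ⟨g, hg⟩ := exists_prof_eq (𝓔 := 𝓔) u (hψ.comp fun x => a * x + b)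
    fun ω => hab _ ((hC' ω).trans (le_max_right _ _))
  exact ⟨a, b, f, g, ha, hf, hg⟩

lemma hasVal_unique (h : SatisfiesAxioms R u) {φ : Ω → ℝ} {y z : ℝ} (hy : HasVal R u φ y)
    (hz : HasVal R u φ z) : y = z := by
  obtain ⟨a, b, f, -, ha, hf, -⟩ := h.exists_acts (isSimple_of_hasVal hy) (isSimple_of_hasVal hy)
  have := h.hasCE_unique (h.hasCE_of_hasVal hy ha hf) (h.hasCE_of_hasVal hz ha hf)
  exact mul_left_cancel₀ ha.ne' (add_right_cancel this)

lemma hasVal_mono (h : SatisfiesAxioms R u) {φ ψ : Ω → ℝ} {y z : ℝ} (hy : HasVal R u φ y)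
    (hz : HasVal R u ψ z) (hle : ∀ ω, φ ω ≤ ψ ω) : y ≤ z := by
  obtain ⟨a, b, f, g, ha, hf, hg⟩ := h.exists_acts (isSimple_of_hasVal hy) (isSimple_of_hasVal hz)
  have h1 := (h.rel_iff_of_hasCE (h.hasCE_of_hasVal hz ha hg) (h.hasCE_of_hasVal hy ha hf)).1
    (h.rel_of_le fun ω => by
      rw [hf, hg]
      exact add_le_add_left (mul_le_mul_of_nonneg_left (hle ω) ha.le) _)
  exact le_of_mul_le_mul_left (le_of_add_le_add_right h1) ha

lemma hasVal_const (h : SatisfiesAxioms R u) (x : ℝ) : HasVal R u (fun _ : Ω => x) x := by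
  obtain ⟨c, -, -⟩ := h.exists_eu_lt
  exact ⟨.const 𝓔 c, 1, Lottery.eu u c - x, one_pos, by rw [prof_const]; ext ω; ring, by
    rw [one_mul, add_sub_cancel]; exact h.hasCE_const c⟩

/-- Certainty equivalents are additive where they exist. -/
lemma hasVal_add (h : SatisfiesAxioms R u) {φ ψ : Ω → ℝ} {y z w : ℝ} (hy : HasVal R u φ y)
    (hz : HasVal R u ψ z) (hw : HasVal R u (fun ω => φ ω + ψ ω) w) : w = y + z := by
  obtain ⟨a, b, f, g, ha, hf, hg⟩ := h.exists_acts (isSimple_of_hasVal hy) (isSimple_of_hasVal hz)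
  let t : unitInterval := ⟨1 / 2, by norm_num, by norm_num⟩
  have ht : (t : ℝ) = 1 / 2 := rfl
  have h0 : 0 < t := by rw [← Subtype.coe_lt_coe, ht]; norm_num
  have h1 : t < 1 := by rw [← Subtype.coe_lt_coe, ht]; norm_num
  have hfc := h.hasCE_of_hasVal hy ha hf
  have hgc := h.hasCE_of_hasVal hz ha hg
  have hmc : HasCE R u (.mix t f g) (a / 2 * w + b) := by
    refine h.hasCE_of_hasVal hw (by positivity) ?_
    rw [prof_mix, hf, hg]
    ext ω
    simp only [ht]
    ring
  obtain ⟨c, hc, hce⟩ := hfc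
  -- Replace f in the mixture by its certainty equivalent c: the value of the new mixture is known
  -- by Weak C-Independence, and S-Independence makes both mixtures indifferent.
  have hcm : HasCE R u (.mix t (.const 𝓔 c) g) (1 / 2 * (a * z + b) + 1 / 2 * (a * y + b)) := by
    have := h.hasCE_mix hgc c h0 h1
    rw [ht, hce] at this
    refine h.hasCE_congr ?_ (y := _) (by convert this using 1; ring)
    rw [prof_mix, prof_mix]
    ext ω
    simp only [ht]
    ring
  have hwf : WellUnderstood R f := ⟨c, hc⟩
  have hwc : WellUnderstood R (.const 𝓔 c) := wellUnderstood_iff_hasCE.2 ⟨_, h.hasCE_const c⟩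
  have hwg : WellUnderstood R g := wellUnderstood_iff_hasCE.2 ⟨_, hgc⟩
  have hw1 : WellUnderstood R (.mix t f g) := wellUnderstood_iff_hasCE.2 ⟨_, hmc⟩
  have hw2 : WellUnderstood R (.mix t (.const 𝓔 c) g) := wellUnderstood_iff_hasCE.2 ⟨_, hcm⟩
  have h2 := (h.sIndependence f (.const 𝓔 c) g hwf hwc hwg t h0 h1 hw1 hw2).1 hc.1
  have h3 := (h.sIndependence (.const 𝓔 c) f g hwc hwf hwg t h0 h1 hw2 hw1).1 hc.2
  have h4 := (h.rel_iff_of_hasCE hmc hcm).1 h2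
  have h5 := (h.rel_iff_of_hasCE hcm hmc).1 h3
  have h6 : a * w = a * (y + z) := by linarith
  exact mul_left_cancel₀ ha.ne' h6

-- A0 supplies one well-understood bet on E, and a positive affine map turns it into any bet with x
-- > y. For x < y, bet on the complement.
open Classical in
lemma exists_hasVal_ite (h : SatisfiesAxioms R u) {E : Set Ω} (hE : E ∈ 𝓔) (x y : ℝ) :
    ∃ v, HasVal R u (fun ω => if ω ∈ E then x else y) v := by
  have key : ∀ {E : Set Ω}, E ∈ 𝓔 → ∀ x y : ℝ, y < x →
      ∃ v, HasVal R u (fun ω => if ω ∈ E then x else y) v := by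
    intro E hE x y hxy
    obtain ⟨c, d, hcd, hw⟩ := h.simplicity.a0 ⟨E, hE⟩
    rw [h.utility.strict_iff] at hcd
    obtain ⟨v, hv⟩ := (wellUnderstood_iff_hasCE (u := u)).1 hw
    have h1 := hasVal_affine (hasVal_prof hv) (div_pos (sub_pos.2 hxy) (sub_pos.2 hcd))
      (y - (x - y) / (Lottery.eu u c - Lottery.eu u d) * Lottery.eu u d)
    have hne : Lottery.eu u c - Lottery.eu u d ≠ 0 := (sub_pos.2 hcd).ne'
    refine ⟨(x - y) / (Lottery.eu u c - Lottery.eu u d) * v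
      + (y - (x - y) / (Lottery.eu u c - Lottery.eu u d) * Lottery.eu u d), ?_⟩
    convert h1 using 1
    rw [prof_splice]
    ext ω
    dsimp only
    split_ifs with hω
    · rw [prof_const]; field_simp; ring
    · rw [prof_const]; ring
  rcases lt_trichotomy y x with hxy | rfl | hxy
  · exact key hE x y hxy
  · simpa using ⟨y, h.hasVal_const y⟩
  · obtain ⟨v, hv⟩ := key (𝓔.compl_mem hE) y x hxy
    refine ⟨v, ?_⟩
    convert hv using 2 with ω
    by_cases hω : ω ∈ E <;> simp [hω]

lemma exists_hasVal_of_encard_le_two (h : SatisfiesAxioms R u) {φ : Ω → ℝ} (hφ : IsSimple 𝓔 φ)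
    (hcard : (range φ).encard ≤ 2) : ∃ v, HasVal R u φ v := by
  classical
  obtain ⟨ω₀⟩ := h.nonempty
  by_cases hc : ∀ ω, φ ω = φ ω₀
  · rw [show φ = fun _ => φ ω₀ from funext hc]
    exact ⟨_, h.hasVal_const _⟩
  push Not at hc
  obtain ⟨ω₁, h₁⟩ := hc
  have : φ = fun ω => if ω ∈ φ ⁻¹' {φ ω₀} then φ ω₀ else φ ω₁ := by
    ext ω
    split_ifs with hω
    · exact hω
    · by_contra hω'
      have hsub : ({φ ω, φ ω₀, φ ω₁} : Set ℝ) ⊆ range φ := by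
        rintro _ (rfl | rfl | rfl) <;> exact ⟨_, rfl⟩
      have h3 : ({φ ω, φ ω₀, φ ω₁} : Set ℝ).encard = 3 :=
        encard_eq_three.2 ⟨_, _, _, hω, hω', h₁.symm, rfl⟩
      have := (encard_le_encard hsub).trans hcard
      rw [h3] at this
      exact absurd this (by norm_num)
  rw [this]
  exact h.exists_hasVal_ite (hφ.2 _) _ _

end CertaintyEquivalents

section Probability

open Classical in
/-- The probability revealed by bets. -/
def prob (h : SatisfiesAxioms R u) : Prob 𝓔 where
  toFun E := (h.exists_hasVal_ite E.2 1 0).choose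
  nonneg E := h.hasVal_mono (h.hasVal_const 0) (h.exists_hasVal_ite E.2 1 0).choose_spec
    fun ω => by split_ifs <;> norm_num
  univ := h.hasVal_unique (h.exists_hasVal_ite 𝓔.top_mem 1 0).choose_spec (by
    have := h.hasVal_const (Ω := Ω) 1
    convert this using 2
    simp)
  additive A B hAB := by
    refine h.hasVal_add (h.exists_hasVal_ite A.2 1 0).choose_spec
      (h.exists_hasVal_ite B.2 1 0).choose_spec ?_
    convert (h.exists_hasVal_ite (A ⊔ B).2 1 0).choose_spec using 2 with ω
    have hd : ω ∈ (A : Set Ω) → ω ∉ (B : Set Ω) := fun h1 => Set.disjoint_left.1 hAB h1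
    by_cases hA : ω ∈ (A : Set Ω)
    · simp [hA, hd hA]
    · simp [hA]

open Classical in
lemma hasVal_ite (h : SatisfiesAxioms R u) {E : Set Ω} (hE : E ∈ 𝓔) (x y : ℝ) :
    HasVal R u (fun ω => if ω ∈ E then x else y) (h.prob.pr E * x + (1 - h.prob.pr E) * y) := by
  have key : ∀ {E : Set Ω}, E ∈ 𝓔 → ∀ x y : ℝ, y < x → HasVal R u
      (fun ω => if ω ∈ E then x else y) (h.prob.pr E * x + (1 - h.prob.pr E) * y) := by
    intro E hE x y hxy
    have h1 : HasVal R u (fun ω => if ω ∈ E then 1 else 0) (h.prob.pr E) := by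
      rw [h.prob.pr_coe ⟨E, hE⟩]
      exact (h.exists_hasVal_ite hE 1 0).choose_spec
    have h2 := hasVal_affine h1 (sub_pos.2 hxy) y
    convert h2 using 1
    · ext ω; split_ifs <;> ring
    · ring
  rcases lt_trichotomy y x with hxy | rfl | hxy
  · exact key hE x y hxy
  · convert h.hasVal_const (Ω := Ω) y using 1
    · simp
    · ring
  · convert key (𝓔.compl_mem hE) y x hxy using 1
    · ext ω
      by_cases hω : ω ∈ E <;> simp [hω]
    · rw [h.prob.pr_compl hE]; ring

lemma hasCE_splice (h : SatisfiesAxioms R u) (E : 𝓔) (c d : Lottery Z) :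
    HasCE R u (.splice E (.const 𝓔 c) (.const 𝓔 d))
      (h.prob.pr E * Lottery.eu u c + (1 - h.prob.pr E) * Lottery.eu u d) := by
  classical
  rw [← h.hasVal_prof_iff, prof_splice]
  exact h.hasVal_ite E.2 (Lottery.eu u c) (Lottery.eu u d)

lemma null_iff (h : SatisfiesAxioms R u) (E : 𝓔) : Null R E ↔ h.prob.pr E = 0 := by
  rw [← null_euPref_iff h.nonconstant (P := h.prob)]
  simp only [Null, Strict, euPref, expectedUtility_eq_integ, integ_prof_splice,
    h.rel_iff_of_hasCE (h.hasCE_splice _ _ _) (h.hasCE_splice _ _ _)]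

end Probability

end SatisfiesAxioms

end SimpleBounds

end

/-! ### Feasible partitions and sufficiency of the axioms -/

noncomputable section

namespace SimpleBounds

open Set

variable {Ω Z : Type*} {𝓔 : BooleanSubalgebra (Set Ω)} {R : Act 𝓔 Z → Act 𝓔 Z → Prop}
  {u : Z → ℝ}

lemma eq_iff_of_range_fiber_eq {X Y : Type*} {χ : Ω → X} {ψ : Ω → Y}
    (h : (range fun ω => {ω' | χ ω' = χ ω}) = range fun ω => {ω' | ψ ω' = ψ ω}) (ω ω' : Ω) :
    χ ω = χ ω' ↔ ψ ω = ψ ω' := by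
  obtain ⟨ω'', h''⟩ : {ω'' | χ ω'' = χ ω'} ∈ range fun ω => {ω' | ψ ω' = ψ ω} := h ▸ ⟨ω', rfl⟩
  dsimp only at h''
  have h1 : ψ ω' = ψ ω'' := by
    have : ω' ∈ {ω | ψ ω = ψ ω''} := by rw [h'']; rfl
    exact this
  have h2 : ω ∈ {ω''' | χ ω''' = χ ω'} ↔ ω ∈ {ω | ψ ω = ψ ω''} := by rw [h'']
  rw [h1]
  exact h2

namespace SatisfiesAxioms

/-- Profiles of well-understood acts, up to positive affine maps. -/
def Feasible (R : Act 𝓔 Z → Act 𝓔 Z → Prop) (u : Z → ℝ) (φ : Ω → ℝ) : Prop := ∃ y, HasVal R u φ y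

lemma Feasible.isSimple {φ : Ω → ℝ} (hφ : Feasible R u φ) : IsSimple 𝓔 φ :=
  let ⟨_, hy⟩ := hφ
  isSimple_of_hasVal hy

lemma Feasible.wellUnderstood (h : SatisfiesAxioms R u) {φ : Ω → ℝ} (hφ : Feasible R u φ)
    {f : Act 𝓔 Z} {a b : ℝ} (ha : 0 < a) (hf : prof u f = fun ω => a * φ ω + b) :
    WellUnderstood R f :=
  let ⟨_, hy⟩ := hφ
  wellUnderstood_iff_hasCE.2 ⟨_, h.hasCE_of_hasVal hy ha hf⟩

lemma feasible_prof_iff (h : SatisfiesAxioms R u) {f : Act 𝓔 Z} :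
    Feasible R u (prof u f) ↔ WellUnderstood R f := by
  rw [wellUnderstood_iff_hasCE (u := u)]
  exact exists_congr fun y => h.hasVal_prof_iff

lemma feasible_of_prof {f : Act 𝓔 Z} (hf : WellUnderstood R f) {φ : Ω → ℝ} {a b : ℝ} (ha : 0 < a)
    (hp : prof u f = fun ω => a * φ ω + b) : Feasible R u φ := by
  obtain ⟨y, hy⟩ := (wellUnderstood_iff_hasCE (u := u)).1 hf
  exact ⟨(y - b) / a, f, a, b, ha, hp, by rw [mul_div_cancel₀ _ ha.ne', sub_add_cancel]; exact hy⟩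

lemma Feasible.affine {φ : Ω → ℝ} (hφ : Feasible R u φ) {a : ℝ} (ha : 0 < a) (b : ℝ) :
    Feasible R u (fun ω => a * φ ω + b) :=
  let ⟨_, hy⟩ := hφ
  ⟨_, hasVal_affine hy ha b⟩

lemma partition_of_affine (h : SatisfiesAxioms R u) {f : Act 𝓔 Z} {φ : Ω → ℝ} {a b : ℝ} (ha : 0 < a)
    (hf : prof u f = fun ω => a * φ ω + b) :
    partition R f = range fun ω => {ω' | φ ω' = φ ω} := by
  rw [h.utility.partition_eq, hf]
  simp only [add_left_inj, mul_right_inj' ha.ne']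

lemma exists_feasible_of_coarser (h : SatisfiesAxioms R u) {φ : Ω → ℝ} (hφ : Feasible R u φ)
    {X : Type*} {ψ : Ω → X} (hψ : IsSimple 𝓔 ψ) (hfac : ∀ ω ω', φ ω = φ ω' → ψ ω = ψ ω') :
    ∃ χ, Feasible R u χ ∧ ∀ ω ω', χ ω = χ ω' ↔ ψ ω = ψ ω' := by
  obtain ⟨a, b, f, -, ha, hf, -⟩ := h.exists_acts hφ.isSimple hφ.isSimple
  have hcl : (range fun ω => {ω' | ψ ω' = ψ ω}) = (Setoid.ker ψ).classes := by
    ext s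
    exact exists_congr fun ω => eq_comm
  obtain ⟨g, hg, hgp⟩ := h.simplicity.a1 f (hφ.wellUnderstood h ha hf)
    (range fun ω => {ω' | ψ ω' = ψ ω}) (hcl ▸ Setoid.isPartition_classes _) (by
      rintro _ ⟨ω, rfl⟩; exact hψ.2 {ψ ω}) (by
      rw [h.partition_of_affine ha hf]
      rintro _ ⟨ω, rfl⟩
      exact ⟨_, ⟨ω, rfl⟩, fun ω' hω' => hfac _ _ hω'⟩)
  rw [h.utility.partition_eq] at hgp
  exact ⟨prof u g, h.feasible_prof_iff.2 hg, eq_iff_of_range_fiber_eq hgp⟩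

lemma exists_factor {X Y : Type*} [Nonempty Y] {φ : Ω → X} {ψ : Ω → Y}
    (h : ∀ ω ω', φ ω = φ ω' → ψ ω = ψ ω') : ∃ k : X → Y, ψ = fun ω => k (φ ω) := by
  refine ⟨Function.extend φ ψ fun _ => Classical.arbitrary Y, ?_⟩
  ext ω
  exact (Function.FactorsThrough.extend_apply (fun ω ω' h' => h ω ω' h') _ ω).symm

-- This is A2 for a rescaled act f: the profile ψ belongs to the act that equals f except on the
-- cells in S, where it pays the lottery of f at ω₀.
open Classical in
lemma feasible_contract (h : SatisfiesAxioms R u) {φ ψ : Ω → ℝ} (hφ : Feasible R u φ)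
    (hψ : Feasible R u ψ) {S : Set ℝ} {ω₀ : Ω}
    (hψφ : ψ = fun ω => if φ ω ∈ S then φ ω₀ else φ ω) {t : ℝ} (h0 : 0 < t) (h1 : t < 1) :
    Feasible R u (fun ω => t * φ ω + (1 - t) * ψ ω) := by
  obtain ⟨a, b, f, -, ha, hf, -⟩ := h.exists_acts hφ.isSimple hφ.isSimple
  let E : 𝓔 := ⟨φ ⁻¹' S, hφ.isSimple.2 S⟩
  set g := Act.splice E (.const 𝓔 (f ω₀)) f with hgdef
  have hg : prof u g = fun ω => a * ψ ω + b := by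
    rw [hgdef, prof_splice, hψφ]
    ext ω
    have hmem : ω ∈ (E : Set Ω) ↔ φ ω ∈ S := Iff.rfl
    have hω₀ : Lottery.eu u (f ω₀) = a * φ ω₀ + b := congrFun hf ω₀
    by_cases hω : φ ω ∈ S
    · simp only [hmem, hω, if_true, prof_const]; exact hω₀
    · simp only [hmem, hω, if_false, hf]
  have hw := h.simplicity.a2 f g (hφ.wellUnderstood h ha hf) (by
      rw [h.partition_of_affine ha hf]
      rintro _ ⟨ω, rfl⟩ ω₁ hω₁ ω₂ hω₂
      rw [h.utility.indiff_iff]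
      have h12 : φ ω₁ = φ ω₂ := Eq.trans hω₁ (Eq.symm hω₂)
      have : prof u g ω₁ = prof u g ω₂ := by rw [hg, hψφ]; simp only [h12]
      exact this) ⟨f ω₀, ⟨ω₀, rfl⟩, fun ω => by
      by_cases hω : ω ∈ (E : Set Ω)
      · exact Or.inr (if_pos hω)
      · exact Or.inl (if_neg hω)⟩ (hψ.wellUnderstood h ha hg) ⟨t, h0.le, h1.le⟩ h0 h1
  refine feasible_of_prof hw ha (b := b) ?_
  rw [prof_mix, hf, hg]
  ext ω
  ring

/-- Feasibility depends only on the partition, and passes to coarser partitions. -/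
lemma Feasible.of_factor (h : SatisfiesAxioms R u) {φ : Ω → ℝ} (hφ : Feasible R u φ) {ψ : Ω → ℝ}
    (hfac : ∀ ω ω', φ ω = φ ω' → ψ ω = ψ ω') : Feasible R u ψ := by
  classical
  induction hn : (range φ).ncard using Nat.strong_induction_on generalizing φ ψ with
  | _ n ih =>
  have hψs : IsSimple 𝓔 ψ := by
    obtain ⟨k, hk⟩ := exists_factor hfac
    rw [hk]; exact hφ.isSimple.comp k
  have hfin := hφ.isSimple.1
  -- functions that identify two values of `φ`
  have hcoarse : ∀ ψ : Ω → ℝ, (∀ ω ω', φ ω = φ ω' → ψ ω = ψ ω') →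
      (∃ ω ω', φ ω ≠ φ ω' ∧ ψ ω = ψ ω') → Feasible R u ψ := by
    intro ψ hfac ⟨ω₁, ω₂, hne, heq⟩
    obtain ⟨k, hk⟩ := exists_factor hfac
    obtain ⟨χ, hχ, hχψ⟩ := h.exists_feasible_of_coarser hφ (hk ▸ hφ.isSimple.comp k) hfac
    refine ih _ ?_ hχ (fun ω ω' => (hχψ ω ω').1) rfl
    obtain ⟨k', hk'⟩ := exists_factor (φ := φ) (ψ := χ) fun ω ω' h' => (hχψ ω ω').2 (hfac ω ω' h')
    have himg : range χ = k' '' range φ := by rw [hk', ← range_comp]; rfl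
    rw [← hn, himg]
    refine lt_of_le_of_ne (ncard_image_le hfin) fun heq' => hne ?_
    refine injOn_of_ncard_image_eq heq' hfin ⟨ω₁, rfl⟩ ⟨ω₂, rfl⟩ ?_
    have := (hχψ ω₁ ω₂).2 heq
    rw [hk'] at this
    exact this
  -- With at most two cells A0 suffices. With three or more there are enough coordinates for the
  -- lemma on contraction-stable sets.
  rcases le_or_gt n 2 with hn2 | hn3
  · refine h.exists_hasVal_of_encard_le_two hψs ?_
    obtain ⟨k, hk⟩ := exists_factor hfac
    have himg : range ψ = k '' range φ := by rw [hk, ← range_comp]; rfl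
    rw [himg]
    refine (encard_image_le _ _).trans ?_
    rw [← hfin.cast_ncard_eq, hn]
    exact_mod_cast hn2
  · have : Fintype (range φ) := hfin.fintype
    let val : (range φ → ℝ) → Ω → ℝ := fun v ω => v ⟨φ ω, ω, rfl⟩
    have hval : ∀ v : range φ → ℝ, ∀ ω ω', φ ω = φ ω' → val v ω = val v ω' := by
      intro v ω ω' h'
      simp only [val, h']
    -- Vectors assign values to the cells of φ. Those with a repetition merge cells and are settled
    -- by A1 and induction, contractions come from A2, and φ itself is an injective member.
    have hstable : ContractionStable {v : range φ → ℝ | Feasible R u (val v)} := by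
      have hni : ∀ v : range φ → ℝ, ¬ Function.Injective v → Feasible R u (val v) := by
        intro v hv
        simp only [Function.Injective, not_forall] at hv
        obtain ⟨⟨_, ω₁, rfl⟩, ⟨_, ω₂, rfl⟩, h1, h2⟩ := hv
        exact hcoarse _ (hval v) ⟨ω₁, ω₂, fun h' => h2 (Subtype.ext h'), h1⟩
      refine ⟨hni, fun v hv a b ha => Feasible.affine hv ha b, fun v hv hinj S j t h0 h1 => ?_⟩
      obtain ⟨_, ω₀, rfl⟩ := j
      -- If S has an index other than j, giving S the value at j repeats a value, so A2 has its
      -- feasible partner. Otherwise the contraction is the identity.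
      by_cases hS : ∃ i ∈ S, i ≠ (⟨φ ω₀, ω₀, rfl⟩ : range φ)
      · obtain ⟨i, hi, hne⟩ := hS
        have hw : Feasible R u (val fun i => if i ∈ S then v ⟨φ ω₀, ω₀, rfl⟩ else v i) := by
          exact hni (fun i => if i ∈ S then v ⟨φ ω₀, ω₀, rfl⟩ else v i)
            fun hinj' => hne (hinj' (by simp [hi]))
        have := h.feasible_contract (S := v '' (S : Set (range φ))) (ω₀ := ω₀) hv hw (by
          ext ω
          simp only [val, hinj.mem_set_image, Finset.mem_coe]) h0 h1
        change Feasible R u _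
        convert this using 1
        ext ω
        simp only [val]
        split_ifs <;> ring
      · push Not at hS
        change Feasible R u _
        have hv' : Feasible R u (val v) := hv
        convert hv' using 1
        ext ω
        simp only [val]
        split_ifs with hω
        · rw [hS _ hω]; ring
        · rfl
    have hcard : 3 ≤ Fintype.card (range φ) := by
      rw [← Nat.card_eq_fintype_card, Nat.card_coe_set_eq, hn]; exact hn3
    obtain ⟨k, hk⟩ := exists_factor hfac
    have := hstable.mem_of_injective_mem hcard (v := Subtype.val) hφ Subtype.val_injective
      fun i => k i
    rw [hk]
    exact this

open Classical in
/-- Well-understood acts are evaluated by their expected utility. -/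
lemma Feasible.hasVal_integ (h : SatisfiesAxioms R u) {φ : Ω → ℝ} (hφ : Feasible R u φ) :
    HasVal R u φ (h.prob.integ φ) := by
  have hs := hφ.isSimple
  have hmem : ∀ ω, φ ω ∈ hs.1.toFinset := fun ω => hs.1.mem_toFinset.2 ⟨ω, rfl⟩
  -- Add one cell at a time. Every partial sum is a function of φ and hence feasible, which is what
  -- additivity of values requires.
  have key : ∀ t : Finset ℝ, HasVal R u (fun ω => if φ ω ∈ t then φ ω else 0)
      (∑ v ∈ t, h.prob.pr (φ ⁻¹' {v}) * v) := by
    intro t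
    induction t using Finset.induction_on with
    | empty => simpa using h.hasVal_const (Ω := Ω) 0
    | insert v t hv ih =>
      obtain ⟨w, hw⟩ := hφ.of_factor h (ψ := fun ω => if φ ω ∈ insert v t then φ ω else 0)
        fun ω ω' h' => by simp only [h']
      have h1 := h.hasVal_ite (hs.2 {v}) v 0
      have h2 : (fun ω => if φ ω ∈ insert v t then φ ω else 0)
          = fun ω => (if ω ∈ φ ⁻¹' {v} then v else 0) + if φ ω ∈ t then φ ω else 0 := by
        ext ω
        by_cases h' : φ ω = v
        · simp [h', hv]
        · simp [h']
      have h3 := h.hasVal_add h1 ih (h2 ▸ hw)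
      rw [Finset.sum_insert hv]
      rw [h3, mul_zero, add_zero] at hw
      exact hw
  have := key hs.1.toFinset
  rw [h.prob.integ_comp hs (fun x => x) hmem]
  simpa only [hmem, if_true] using this

/-- A4, applied to acts realising φ and ψ on a common scale. -/
lemma Feasible.congr (h : SatisfiesAxioms R u) {φ ψ : Ω → ℝ} (hφ : Feasible R u φ)
    (hψ : IsSimple 𝓔 ψ) {E : Set Ω} (hE : h.prob.IsNull E) (heq : ∀ ω ∉ E, φ ω = ψ ω) :
    Feasible R u ψ := by
  obtain ⟨F, hF, hF0, hEF⟩ := hE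
  obtain ⟨a, b, f, g, ha, hf, hg⟩ := h.exists_acts hφ.isSimple hψ
  obtain ⟨c, hc⟩ := hφ.wellUnderstood h ha hf
  have h1 := h.simplicity.a4 f ⟨c, hc⟩ ⟨F, hF⟩ ((h.null_iff _).2 hF0) g
  have h2 : WellUnderstood R (Act.splice ⟨F, hF⟩ g f) :=
    ⟨c, h.rel_trans h1.1 hc.1, h.rel_trans hc.2 h1.2⟩
  refine feasible_of_prof h2 ha (b := b) ?_
  ext ω
  by_cases hω : ω ∈ F
  · rw [prof_splice_of_mem u (E := ⟨F, hF⟩) g f hω, hg]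
  · rw [prof_splice_of_notMem u (E := ⟨F, hF⟩) g f hω, hf]
    simp only [heq ω fun h' => hω (hEF h')]

/-- Moving mass between two essential cells preserves feasibility. -/
lemma Feasible.exchange (h : SatisfiesAxioms R u) {φ ψ : Ω → ℝ} (hφ : Feasible R u φ)
    (hψ : IsSimple 𝓔 ψ) {i j : ℝ} (hij : i ≠ j) (hi : i ∈ h.prob.essVals φ)
    (hj : j ∈ h.prob.essVals φ) (hi' : i ∈ range ψ) (hj' : j ∈ range ψ)
    (hor : ∀ ω, ψ ω = i ∨ ψ ω = j ↔ φ ω = i ∨ φ ω = j)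
    (hother : ∀ ω v, v ≠ i → v ≠ j → (ψ ω = v ↔ φ ω = v)) : Feasible R u ψ := by
  obtain ⟨a, b, f, -, ha, hf, -⟩ := h.exists_acts hφ.isSimple hφ.isSimple
  have hpart := h.partition_of_affine ha hf
  obtain ⟨ω₁, h₁⟩ := Prob.essVals_subset_range _ hi
  obtain ⟨ω₂, h₂⟩ := Prob.essVals_subset_range _ hj
  have hnull : ∀ {v} (hv : v ∈ h.prob.essVals φ), ¬ Null R ⟨φ ⁻¹' {v}, hφ.isSimple.2 {v}⟩ :=
    fun hv hn => hv ((Prob.isNull_iff (hφ.isSimple.2 _)).2 ((h.null_iff _).1 hn))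
  have hcell : ∀ {v ω}, φ ω = v → φ ⁻¹' {v} = {ω' | φ ω' = φ ω} := by
    rintro _ ω rfl; rfl
  have hcell' : ∀ {v ω}, ψ ω = v → ψ ⁻¹' {v} = {ω' | ψ ω' = ψ ω} := by
    rintro _ ω rfl; rfl
  obtain ⟨g, hg, hgp⟩ := h.simplicity.a3 f (hφ.wellUnderstood h ha hf)
    ⟨φ ⁻¹' {i}, hφ.isSimple.2 {i}⟩ ⟨φ ⁻¹' {j}, hφ.isSimple.2 {j}⟩
    (by rw [hpart]; exact ⟨ω₁, (hcell h₁).symm⟩) (by rw [hpart]; exact ⟨ω₂, (hcell h₂).symm⟩)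
    (fun h' => hij (by
      have : ω₁ ∈ φ ⁻¹' {j} := by
        have hset : φ ⁻¹' {i} = φ ⁻¹' {j} := congrArg Subtype.val h'
        rw [← hset]; exact h₁
      exact h₁.symm.trans this)) (hnull hi) (hnull hj)
    ⟨ψ ⁻¹' {i}, hψ.2 {i}⟩ ⟨ψ ⁻¹' {j}, hψ.2 {j}⟩
    (let ⟨ω, hω⟩ := hi'; ⟨ω, hω⟩) (let ⟨ω, hω⟩ := hj'; ⟨ω, hω⟩)
    (Set.disjoint_left.2 fun ω h1 h2 => hij ((show ψ ω = i from h1).symm.trans h2))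
    (by ext ω; exact hor ω)
  have hgψ : partition R g = range fun ω => {ω' | ψ ω' = ψ ω} := by
    rw [hgp, hpart]
    dsimp only
    have hfib : ∀ v, v ≠ i → v ≠ j → {ω' | ψ ω' = v} = {ω' | φ ω' = v} := fun v h1 h2 => by
      ext ω; exact hother ω v h1 h2
    ext A
    constructor
    · rintro ((rfl | h') | ⟨⟨ω, rfl⟩, h'⟩)
      · obtain ⟨ω, hω⟩ := hi'
        exact ⟨ω, (hcell' hω).symm⟩
      · rw [mem_singleton_iff] at h'
        obtain ⟨ω, hω⟩ := hj'
        exact ⟨ω, h' ▸ (hcell' hω).symm⟩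
      · dsimp only at h' ⊢
        have hvi : φ ω ≠ i := fun hv => h' (Or.inl (hcell hv).symm)
        have hvj : φ ω ≠ j := fun hv => h' (Or.inr (hcell hv).symm)
        exact ⟨ω, by dsimp only; rw [(hother ω _ hvi hvj).2 rfl, hfib _ hvi hvj]⟩
    · rintro ⟨ω, rfl⟩
      dsimp only
      by_cases hvi : ψ ω = i
      · exact Or.inl (Or.inl (hcell' hvi).symm)
      by_cases hvj : ψ ω = j
      · exact Or.inl (Or.inr (hcell' hvj).symm)
      have hφω := (hother ω _ hvi hvj).1 rfl
      refine Or.inr ⟨⟨ω, by dsimp only; rw [hfib _ hvi hvj, hφω]⟩, ?_⟩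
      rw [hfib _ hvi hvj]
      rintro (h' | h')
      · have : ω ∈ φ ⁻¹' {i} := by rw [← h']; exact hφω
        exact hvi (hφω ▸ this)
      · rw [mem_singleton_iff] at h'
        have : ω ∈ φ ⁻¹' {j} := by rw [← h']; exact hφω
        exact hvj (hφω ▸ this)
  rw [h.utility.partition_eq] at hgψ
  exact (h.feasible_prof_iff.2 hg).of_factor h fun ω ω' => (eq_iff_of_range_fiber_eq hgψ ω ω').1

/-- All partitions into the same number of essential cells are feasible if one is. -/
lemma Feasible.of_encard_eq (h : SatisfiesAxioms R u) {φ χ : Ω → ℝ} (hχ : Feasible R u χ)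
    (hφ : IsSimple 𝓔 φ) (hχe : range χ ⊆ h.prob.essVals χ) (hφe : range φ ⊆ h.prob.essVals φ)
    (hcard : (range χ).encard = (range φ).encard) : Feasible R u φ := by
  classical
  obtain ⟨e, he⟩ := hχ.isSimple.1.exists_bijOn_of_encard_eq hcard
  have hκ₀ : IsSimple 𝓔 fun ω => (χ ω, φ ω) := hχ.isSimple.prodMk hφ
  -- The cells of positive probability in the common refinement. Up to null sets, both partitions
  -- are labellings of X.
  let X := h.prob.essVals fun ω => (χ ω, φ ω)
  have hXfin : Finite X := hκ₀.1.subset (Prob.essVals_subset_range _)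
  obtain ⟨k, hk, hk'⟩ := Prob.exists_range_subset_essVals (P := h.prob) hκ₀
  have hnull := Prob.isNull_notMem_essVals (P := h.prob) hκ₀
  -- Null cells are sent into an essential one, so every fibre of κ is non-null.
  let κ : Ω → X := fun ω => ⟨k (χ ω, φ ω), hk ⟨ω, rfl⟩⟩
  have hκ : IsSimple 𝓔 κ := by
    refine ⟨toFinite _, fun s => ?_⟩
    have : κ ⁻¹' s = (fun ω => k (χ ω, φ ω)) ⁻¹' (Subtype.val '' s) := by
      ext ω
      exact ⟨fun h' => ⟨κ ω, h', rfl⟩, fun ⟨x, hx, hx'⟩ => by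
        obtain rfl : x = κ ω := Subtype.ext hx'
        exact hx⟩
    rw [this]
    exact (hκ₀.comp k).2 _
  have hfib : ∀ x : X, ¬ h.prob.IsNull (κ ⁻¹' {x}) := by
    intro x hx
    refine x.2 ((hx.union hnull).mono fun ω hω => ?_)
    by_cases hω' : ω ∈ {ω | (χ ω, φ ω) ∉ h.prob.essVals fun ω => (χ ω, φ ω)}
    · exact Or.inr hω'
    · exact Or.inl (Subtype.ext ((hk' ω hω').trans hω))
  have hκsurj : ∀ x : X, ∃ ω, κ ω = x := by
    intro x
    by_contra! hx
    exact hfib x (Prob.isNull_empty.mono fun ω hω => hx ω hω)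
  have hX1 : ∀ x : X, x.1.1 ∈ range χ := fun x => by
    obtain ⟨ω, hω⟩ := Prob.essVals_subset_range _ x.2
    exact ⟨ω, congrArg Prod.fst hω⟩
  have hX2 : ∀ x : X, x.1.2 ∈ range φ := fun x => by
    obtain ⟨ω, hω⟩ := Prob.essVals_subset_range _ x.2
    exact ⟨ω, congrArg Prod.snd hω⟩
  let p : X → range φ := fun x => ⟨e x.1.1, he.1 (hX1 x)⟩
  let q : X → range φ := fun x => ⟨x.1.2, hX2 x⟩
  have hp : Function.Surjective p := by
    rintro ⟨v, hv⟩
    obtain ⟨a, ha, rfl⟩ := he.2.2 hv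
    obtain ⟨x, hx, rfl⟩ := Prob.essVals_comp_subset hκ₀ Prod.fst (hχe ha)
    exact ⟨⟨x, hx⟩, rfl⟩
  have hq : Function.Surjective q := by
    rintro ⟨v, hv⟩
    obtain ⟨x, hx, rfl⟩ := Prob.essVals_comp_subset hκ₀ Prod.snd (hφe hv)
    exact ⟨⟨x, hx⟩, rfl⟩
  have hsimple : ∀ r : X → range φ, IsSimple 𝓔 fun ω => (r (κ ω) : ℝ) := fun r =>
    hκ.comp fun x => (r x : ℝ)
  -- The labelling p encodes χ, relabelled by e, and q encodes φ. Relabelling preserves the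
  -- partition, and changing one label moves an essential cell between two non-null classes, which
  -- A3 allows.
  have hqF := surjective_mem_of_update_mem
    (F := {r : X → range φ | Feasible R u fun ω => (r (κ ω) : ℝ)})
    (fun r hr σ => Feasible.of_factor h hr fun ω ω' h' => by
      dsimp only
      rw [Subtype.ext h']) (fun r hr x j hrs hrs' => ?_) (p := p) (q := q) ?_ hp hq
  · refine Feasible.congr h hqF hφ hnull fun ω hω => ?_
    simp only [q, κ, hk' ω hω]
  · by_cases hj : j = r x
    · rw [hj, Function.update_eq_self]; exact hr
    have hess : ∀ l : range φ, (l : ℝ) ∈ h.prob.essVals fun ω => (r (κ ω) : ℝ) := by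
      intro l hn
      obtain ⟨y, rfl⟩ := hrs l
      exact hfib y (hn.mono fun ω hω => by
        have : κ ω = y := hω
        change (r (κ ω) : ℝ) = r y
        rw [this])
    have hran : ∀ l : range φ, (l : ℝ) ∈ range fun ω => (Function.update r x j (κ ω) : ℝ) := by
      intro l
      obtain ⟨y, hy⟩ := hrs' l
      obtain ⟨ω, rfl⟩ := hκsurj y
      exact ⟨ω, congrArg Subtype.val hy⟩
    refine Feasible.exchange h hr (hsimple _) (i := r x) (j := j)
      (fun h' => hj (Subtype.ext h').symm) (hess _) (hess _) (hran _) (hran _) (fun ω => ?_)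
      fun ω v hv1 hv2 => ?_
    · by_cases hω : κ ω = x
      · simp [hω]
      · rw [Function.update_of_ne hω]
    · by_cases hω : κ ω = x
      · rw [hω, Function.update_self]
        exact iff_of_false hv2.symm hv1.symm
      · rw [Function.update_of_ne hω]
  · have h1 : Feasible R u fun ω => e (χ ω) := hχ.of_factor h fun ω ω' h' => by rw [h']
    refine Feasible.congr h h1 (hsimple p) hnull fun ω hω => ?_
    simp only [p, κ, hk' ω hω]

/-- The number of cells that a well-understood act can distinguish. -/
def bound (h : SatisfiesAxioms R u) : ℕ∞ :=
  max 2 (sSup ((fun φ => (h.prob.essVals φ).encard) '' {φ : Ω → ℝ | Feasible R u φ}))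

/-- Given φ with m essential values, discard the null cells. If m ≤ 2, A0 applies. Otherwise some
feasible function has at least m essential values. Merging cells brings it to exactly m, and all
partitions into m essential cells are feasible together. -/
lemma feasible_iff (h : SatisfiesAxioms R u) {φ : Ω → ℝ} (hφ : IsSimple 𝓔 φ) :
    Feasible R u φ ↔ (h.prob.essVals φ).encard ≤ h.bound := by
  classical
  constructor
  · exact fun hf => le_trans (le_sSup (mem_image_of_mem (fun φ => (h.prob.essVals φ).encard) hf))
      (le_max_right _ _)
  intro hle
  obtain ⟨k, hk, hk'⟩ := Prob.exists_range_subset_essVals (P := h.prob) hφ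
  have hnull := Prob.isNull_notMem_essVals (P := h.prob) hφ
  set φ' := fun ω => k (φ ω) with hφ'
  have hess : h.prob.essVals φ' = h.prob.essVals φ := Prob.essVals_congr hnull hk'
  have hran : range φ' = h.prob.essVals φ :=
    subset_antisymm hk (hess ▸ Prob.essVals_subset_range φ')
  suffices hf : Feasible R u φ' from hf.congr h hφ hnull hk'
  rcases le_or_gt (h.prob.essVals φ).encard 2 with h2 | h2
  · exact h.exists_hasVal_of_encard_le_two (hφ.comp k) (hran ▸ h2)
  have hsup : (h.prob.essVals φ).encard
      ≤ sSup ((fun φ => (h.prob.essVals φ).encard) '' {φ : Ω → ℝ | Feasible R u φ}) :=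
    (le_max_iff.1 hle).resolve_left (not_le.2 h2)
  obtain ⟨m, hm⟩ := (hφ.1.subset (Prob.essVals_subset_range φ)).exists_encard_eq_coe
  obtain ⟨χ, hχ, hmχ⟩ : ∃ χ : Ω → ℝ, Feasible R u χ ∧ (m : ℕ∞) ≤ (h.prob.essVals χ).encard := by
    rw [hm] at hsup h2
    have hm2 : 2 < m := by exact_mod_cast h2
    -- The supremum may be infinite and not attained. Being strictly above m - 1, it still yields a
    -- feasible function with at least m essential values.
    have hlt : ((m - 1 : ℕ) : ℕ∞)
        < sSup ((fun φ => (h.prob.essVals φ).encard) '' {φ : Ω → ℝ | Feasible R u φ}) :=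
      lt_of_lt_of_le (by exact_mod_cast Nat.sub_lt (by omega) one_pos) hsup
    obtain ⟨_, ⟨χ, hχ, rfl⟩, hlt⟩ := lt_sSup_iff.1 hlt
    refine ⟨χ, hχ, ?_⟩
    have := Order.add_one_le_of_lt hlt
    have hm' : ((m - 1 : ℕ) : ℕ∞) + 1 = m := by
      exact_mod_cast Nat.sub_add_cancel (by omega : 1 ≤ m)
    rwa [hm'] at this
  obtain ⟨s, hs, hsm⟩ := exists_subset_encard_eq hmχ
  obtain ⟨v₀, hv₀⟩ : s.Nonempty := by
    rw [← encard_pos, hsm, ← hm]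
    exact lt_of_le_of_lt (by norm_num) h2
  set χ' : Ω → ℝ := fun ω => if χ ω ∈ s then χ ω else v₀ with hχ'
  have hf' : Feasible R u χ' := hχ.of_factor h fun ω ω' h' => by simp only [χ', h']
  have hsub : range χ' ⊆ s := by
    rintro _ ⟨ω, rfl⟩
    simp only [χ']
    split_ifs with hω
    exacts [hω, hv₀]
  have hse : s ⊆ h.prob.essVals χ' := by
    intro v hv hn
    refine hs hv (hn.mono ?_)
    rintro ω rfl
    exact if_pos hv
  have hr : range χ' = s := subset_antisymm hsub (hse.trans (Prob.essVals_subset_range _))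
  refine hf'.of_encard_eq h (hφ.comp k) (hr.le.trans hse) ?_ ?_
  · rw [hess, hran]
  · rw [hr, hran, hsm, hm]

lemma wellUnderstood_iff (h : SatisfiesAxioms R u) {f : Act 𝓔 Z} :
    WellUnderstood R f ↔ (h.prob.essVals (prof u f)).encard ≤ h.bound := by
  rw [← h.feasible_prof_iff, h.feasible_iff (isSimple_prof u f)]

lemma hasCE_integ (h : SatisfiesAxioms R u) {f : Act 𝓔 Z} (hf : WellUnderstood R f) :
    HasCE R u f (h.prob.integ (prof u f)) :=
  h.hasVal_prof_iff.1 ((h.feasible_prof_iff.2 hf).hasVal_integ h)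

/-- Uniform Comparability interposes well-understood acts, whose bounds equal their integrals, so
monotonicity of the bounds gives one direction. For the other, the optimal N-valued acts, corrected
on null events, are themselves well-understood and can be interposed. -/
lemma isBoundRep (h : SatisfiesAxioms R u) : IsBoundRep R h.bound h.prob u := by
  have h2 : 2 ≤ h.bound := le_max_left _ _
  have hN : 1 ≤ h.bound := le_trans (by norm_num) h2
  have hu := h.utility
  refine ⟨h2, h.nonconstant, fun f g => ⟨fun hfg => ?_, ?_⟩⟩
  · by_cases hdom : Dominates R f g
    · exact Or.inl (hu.dominates_iff.1 hdom)
    obtain ⟨k, l, hk, hl, h1, h2, h3⟩ := (h.uniform f g hdom).1 hfg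
    right
    rw [h.rel_iff_of_hasCE (h.hasCE_integ hk) (h.hasCE_integ hl)] at h2
    calc h.prob.upper h.bound (prof u g) ≤ h.prob.upper h.bound (prof u l) :=
          Prob.upper_mono hN (isSimple_prof u g) (isSimple_prof u l) (.of_le (hu.dominates_iff.1 h3))
      _ = h.prob.integ (prof u l) :=
          Prob.upper_eq_integ_of_essVals hN (isSimple_prof u l) (h.wellUnderstood_iff.1 hl)
      _ ≤ h.prob.integ (prof u k) := h2
      _ = h.prob.lower h.bound (prof u k) :=
          (Prob.lower_eq_integ_of_essVals hN (isSimple_prof u k) (h.wellUnderstood_iff.1 hk)).symm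
      _ ≤ h.prob.lower h.bound (prof u f) :=
          Prob.lower_mono hN (isSimple_prof u k) (isSimple_prof u f) (.of_le (hu.dominates_iff.1 h1))
  · rintro (hle | hle)
    · exact h.rel_of_le hle
    obtain ⟨k, hk, ⟨E, hE, hE0, hEs⟩, hki⟩ := exists_act_lower h.prob u hN f
    obtain ⟨l, hl, ⟨F, hF, hF0, hFs⟩, hli⟩ := exists_act_upper h.prob u hN g
    have hEn : h.prob.IsNull E := ⟨E, hE, hE0, subset_rfl⟩
    have hFn : h.prob.IsNull F := ⟨F, hF, hF0, subset_rfl⟩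
    have hkE : ∀ ω ∉ E, prof u (Act.splice ⟨E, hE⟩ f k) ω = prof u k ω :=
      fun ω hω => prof_splice_of_notMem u (E := ⟨E, hE⟩) f k hω
    have hlF : ∀ ω ∉ F, prof u (Act.splice ⟨F, hF⟩ g l) ω = prof u l ω :=
      fun ω hω => prof_splice_of_notMem u (E := ⟨F, hF⟩) g l hω
    have hkw : WellUnderstood R (Act.splice ⟨E, hE⟩ f k) := by
      rw [h.wellUnderstood_iff, Prob.essVals_congr hEn hkE]
      exact Prob.essVals_encard_le_of_range hk
    have hlw : WellUnderstood R (Act.splice ⟨F, hF⟩ g l) := by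
      rw [h.wellUnderstood_iff, Prob.essVals_congr hFn hlF]
      exact Prob.essVals_encard_le_of_range hl
    refine h.rel_trans (h.rel_of_le fun ω => ?_) (h.rel_trans
      ((h.rel_iff_of_hasCE (h.hasCE_integ hkw) (h.hasCE_integ hlw)).2 ?_)
      (h.rel_of_le fun ω => ?_))
    · by_cases hω : ω ∈ E
      · exact (prof_splice_of_mem u (E := ⟨E, hE⟩) f k hω).le
      · exact (hkE ω hω).le.trans (not_lt.1 fun h' => hω (hEs h'))
    · rw [Prob.integ_congr (isSimple_prof u _) (isSimple_prof u k) hEn hkE,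
        Prob.integ_congr (isSimple_prof u _) (isSimple_prof u l) hFn hlF, hki, hli]
      exact hle
    · by_cases hω : ω ∈ F
      · exact (prof_splice_of_mem u (E := ⟨F, hF⟩) g l hω).ge
      · exact le_trans (not_lt.1 fun h' => hω (hFs h')) (hlF ω hω).ge

end SatisfiesAxioms

lemma axioms_iff_exists_isSimpleBoundsRep :
    (BasicConditions R ∧ SimplicityConditions R ∧ SIndependence R ∧ UniformComparability R) ↔
      ∃ (N : ℕ∞) (P : Prob 𝓔) (u : Z → ℝ), IsSimpleBoundsRep R N P u := by
  constructor
  · rintro ⟨h1, h2, h3, h4⟩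
    obtain ⟨u, hu⟩ := h1.isVNM.exists_utility
    have h : SatisfiesAxioms R u := ⟨h1, h2, h3, h4, hu⟩
    exact ⟨h.bound, h.prob, u, h.isBoundRep.isSimpleBoundsRep⟩
  · rintro ⟨N, P, u, hr⟩
    rw [isSimpleBoundsRep_iff_isBoundRep] at hr
    exact ⟨hr.basicConditions, hr.simplicityConditions, hr.sIndependence, hr.uniformComparability⟩

end SimpleBounds

end

theorem theorem3 {Ω Z : Type*} (𝓔 : BooleanSubalgebra (Set Ω))
    (R : SimpleBounds.Act 𝓔 Z → SimpleBounds.Act 𝓔 Z → Prop) :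
    ((SimpleBounds.BasicConditions R ∧ SimpleBounds.SimplicityConditions R ∧
        SimpleBounds.SIndependence R ∧ SimpleBounds.UniformComparability R) ↔
      ∃ (N : ℕ∞) (P : SimpleBounds.Prob 𝓔) (u : Z → ℝ),
        SimpleBounds.IsSimpleBoundsRep R N P u) ∧
    (∀ (N : ℕ∞) (P : SimpleBounds.Prob 𝓔) (u : Z → ℝ),
      SimpleBounds.IsSimpleBoundsRep R N P u ↔ SimpleBounds.IsExplicitRep R N P u) ∧
    (∀ (N : ℕ∞) (P : SimpleBounds.Prob 𝓔) (u : Z → ℝ),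
      SimpleBounds.IsSimpleBoundsRep R N P u →
        (∀ (N' : ℕ∞) (P' : SimpleBounds.Prob 𝓔) (u' : Z → ℝ),
          SimpleBounds.IsSimpleBoundsRep R N' P' u' →
            P' = P ∧ ∃ a b : ℝ, 0 < a ∧ ∀ z, u' z = a * u z + b) ∧
        (∀ a b : ℝ, 0 < a → SimpleBounds.IsSimpleBoundsRep R N P fun z => a * u z + b) ∧
        ∀ f, (SimpleBounds.simInf R N f).Nonempty ∧ (SimpleBounds.simSup R N f).Nonempty) := by
  exact ⟨SimpleBounds.axioms_iff_exists_isSimpleBoundsRep,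
    fun _ _ _ => SimpleBounds.isSimpleBoundsRep_iff_isExplicitRep,
    fun _ _ _ hr => ⟨fun _ _ _ hr' => hr.unique hr', fun _ b ha => hr.affine ha b,
      fun f => ⟨(hr.lower f).1, (hr.upper f).1⟩⟩⟩
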